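/- Let $d\ge 1$ and $N>d$ be integers, and let $\theta(0),\theta(1),\dots$ be a Markov chain on a probability space with values in $\Theta=\{1,\dots,L\}$ and transition probabilities $\lambda_{ij}$, such that $\mathrm P(\theta(k)=i)>0$ for all $0\le k\le N-d$ and $i\in\Theta$. Put $\mathcal G_k=\sigma(\theta(0),\dots,\theta(k))$. Consider $$x(k+1)=A_{\theta(k)}(k)x(k)+B_{\theta(k)}(k)u(k-d),\qquad k=0,\dots,N,$$ with $x(k)\in\mathbb R^n$, $u(k)\in\mathbb R^m$, given deterministic $x(0)=x_0$ and $u(-d),\dots,u(-1)$, and the cost $$J_N=\mathrm E\Big[\sum_{k=0}^N x(k)'Q_{\theta(k)}(k)x(k)+\sum_{k=d}^N u(k-d)'R_{\theta(k)}(k)u(k-d)+x(N+1)'P_{\theta(N+1)}(N+1)x(N+1)\Big],$$ where $Q_i(k)\ge0$, $R_i(k)\ge0$ and $P_i(N+1)$ is symmetric. Problem 1 is to minimize $J_N$ over the controls $(u(0),\dots,u(N-d))$ with $u(k)$ $\mathcal G_k$-measurable; uniqueness is understood up to almost sure equality. The time arguments of $A,B,Q,R,P$ and of the matrices defined below are omitted: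 the index of the mode $l_k$ shows the time $k$. For $a<b$ write $$\Lambda_{l_a,l_b}[f]=\sum_{l_{a+1}=1}^L\lambda_{l_a,l_{a+1}}\cdots\sum_{l_b=1}^L\lambda_{l_{b-1},l_b}\,f,$$ and $F_{l_b,l_a}=A_{l_b}\cdots A_{l_a}$ for $a\le b$, $F_{l_b,l_{b+1}}=I$. Define matrices backward in time as follows, where $(\cdot)^{-1}$ is replaced by $0$ at a singular matrix. For $k=N,\dots,d$, $$W_{l_{k-d}}=\Lambda_{l_{k-d},l_k}[B_{l_k}'(P_{l_k}-P^0_{l_k})B_{l_k}+R_{l_k}]-\sum_{s=1}^{d-1}\Lambda_{l_{k-d},l_{k-s}}[(T^s_{l_{k-s}})'W^{-1}_{l_{k-s}}T^s_{l_{k-s}}],$$ $$T^0_{l_{k-d}}=\Lambda_{l_{k-d},l_k}[B_{l_k}'(P_{l_k}-P^0_{l_k})F_{l_k,l_{k-d+1}}]-\sum_{s=1}^{d-1}\Lambda_{l_{k-d},l_{k-s}}[(T^s_{l_{k-s}})'W^{-1}_{l_{k-s}}T^0_{l_{k-s}}F_{l_{k-s},l_{k-d+1}}],$$ and for $1\le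 j\le d-1$ $$T^j_{l_{k-d}}=\Lambda_{l_{k-d},l_k}[B_{l_k}'(P_{l_k}-P^0_{l_k})F_{l_k,l_{k-d+j+1}}B_{l_{k-d+j}}]-\sum_{s=1}^{d-j}\Lambda_{l_{k-d},l_{k-s}}[(T^s_{l_{k-s}})'W^{-1}_{l_{k-s}}T^0_{l_{k-s}}F_{l_{k-s},l_{k-d+j+1}}B_{l_{k-d+j}}]-\sum_{s=d-j+1}^{d-1}\Lambda_{l_{k-d},l_{k-s}}[(T^s_{l_{k-s}})'W^{-1}_{l_{k-s}}T^{s-(d-j)}_{l_{k-s}}];$$ for $k=N,\dots,1$, $$P_{l_{k-1}}=\Lambda_{l_{k-1},l_k}[Q_{l_k}+A_{l_k}'(P_{l_k}-P^0_{l_k})A_{l_k}],\qquad P^0_{l_{k-1}}=(T^0_{l_{k-1}})'W^{-1}_{l_{k-1}}T^0_{l_{k-1}}.$$ The terminal values are $P_{l_N}=\Lambda_{l_N,l_{N+1}}[P_{l_{N+1}}]$ and, for $0\le i\le d-1$, $T^j_{l_{N-i}}=0$ ($0\le j\le d-1$) and $P^0_{l_{N-i}}=0$ (where $W_{l_{N-i}}$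 is immaterial; take it to be $0$). Define further, for $k=N,\dots,1$ and with $\delta^j_{l_N}=0$, $$(\delta^1_{l_{k-1}})'=\Lambda_{l_{k-1},l_k}[A_{l_k}'(P_{l_k}-P^0_{l_k})B_{l_k}]-(T^0_{l_{k-1}})'W^{-1}_{l_{k-1}}T^1_{l_{k-1}},$$ $$(\delta^j_{l_{k-1}})'=\Lambda_{l_{k-1},l_k}[A_{l_k}'(\delta^{j-1}_{l_k})']-(T^0_{l_{k-1}})'W^{-1}_{l_{k-1}}T^j_{l_{k-1}},\quad 2\le j\le d-1,$$ and, for $d\le k\le N+1$ and $1\le j\le d-1$, $$(\alpha^{d-j}_{l_{k-1},l_{k-j}})'=(\delta^{d-j}_{l_{k-1}})'-\sum_{s=1}^{j-1}(\alpha^{d-s}_{l_{k-1},l_{k-s}})'W^{-1}_{l_{k-s-1}}T^{d-j+s}_{l_{k-s-1}}.$$ Then Problem 1 has a unique optimal control if and only if $W_{l_{k-d}}>0$ for all $k=d,\dots,N$ and all $l_{k-d}\in\Theta$. In this case, with $l_t=\theta(t)$, and almost surely in (1) and (2): (1) the optimal control satisfies, for $k=d,\dots,N$, $$u(k-d)=-W^{-1}_{l_{k-d}}T^0_{l_{k-d}}x(k-d+1)-\sum_{j=1}^{d-1}W^{-1}_{l_{k-d}}T^j_{l_{k-d}}u(k-2d+j);$$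 (2) the optimal costate, defined along the optimal trajectory by $\lambda_N=\mathrm E[P_{\theta(N+1)}x(N+1)\mid\mathcal G_N]$ and $\lambda_{k-1}=\mathrm E[A_{\theta(k)}'\lambda_k+Q_{\theta(k)}x(k)\mid\mathcal G_{k-1}]$ for $k=N,\dots,1$, satisfies, for $k=d,\dots,N+1$, $$\lambda_{k-1}=(P_{l_{k-1}}-P^0_{l_{k-1}})x(k)-\sum_{s=1}^{d-1}(\alpha^{d-s}_{l_{k-1},l_{k-s}})'W^{-1}_{l_{k-s-1}}\mathrm E\{\alpha^{d-s}_{l_{k-1},l_{k-s}}x(k)\mid\mathcal G_{k-s-1}\};$$ (3) the optimal cost is $$J_N^*=\mathrm E\Big\{\sum_{k=0}^{d-1}x(k)'Q_{l_k}x(k)+x(d)'(P_{l_{d-1}}-P^0_{l_{d-1}})x(d)-x(d)'\sum_{s=1}^{d-1}(\alpha^{d-s}_{l_{d-1},l_{d-s}})'W^{-1}_{l_{d-s-1}}\mathrm E[\alpha^{d-s}_{l_{d-1},l_{d-s}}x(d)\mid\mathcal G_{d-s-1}]\Big\}.$$ -/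

import Mathlib

open MeasureTheory
open scoped Matrix

noncomputable section

/-- Data of a finite-horizon linear-quadratic problem for a Markov jump linear system with `L` modes
and `d`-step input delay. `lam` is the transition matrix, `PT` the terminal penalty `P_{N+1}`,
`x0` the known initial state, and `u0 i` (used for `-d ≤ i < 0` only) the known past inputs. -/
structure DelayedMJLS (n m L : ℕ) where
  d : ℕ
  N : ℕ
  A : ℕ → Fin L → Matrix (Fin n) (Fin n) ℝ
  B : ℕ → Fin L → Matrix (Fin n) (Fin m) ℝ
  Q : ℕ → Fin L → Matrix (Fin n) (Fin n) ℝ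
  R : ℕ → Fin L → Matrix (Fin m) (Fin m) ℝ
  PT : Fin L → Matrix (Fin n) (Fin n) ℝ
  lam : Matrix (Fin L) (Fin L) ℝ
  x0 : Fin n → ℝ
  u0 : ℤ → Fin m → ℝ

/-- `θ` is a Markov chain under `μ` with transition matrix `lam`
(and an arbitrary initial distribution). -/
structure IsMarkovChain {Ω : Type*} [MeasurableSpace Ω] {L : ℕ} (μ : Measure Ω)
    (θ : ℕ → Ω → Fin L) (lam : Matrix (Fin L) (Fin L) ℝ) : Prop where
  measurable : ∀ k, Measurable (θ k)
  nonneg : ∀ i j, 0 ≤ lam i j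
  sum_eq_one : ∀ i, ∑ j, lam i j = 1
  markov : ∀ (k : ℕ) (l : ℕ → Fin L),
    μ.real {ω | ∀ t ≤ k + 1, θ t ω = l t} =
      μ.real {ω | ∀ t ≤ k, θ t ω = l t} * lam (l k) (l (k + 1))

/-- The `σ`-algebra `𝒢_k` generated by `θ(0), …, θ(k)`. -/
@[reducible] def modeSigma {Ω : Type*} {L : ℕ} (θ : ℕ → Ω → Fin L) (k : ℕ) : MeasurableSpace Ω :=
  ⨆ t : Fin (k + 1), MeasurableSpace.comap (θ t) ⊤

/-- Iterated sum over the modes at times `a + 1, …, a + r`, weighted by transition probabilities;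
the mode at time `a` is read off the path `l`. -/
def pathSum {L : ℕ} {V : Type*} [AddCommMonoid V] [Module ℝ V] (lam : Matrix (Fin L) (Fin L) ℝ) :
    ℕ → ℕ → ((ℕ → Fin L) → V) → (ℕ → Fin L) → V
  | _, 0, f, l => f l
  | a, r + 1, f, l => ∑ j, lam (l a) j • pathSum lam (a + 1) r f (Function.update l (a + 1) j)

/-- The values at one time of the backward coupled difference Riccati recursion, as functions of the
mode: `W`, `T⁰`, `T^j` (for `1 ≤ j ≤ d - 1`) and `P`. -/
structure RiccatiData (n m L : ℕ) where
  W : Fin L → Matrix (Fin m) (Fin m) ℝ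
  T0 : Fin L → Matrix (Fin m) (Fin n) ℝ
  T : ℕ → Fin L → Matrix (Fin m) (Fin m) ℝ
  P : Fin L → Matrix (Fin n) (Fin n) ℝ

namespace RiccatiData

variable {n m L : ℕ}

/-- `P⁰ = (T⁰)' W⁻¹ T⁰`. -/
def P0 (r : RiccatiData n m L) (i : Fin L) : Matrix (Fin n) (Fin n) ℝ :=
  (r.T0 i)ᵀ * (r.W i)⁻¹ * r.T0 i

/-- `P - P⁰`. -/
def PmP0 (r : RiccatiData n m L) (i : Fin L) : Matrix (Fin n) (Fin n) ℝ :=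
  r.P i - r.P0 i

end RiccatiData

namespace DelayedMJLS

variable {n m L : ℕ} (S : DelayedMJLS n m L)

/-- `Λ_{l_a, l_b}[f]` for `a ≤ b`, where `l_a = i` and `f` is a function of the modes
`l_{a+1}, …, l_b`:
the sum over `l_{a+1}, …, l_b` of `λ_{l_a,l_{a+1}} ⋯ λ_{l_{b-1},l_b} f`. -/
def Lam {V : Type*} [AddCommMonoid V] [Module ℝ V] (a b : ℕ) (f : (ℕ → Fin L) → V)
    (i : Fin L) : V :=
  pathSum S.lam a (b - a) f (fun _ => i)

/-- The product `A_{l_{a+r-1}} ⋯ A_{l_a}` of `r` factors. -/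
def transition (l : ℕ → Fin L) (a : ℕ) : ℕ → Matrix (Fin n) (Fin n) ℝ
  | 0 => 1
  | r + 1 => S.A (a + r) (l (a + r)) * transition l a r

/-- `F_{l_b, l_a} = A_{l_b} ⋯ A_{l_a}` for `a ≤ b`, and `F_{l_b, l_{b+1}} = I`. -/
def F (l : ℕ → Fin L) (b a : ℕ) : Matrix (Fin n) (Fin n) ℝ :=
  S.transition l a (b + 1 - a)

section Recursion

/- In these right-hand sides, `r` holds the values of the recursion at times later than `t`,
and `k = t + d`. -/

def rhsW (r : ℕ → RiccatiData n m L) (t : ℕ) (i : Fin L) : Matrix (Fin m) (Fin m) ℝ :=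
  let k := t + S.d
  S.Lam t k (fun l => (S.B k (l k))ᵀ * (r k).PmP0 (l k) * S.B k (l k) + S.R k (l k)) i
    - ∑ s ∈ Finset.Icc 1 (S.d - 1),
        S.Lam t (k - s) (fun l =>
          ((r (k - s)).T s (l (k - s)))ᵀ * ((r (k - s)).W (l (k - s)))⁻¹
            * (r (k - s)).T s (l (k - s))) i

def rhsT0 (r : ℕ → RiccatiData n m L) (t : ℕ) (i : Fin L) : Matrix (Fin m) (Fin n) ℝ :=
  let k := t + S.d
  S.Lam t k (fun l => (S.B k (l k))ᵀ * (r k).PmP0 (l k) * S.F l k (t + 1)) i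
    - ∑ s ∈ Finset.Icc 1 (S.d - 1),
        S.Lam t (k - s) (fun l =>
          ((r (k - s)).T s (l (k - s)))ᵀ * ((r (k - s)).W (l (k - s)))⁻¹
            * (r (k - s)).T0 (l (k - s)) * S.F l (k - s) (t + 1)) i

/-- Right-hand side for `T^j`, `1 ≤ j ≤ d - 1`. For `j = 1` the last sum is empty, and the term
`s = d - 1` of the middle sum has `F_{l_{t+1}, l_{t+2}} = I`. -/
def rhsT (r : ℕ → RiccatiData n m L) (t j : ℕ) (i : Fin L) : Matrix (Fin m) (Fin m) ℝ :=
  let k := t + S.d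
  S.Lam t k (fun l =>
      (S.B k (l k))ᵀ * (r k).PmP0 (l k) * S.F l k (t + j + 1) * S.B (t + j) (l (t + j))) i
    - ∑ s ∈ Finset.Icc 1 (S.d - j),
        S.Lam t (k - s) (fun l =>
          ((r (k - s)).T s (l (k - s)))ᵀ * ((r (k - s)).W (l (k - s)))⁻¹
            * (r (k - s)).T0 (l (k - s)) * S.F l (k - s) (t + j + 1)
            * S.B (t + j) (l (t + j))) i
    - ∑ s ∈ Finset.Icc (S.d - j + 1) (S.d - 1),
        S.Lam t (k - s) (fun l =>
          ((r (k - s)).T s (l (k - s)))ᵀ * ((r (k - s)).W (l (k - s)))⁻¹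
            * (r (k - s)).T (s - (S.d - j)) (l (k - s))) i

def rhsP (r : ℕ → RiccatiData n m L) (t : ℕ) (i : Fin L) : Matrix (Fin n) (Fin n) ℝ :=
  S.Lam t (t + 1) (fun l =>
    S.Q (t + 1) (l (t + 1))
      + (S.A (t + 1) (l (t + 1)))ᵀ * (r (t + 1)).PmP0 (l (t + 1)) * S.A (t + 1) (l (t + 1))) i

/-- One backward step. At times `t > N - d` there is no input left to choose: there `T⁰ = T^j = 0`,
and the value of `W` is immaterial. -/
def riccatiStep (r : ℕ → RiccatiData n m L) (t : ℕ) : RiccatiData n m L where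
  W i := if t + S.d ≤ S.N then S.rhsW r t i else 0
  T0 i := if t + S.d ≤ S.N then S.rhsT0 r t i else 0
  T j i := if 0 < j ∧ j < S.d ∧ t + S.d ≤ S.N then S.rhsT r t j i else 0
  P i := S.rhsP r t i

/-- The values at the final time `N`, with `P_{l_N} = Λ_{l_N, l_{N+1}}[P_{l_{N+1}}]`. -/
def riccatiFinal : RiccatiData n m L where
  W _ := 0
  T0 _ := 0
  T _ _ := 0
  P i := S.Lam S.N (S.N + 1) (fun l => S.PT (l (S.N + 1))) i

/-- After `c` backward steps, the table is correct at the times `N - c, …, N`. -/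
def riccatiTable : ℕ → ℕ → RiccatiData n m L
  | 0 => fun _ => S.riccatiFinal
  | c + 1 => Function.update (riccatiTable c) (S.N - (c + 1))
      (S.riccatiStep (riccatiTable c) (S.N - (c + 1)))

/-- The solution of the backward coupled difference Riccati recursion at the time `t`. -/
def riccati (t : ℕ) : RiccatiData n m L := S.riccatiTable (S.N - t) t

end Recursion

/-- `W_i` at the time `t`. -/
abbrev W (t : ℕ) (i : Fin L) : Matrix (Fin m) (Fin m) ℝ := (S.riccati t).W i

/-- `T_i^0` at the time `t`. -/
abbrev T0 (t : ℕ) (i : Fin L) : Matrix (Fin m) (Fin n) ℝ := (S.riccati t).T0 i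

/-- `T_i^j` at the time `t`, for `1 ≤ j ≤ d - 1`. -/
abbrev T (j t : ℕ) (i : Fin L) : Matrix (Fin m) (Fin m) ℝ := (S.riccati t).T j i

/-- `P_i - P_i^0` at the time `t`. -/
abbrev PmP0 (t : ℕ) (i : Fin L) : Matrix (Fin n) (Fin n) ℝ := (S.riccati t).PmP0 i

theorem riccatiTable_eq (c t : ℕ) (hc : c ≤ S.N) (ht : S.N - c ≤ t) (htN : t ≤ S.N) :
    S.riccatiTable c t = S.riccati t := by
  induction c with
  | zero =>
    obtain rfl : t = S.N := by omega
    simp [riccati]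
  | succ c ih =>
    by_cases h : t = S.N - (c + 1)
    · have : S.N - t = c + 1 := by omega
      rw [riccati, this]
    · rw [riccatiTable, Function.update_of_ne h]
      exact ih (by omega) (by omega)

theorem riccati_final : S.riccati S.N = S.riccatiFinal := by
  simp [riccati, riccatiTable]

/-- A backward step uses only the values at the times `t + 1, …, N`. -/
theorem riccatiStep_congr {r r' : ℕ → RiccatiData n m L} {t : ℕ} (hd : 0 < S.d) (ht : t < S.N)
    (h : ∀ q, t < q → q ≤ S.N → r q = r' q) : S.riccatiStep r t = S.riccatiStep r' t := by
  have hP : S.rhsP r t = S.rhsP r' t := by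
    funext i
    simp only [rhsP, h (t + 1) (by omega) (by omega)]
  by_cases hN : t + S.d ≤ S.N
  · have hk : r (t + S.d) = r' (t + S.d) := h _ (by omega) hN
    have hs : ∀ s, 1 ≤ s → s ≤ S.d - 1 → r (t + S.d - s) = r' (t + S.d - s) :=
      fun s h1 h2 => h _ (by omega) (by omega)
    have hW : S.rhsW r t = S.rhsW r' t := by
      funext i
      simp only [rhsW, hk]
      congr 1
      refine Finset.sum_congr rfl fun s hs' => ?_
      rw [Finset.mem_Icc] at hs'
      rw [hs s hs'.1 hs'.2]
    have hT0 : S.rhsT0 r t = S.rhsT0 r' t := by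
      funext i
      simp only [rhsT0, hk]
      congr 1
      refine Finset.sum_congr rfl fun s hs' => ?_
      rw [Finset.mem_Icc] at hs'
      rw [hs s hs'.1 hs'.2]
    have hT : ∀ j i, 0 < j → S.rhsT r t j i = S.rhsT r' t j i := by
      intro j i hj
      simp only [rhsT, hk]
      congr 1
      · congr 1
        refine Finset.sum_congr rfl fun s hs' => ?_
        rw [Finset.mem_Icc] at hs'
        rw [hs s hs'.1 (by omega)]
      · refine Finset.sum_congr rfl fun s hs' => ?_
        rw [Finset.mem_Icc] at hs'
        rw [hs s (by omega) hs'.2]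
    have hT' : ∀ j i, (S.riccatiStep r t).T j i = (S.riccatiStep r' t).T j i := by
      intro j i
      by_cases hj : 0 < j
      · simp only [riccatiStep, hT j i hj]
      · simp only [riccatiStep, hj, false_and, if_false]
    have hT'' : (S.riccatiStep r t).T = (S.riccatiStep r' t).T :=
      funext fun j => funext fun i => hT' j i
    have key : ∀ p q : RiccatiData n m L,
        p.W = q.W → p.T0 = q.T0 → p.T = q.T → p.P = q.P → p = q := by
      rintro ⟨_, _, _, _⟩ ⟨_, _, _, _⟩ h1 h2 h3 h4
      cases h1; cases h2; cases h3; cases h4; rfl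
    exact key _ _ (by simp only [riccatiStep, hW]) (by simp only [riccatiStep, hT0]) hT''
      (by simp only [riccatiStep, hP])
  · simp only [riccatiStep, hN, and_false, if_false, hP]

/-- The backward equations of the recursion; at `t = N` use `riccati_final`. -/
theorem riccati_step (hd : 0 < S.d) {t : ℕ} (ht : t < S.N) :
    S.riccati t = S.riccatiStep S.riccati t := by
  obtain ⟨c, hc⟩ : ∃ c, S.N - t = c + 1 := ⟨S.N - t - 1, by omega⟩
  have htc : S.N - (c + 1) = t := by omega
  rw [riccati, hc, riccatiTable, htc, Function.update_self]
  exact S.riccatiStep_congr hd ht fun q hq hqN => S.riccatiTable_eq c q (by omega) (by omega) hqN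

/-- `δ_i^j` at the time `t`, for `1 ≤ j ≤ d - 1`, with the terminal values `δ_{l_N}^j = 0`. -/
def delta : ℕ → ℕ → Fin L → Matrix (Fin m) (Fin n) ℝ
  | 0, _, _ => 0
  | 1, t, i =>
    if t < S.N then
      (S.Lam t (t + 1) (fun l => (S.A (t + 1) (l (t + 1)))ᵀ * S.PmP0 (t + 1) (l (t + 1))
          * S.B (t + 1) (l (t + 1))) i
        - (S.T0 t i)ᵀ * (S.W t i)⁻¹ * S.T 1 t i)ᵀ
    else 0
  | j + 2, t, i =>
    if t < S.N then
      (S.Lam t (t + 1) (fun l => (S.A (t + 1) (l (t + 1)))ᵀ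
          * (delta (j + 1) (t + 1) (l (t + 1)))ᵀ) i
        - (S.T0 t i)ᵀ * (S.W t i)⁻¹ * S.T (j + 2) t i)ᵀ
    else 0

/-- `alpha j t l` is `α_{l_t, l_{t+1-j}}^{d-j}`, for `1 ≤ j ≤ d - 1`; it depends on the modes
`l_{t+1-j}, …, l_t` of the path `l`. The summation index `s` here runs
over `0, …, j - 2` and stands for `s + 1` in `∑_{s=1}^{j-1}`. -/
def alpha (j t : ℕ) (l : ℕ → Fin L) : Matrix (Fin m) (Fin n) ℝ :=
  ((S.delta (S.d - j) t (l t))ᵀ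
    - ∑ s : Fin (j - 1), (alpha (s + 1) t l)ᵀ * (S.W (t - (s + 1)) (l (t - (s + 1))))⁻¹
        * S.T (S.d - j + (s + 1)) (t - (s + 1)) (l (t - (s + 1))))ᵀ
  termination_by j
  decreasing_by omega

section Control

variable {Ω : Type*} [MeasurableSpace Ω] (μ : Measure Ω) (θ : ℕ → Ω → Fin L)
  (u : ℤ → Ω → Fin m → ℝ)

/-- The state `x(k)` driven by the input `u`. -/
def state : ℕ → Ω → Fin n → ℝ
  | 0, _ => S.x0
  | k + 1, ω => S.A k (θ k ω) *ᵥ state k ω + S.B k (θ k ω) *ᵥ u ((k : ℤ) - S.d) ω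

/-- The quadratic cost `J_N`. -/
def cost : ℝ :=
  ∫ ω, ((∑ k ∈ Finset.range (S.N + 1),
          S.state θ u k ω ⬝ᵥ S.Q k (θ k ω) *ᵥ S.state θ u k ω)
      + (∑ k ∈ Finset.Icc S.d S.N,
          u ((k : ℤ) - S.d) ω ⬝ᵥ S.R k (θ k ω) *ᵥ u ((k : ℤ) - S.d) ω)
      + S.state θ u (S.N + 1) ω ⬝ᵥ S.PT (θ (S.N + 1) ω) *ᵥ S.state θ u (S.N + 1) ω) ∂μ

/-- Admissible inputs: the past inputs are the given ones, and `u(t)` is `𝒢_t`-measurable for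
`t = 0, …, N - d`. The values at later times play no role. -/
structure IsAdmissible : Prop where
  initial : ∀ i : ℤ, -(S.d : ℤ) ≤ i → i < 0 → ∀ ω, u i ω = S.u0 i
  measurable : ∀ t : ℕ, t + S.d ≤ S.N → Measurable[modeSigma θ t] (u t)

/-- `u` is an optimal control: it is admissible and minimizes the cost. -/
def IsOptimal : Prop :=
  S.IsAdmissible θ u ∧ ∀ v, S.IsAdmissible θ v → S.cost μ θ u ≤ S.cost μ θ v

/-- There is exactly one optimal control `(u(0), …, u(N - d))`, up to null sets. -/
def HasUniqueOptimal : Prop :=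
  ∃ u, S.IsOptimal μ θ u ∧
    ∀ v, S.IsOptimal μ θ v → ∀ t : ℕ, t + S.d ≤ S.N → v t =ᵐ[μ] u t

/-- The costate in reversed time: `costateRev c` is `λ_{N-c}`. -/
def costateRev : ℕ → Ω → Fin n → ℝ
  | 0 => μ[fun ω => S.PT (θ (S.N + 1) ω) *ᵥ S.state θ u (S.N + 1) ω | modeSigma θ S.N]
  | c + 1 =>
    μ[fun ω => (S.A (S.N - c) (θ (S.N - c) ω))ᵀ *ᵥ costateRev c ω
        + S.Q (S.N - c) (θ (S.N - c) ω) *ᵥ S.state θ u (S.N - c) ω | modeSigma θ (S.N - c - 1)]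

/-- The costate `λ_k`, for `0 ≤ k ≤ N`. -/
def costate (k : ℕ) : Ω → Fin n → ℝ := S.costateRev μ θ u (S.N - k)

/-- `λ_N = E[P_{θ(N+1)} x(N+1) | 𝒢_N]`. -/
theorem costate_final : S.costate μ θ u S.N =
    μ[fun ω => S.PT (θ (S.N + 1) ω) *ᵥ S.state θ u (S.N + 1) ω | modeSigma θ S.N] := by
  simp [costate, costateRev]

/-- `λ_{k-1} = E[A_{θ(k)}' λ_k + Q_{θ(k)} x(k) | 𝒢_{k-1}]`. -/
theorem costate_pred {k : ℕ} (hk : 1 ≤ k) (hkN : k ≤ S.N) : S.costate μ θ u (k - 1) =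
    μ[fun ω => (S.A k (θ k ω))ᵀ *ᵥ S.costate μ θ u k ω + S.Q k (θ k ω) *ᵥ S.state θ u k ω
      | modeSigma θ (k - 1)] := by
  have h1 : S.N - (k - 1) = (S.N - k) + 1 := by omega
  have h2 : S.N - (S.N - k) = k := by omega
  rw [costate, h1, costateRev, h2]
  rfl

/-- The term
`∑_{s=1}^{d-1} (α_{l_{k-1},l_{k-s}}^{d-s})' W_{l_{k-s-1}}⁻¹ E{α_{l_{k-1},l_{k-s}}^{d-s} x(k) | 𝒢_{k-s-1}}`
along the mode path `l_t = θ(t)`. -/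
def memoryTerm (k : ℕ) (ω : Ω) : Fin n → ℝ :=
  ∑ s ∈ Finset.Icc 1 (S.d - 1),
    (S.alpha s (k - 1) (fun t => θ t ω))ᵀ *ᵥ (S.W (k - s - 1) (θ (k - s - 1) ω))⁻¹ *ᵥ
      (μ[fun ω' => S.alpha s (k - 1) (fun t => θ t ω') *ᵥ S.state θ u k ω'
        | modeSigma θ (k - s - 1)]) ω

end Control

end DelayedMJLS

end

/-! Adjoin to $x(t+1)$ the inputs $u(t-d+1),\dots,u(t)$ that have been issued but have not yet
acted. On this augmented state the problem is a linear-quadratic one with Markov modes, and dynamic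
programming applies: the cost-to-go after time $t$ (`value`) is a quadratic form, and $u(t)$ is
removed from it by completing the square, which leaves `reduced`.

The matrices of the recursion are blocks of these forms. In `value`, $W$ couples $u(t)$ with itself,
and $T^0$, $T^j$ couple it with $x(t+1)$ and $u(t-d+j)$ (`value_pulse`). In `reduced`, $P-P^0$
couples the state with itself, and $\delta^j$ couples it with $u(t-d+j)$ (`reduced_fst`,
`reduced_pulse_fst`). The sums over $s$ in the recursion arise because $u(t)$ acts only at time
$t+d$: on its way there it passes the $d-1$ minimizations over $u(t+1),\dots,u(t+d-1)$, and each of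
them subtracts a term with $W^{-1}$ (`value_unroll`).

It follows that the cost is a quantity common to all admissible controls plus the sum of the
expected `gap`s (`cost_eq`, `cost_sub_sum_gapCost`), an identity that needs no invertibility of $W$.
If every $W$ is positive definite, each gap is a $W$-weighted square of the deviation from the
feedback law, so the law is the only minimizer up to null sets. Conversely, at the last time where
some $W_i$ is not positive definite, the optimal $u(t)$ can be moved on $\{\theta(t)=i\}$ in a
direction of nonpositive curvature, with the feedback law applied afterwards, and the cost does not
increase. This contradicts uniqueness because the event has positive probability.

Under the feedback law the gap vanishes against every direction. Hence the state gradient of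
`reduced` satisfies the costate recursion (`costate_ae_eq_gradient`). This gradient still contains
pending inputs. The law eliminates them one after another; this produces $\alpha$, and the remaining
part of each feedback is the conditional expectation of $\alpha x$ (`integral_alpha_state`,
`gradient_ae_eq`). For the optimal cost, the minimized form at time $d-1$ is split into a state
direction and directions of pending controls; the latter contribute zero in expectation by
stationarity (`integral_reduced_traj_pulse`). -/

/-- The bilinear form `(x, y) ↦ y' M x`. -/
noncomputable def matForm {a b : Type*} [Fintype a] [Fintype b] (M : Matrix a b ℝ) :
    (b → ℝ) →ₗ[ℝ] (a → ℝ) →ₗ[ℝ] ℝ :=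
  LinearMap.mk₂ ℝ (fun x y => y ⬝ᵥ M *ᵥ x)
    (fun x x' y => by simp [Matrix.mulVec_add, dotProduct_add])
    (fun c x y => by simp [Matrix.mulVec_smul])
    (fun x y y' => by simp [add_dotProduct])
    (fun c x y => by simp)

@[simp] theorem matForm_apply {a b : Type*} [Fintype a] [Fintype b] (M : Matrix a b ℝ)
    (x : b → ℝ) (y : a → ℝ) : matForm M x y = y ⬝ᵥ M *ᵥ x := rfl

/-! ### Iterated sums over mode paths. -/

section PathSum

variable {L : ℕ} {V V' : Type*} [AddCommMonoid V] [Module ℝ V] [AddCommMonoid V'] [Module ℝ V']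
  (lam : Matrix (Fin L) (Fin L) ℝ)

theorem pathSum_congr (r : ℕ) : ∀ (a : ℕ) {f g : (ℕ → Fin L) → V} (l : ℕ → Fin L),
    (∀ l', (∀ s ≤ a, l' s = l s) → f l' = g l') → pathSum lam a r f l = pathSum lam a r g l := by
  induction r with
  | zero => intro a f g l h; exact h l fun _ _ => rfl
  | succ r ih =>
    intro a f g l h
    simp only [pathSum]
    refine Finset.sum_congr rfl fun j _ => ?_
    rw [ih (a + 1) (g := g)]
    intro l' hl'
    refine h l' fun s hs => ?_
    rw [hl' s (by omega), Function.update_of_ne (by omega)]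

/-- The definition peels off the first transition. A delayed input acts at the last one, so the sum
must also open from that end. -/
theorem pathSum_succ_last (r : ℕ) : ∀ (a : ℕ) (f : (ℕ → Fin L) → V) (l : ℕ → Fin L),
    pathSum lam a (r + 1) f l = pathSum lam a r
      (fun l' => ∑ j, lam (l' (a + r)) j • f (Function.update l' (a + r + 1) j)) l := by
  induction r with
  | zero => intro a f l; rfl
  | succ r ih =>
    intro a f l
    rw [pathSum]
    conv_rhs => rw [pathSum]
    refine Finset.sum_congr rfl fun j _ => ?_
    rw [ih]
    have : a + 1 + r = a + (r + 1) := by omega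
    simp only [this]

theorem map_pathSum (φ : V →ₗ[ℝ] V') (r : ℕ) : ∀ (a : ℕ) (f : (ℕ → Fin L) → V)
    (l : ℕ → Fin L), φ (pathSum lam a r f l) = pathSum lam a r (fun l' => φ (f l')) l := by
  induction r with
  | zero => intro a f l; rfl
  | succ r ih =>
    intro a f l
    simp only [pathSum, map_sum, map_smul, ih]

end PathSum

/-! ### The cost-to-go as a bilinear form on the augmented state. -/

namespace DelayedMJLS

variable {n m L : ℕ} (S : DelayedMJLS n m L)

/-- A state together with a sequence of inputs, indexed by their absolute times. -/
abbrev Aug (n m : ℕ) := (Fin n → ℝ) × (ℤ → Fin m → ℝ)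

/-- Keep the inputs at the times `t - d < τ < t`. -/
noncomputable def window (t : ℕ) : Aug n m →ₗ[ℝ] Aug n m where
  toFun e := (e.1, fun τ => if (t : ℤ) - S.d < τ ∧ τ < t then e.2 τ else 0)
  map_add' e e' := by
    ext τ <;> simp
    split_ifs <;> simp
  map_smul' c e := by
    ext τ
    · simp
    · by_cases h : (t : ℤ) - S.d < τ ∧ τ < t <;> simp [h]

/-- The linear part `T⁰ x + ∑_j T^j u(t - d + j)` of the feedback law at time `t`. -/
noncomputable def feed (t : ℕ) (i : Fin L) : Aug n m →ₗ[ℝ] (Fin m → ℝ) where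
  toFun e := S.T0 t i *ᵥ e.1 + ∑ j ∈ Finset.Icc 1 (S.d - 1), S.T j t i *ᵥ e.2 ((t : ℤ) - S.d + j)
  map_add' e e' := by
    simp only [Prod.fst_add, Prod.snd_add, Pi.add_apply, Matrix.mulVec_add,
      Finset.sum_add_distrib]
    abel
  map_smul' c e := by
    simp [Matrix.mulVec_smul, Finset.smul_sum]

/-- The dynamics at time `k` in mode `j`. -/
noncomputable def advance (k : ℕ) (j : Fin L) : Aug n m →ₗ[ℝ] Aug n m where
  toFun e := (S.A k j *ᵥ e.1 + S.B k j *ᵥ e.2 ((k : ℤ) - S.d), e.2)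
  map_add' e e' := by
    ext τ <;> simp [Matrix.mulVec_add]
    abel
  map_smul' c e := by
    ext τ <;> simp [Matrix.mulVec_smul]

/-- The bilinear form of the running cost at time `k`; inputs are charged from time `d` on. -/
noncomputable def stage (k : ℕ) (j : Fin L) : Aug n m →ₗ[ℝ] Aug n m →ₗ[ℝ] ℝ :=
  (matForm (S.Q k j)).compl₁₂ (LinearMap.fst ℝ _ _) (LinearMap.fst ℝ _ _)
    + if S.d ≤ k then
        (matForm (S.R k j)).compl₁₂
          (LinearMap.proj ((k : ℤ) - S.d) ∘ₗ LinearMap.snd ℝ _ _)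
          (LinearMap.proj ((k : ℤ) - S.d) ∘ₗ LinearMap.snd ℝ _ _)
      else 0

/-- Partial minimization over the input at time `t` of a cost-to-go `V`. -/
noncomputable def reduce (t : ℕ) (i : Fin L) (V : Aug n m →ₗ[ℝ] Aug n m →ₗ[ℝ] ℝ) :
    Aug n m →ₗ[ℝ] Aug n m →ₗ[ℝ] ℝ :=
  -- This is the value with $u(t)=0$ minus the gain from optimizing $u(t)$, on the premise that `V`
  -- has curvature $W$ and linear part `feed` in $u(t)$. For `V = value` that premise is
  -- `value_pulse`.
  V.compl₁₂ (S.window t) (S.window t)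
    - (matForm (S.W t i)⁻¹).compl₁₂ (S.feed t i) (S.feed t i)

/-- The cost-to-go after time `t` when `c` stages remain. -/
noncomputable def valueAux : ℕ → ℕ → Fin L → Aug n m →ₗ[ℝ] Aug n m →ₗ[ℝ] ℝ
  | 0, t, i => (matForm ((S.riccati t).P i)).compl₁₂ (LinearMap.fst ℝ _ _) (LinearMap.fst ℝ _ _)
  | c + 1, t, i => ∑ j, S.lam i j • (S.stage (t + 1) j
      + (S.reduce (t + 1) j (valueAux c (t + 1) j)).compl₁₂
          (S.advance (t + 1) j) (S.advance (t + 1) j))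

/-- The cost-to-go after time `t`, before the input at time `t` is chosen optimally. -/
noncomputable def value (t : ℕ) (i : Fin L) : Aug n m →ₗ[ℝ] Aug n m →ₗ[ℝ] ℝ :=
  S.valueAux (S.N - t) t i

/-- The cost-to-go after time `t`, minimized over the input at time `t`. -/
noncomputable def reduced (t : ℕ) (i : Fin L) : Aug n m →ₗ[ℝ] Aug n m →ₗ[ℝ] ℝ :=
  S.reduce t i (S.value t i)

theorem window_apply (t : ℕ) (e : Aug n m) : S.window t e =
    (e.1, fun τ => if (t : ℤ) - S.d < τ ∧ τ < t then e.2 τ else 0) := rfl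

theorem feed_apply (t : ℕ) (i : Fin L) (e : Aug n m) : S.feed t i e =
    S.T0 t i *ᵥ e.1 + ∑ j ∈ Finset.Icc 1 (S.d - 1), S.T j t i *ᵥ e.2 ((t : ℤ) - S.d + j) := rfl

theorem advance_apply (k : ℕ) (j : Fin L) (e : Aug n m) : S.advance k j e =
    (S.A k j *ᵥ e.1 + S.B k j *ᵥ e.2 ((k : ℤ) - S.d), e.2) := rfl

theorem stage_apply (k : ℕ) (j : Fin L) (e e' : Aug n m) : S.stage k j e e' =
    e'.1 ⬝ᵥ S.Q k j *ᵥ e.1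
      + if S.d ≤ k then e'.2 ((k : ℤ) - S.d) ⬝ᵥ S.R k j *ᵥ e.2 ((k : ℤ) - S.d) else 0 := by
  unfold stage
  split_ifs <;> simp

theorem reduced_apply (t : ℕ) (i : Fin L) (e e' : Aug n m) : S.reduced t i e e' =
    S.value t i (S.window t e) (S.window t e')
      - S.feed t i e' ⬝ᵥ (S.W t i)⁻¹ *ᵥ S.feed t i e := by
  simp [reduced, reduce]

theorem value_final (i : Fin L) (e e' : Aug n m) :
    S.value S.N i e e' = e'.1 ⬝ᵥ (S.riccati S.N).P i *ᵥ e.1 := by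
  simp [value, valueAux]

theorem value_step {t : ℕ} (ht : t < S.N) (i : Fin L) (e e' : Aug n m) :
    S.value t i e e' = ∑ j, S.lam i j * (S.stage (t + 1) j e e'
      + S.reduced (t + 1) j (S.advance (t + 1) j e) (S.advance (t + 1) j e')) := by
  obtain ⟨c, hc⟩ : ∃ c, S.N - t = c + 1 := ⟨S.N - t - 1, by omega⟩
  have hc' : S.N - (t + 1) = c := by omega
  simp only [reduced, value, hc, hc', valueAux]
  simp [LinearMap.sum_apply, mul_add]

theorem W_eq (hd : 0 < S.d) {t : ℕ} (ht : t + S.d ≤ S.N) (i : Fin L) :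
    S.W t i = S.rhsW S.riccati t i := by
  rw [W, S.riccati_step hd (by omega)]
  simp [riccatiStep, ht]

theorem T0_eq (hd : 0 < S.d) {t : ℕ} (ht : t + S.d ≤ S.N) (i : Fin L) :
    S.T0 t i = S.rhsT0 S.riccati t i := by
  rw [T0, S.riccati_step hd (by omega)]
  simp [riccatiStep, ht]

theorem T_eq (hd : 0 < S.d) {t : ℕ} (ht : t + S.d ≤ S.N) {j : ℕ} (hj : 0 < j) (hjd : j < S.d)
    (i : Fin L) : S.T j t i = S.rhsT S.riccati t j i := by
  rw [T, S.riccati_step hd (by omega)]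
  simp [riccatiStep, ht, hj, hjd]

theorem P_eq (hd : 0 < S.d) {t : ℕ} (ht : t < S.N) (i : Fin L) :
    (S.riccati t).P i = S.rhsP S.riccati t i := by
  conv_lhs => rw [S.riccati_step hd ht]
  simp [riccatiStep]

section Late

variable (hd : 0 < S.d) {t : ℕ} (ht : S.N < t + S.d) (htN : t ≤ S.N) (i : Fin L)
include hd ht htN

theorem W_late : S.W t i = 0 := by
  rcases htN.lt_or_eq with h | rfl
  · rw [W, S.riccati_step hd h]
    simp [riccatiStep, show ¬ t + S.d ≤ S.N by omega]
  · rw [W, riccati_final]; rfl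

theorem T0_late : S.T0 t i = 0 := by
  rcases htN.lt_or_eq with h | rfl
  · rw [T0, S.riccati_step hd h]
    simp [riccatiStep, show ¬ t + S.d ≤ S.N by omega]
  · rw [T0, riccati_final]; rfl

theorem T_late (j : ℕ) : S.T j t i = 0 := by
  rcases htN.lt_or_eq with h | rfl
  · rw [T, S.riccati_step hd h]
    simp [riccatiStep, show ¬ t + S.d ≤ S.N by omega]
  · rw [T, riccati_final]; rfl

theorem feed_late (e : Aug n m) : S.feed t i e = 0 := by
  simp [feed_apply, S.T0_late hd ht htN, S.T_late hd ht htN]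

end Late

theorem feed_congr (t : ℕ) (i : Fin L) {e e' : Aug n m} (h1 : e.1 = e'.1)
    (h2 : ∀ τ : ℤ, (t : ℤ) - S.d < τ → τ < t → e.2 τ = e'.2 τ) :
    S.feed t i e = S.feed t i e' := by
  rw [feed_apply, feed_apply, h1]
  congr 1
  refine Finset.sum_congr rfl fun j hj => ?_
  rw [Finset.mem_Icc] at hj
  rw [h2 _ (by omega) (by omega)]

theorem window_congr (t : ℕ) {e e' : Aug n m} (h1 : e.1 = e'.1)
    (h2 : ∀ τ : ℤ, (t : ℤ) - S.d < τ → τ < t → e.2 τ = e'.2 τ) :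
    S.window t e = S.window t e' := by
  rw [window_apply, window_apply, h1]
  congr 1
  funext τ
  split_ifs with h
  · exact h2 τ h.1 h.2
  · rfl

theorem reduced_congr (t : ℕ) (i : Fin L) {e e' f f' : Aug n m} (he : e.1 = e'.1) (hf : f.1 = f'.1)
    (he2 : ∀ τ : ℤ, (t : ℤ) - S.d < τ → τ < t → e.2 τ = e'.2 τ)
    (hf2 : ∀ τ : ℤ, (t : ℤ) - S.d < τ → τ < t → f.2 τ = f'.2 τ) :
    S.reduced t i e f = S.reduced t i e' f' := by
  rw [reduced_apply, reduced_apply, S.window_congr t he he2, S.window_congr t hf hf2,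
    S.feed_congr t i he he2, S.feed_congr t i hf hf2]

/-- Inputs up to $t-d$ have already acted on $x(t+1)$, and those after $t$ are cut off by the next
window. -/
theorem value_congr (hd : 0 < S.d) {t : ℕ} (htN : t ≤ S.N) (i : Fin L) {e e' f f' : Aug n m}
    (he : e.1 = e'.1) (hf : f.1 = f'.1)
    (he2 : ∀ τ : ℤ, (t : ℤ) - S.d < τ → τ ≤ t → e.2 τ = e'.2 τ)
    (hf2 : ∀ τ : ℤ, (t : ℤ) - S.d < τ → τ ≤ t → f.2 τ = f'.2 τ) :
    S.value t i e f = S.value t i e' f' := by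
  rcases htN.lt_or_eq with h | rfl
  · rw [S.value_step h, S.value_step h]
    refine Finset.sum_congr rfl fun j _ => ?_
    have h1 : e.2 (((t + 1 : ℕ) : ℤ) - S.d) = e'.2 (((t + 1 : ℕ) : ℤ) - S.d) :=
      he2 _ (by omega) (by omega)
    have h2 : f.2 (((t + 1 : ℕ) : ℤ) - S.d) = f'.2 (((t + 1 : ℕ) : ℤ) - S.d) :=
      hf2 _ (by omega) (by omega)
    rw [stage_apply, stage_apply, he, hf, h1, h2]
    congr 2
    apply S.reduced_congr
    · simp only [advance_apply, he, h1]
    · simp only [advance_apply, hf, h2]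
    · exact fun τ h3 h4 => he2 τ (by omega) (by omega)
    · exact fun τ h3 h4 => hf2 τ (by omega) (by omega)
  · rw [value_final, value_final, he, hf]

/-! ### Following the cost-to-go along a mode path. -/

/-- `q` steps of the dynamics after time `t` along the modes `l`. -/
noncomputable def advancePath : ℕ → ℕ → (ℕ → Fin L) → Aug n m → Aug n m
  | 0, _, _, e => e
  | q + 1, t, l, e => advancePath q (t + 1) l (S.advance (t + 1) (l (t + 1)) e)

theorem advancePath_snd (q : ℕ) : ∀ (t : ℕ) (l : ℕ → Fin L) (e : Aug n m),
    (S.advancePath q t l e).2 = e.2 := by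
  induction q with
  | zero => intros; rfl
  | succ q ih => intro t l e; rw [advancePath, ih]; rfl

theorem advancePath_succ (q : ℕ) : ∀ (t : ℕ) (l : ℕ → Fin L) (e : Aug n m),
    S.advancePath (q + 1) t l e
      = S.advance (t + q + 1) (l (t + q + 1)) (S.advancePath q t l e) := by
  induction q with
  | zero => intros; rfl
  | succ q ih =>
    intro t l e
    rw [advancePath, ih, advancePath, show t + 1 + q + 1 = t + (q + 1) + 1 by omega]

/-- Following a perturbation `f` of inputs only, the cost-to-go is the one at a later time minus
the partial minimizations passed on the way, as long as the perturbation does not yet act. -/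
theorem value_unroll (hd : 0 < S.d) (r : ℕ) : ∀ (t : ℕ) (l : ℕ → Fin L) (e f : Aug n m),
    t + r ≤ S.N → (∀ τ : ℤ, t < τ → e.2 τ = 0) → f.1 = 0 → (∀ τ : ℤ, t < τ → f.2 τ = 0) →
    (∀ τ : ℤ, τ ≤ t + r - S.d → f.2 τ = 0) →
    S.value t (l t) e f =
      pathSum S.lam t r (fun l' => S.value (t + r) (l' (t + r)) (S.advancePath r t l' e) f) l
        - ∑ q ∈ Finset.range r, pathSum S.lam t (q + 1) (fun l' =>
            S.feed (t + q + 1) (l' (t + q + 1)) f ⬝ᵥ (S.W (t + q + 1) (l' (t + q + 1)))⁻¹ *ᵥ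
              S.feed (t + q + 1) (l' (t + q + 1)) (S.advancePath (q + 1) t l' e)) l := by
  induction r with
  | zero => intro t l e f _ _ _ _ _; simp [pathSum, advancePath]
  | succ r ih =>
    intro t l e f htr he hf hf2 hf3
    -- The only input that acts or is charged at time $t+1$ is $u(t+1-d)$. It vanishes in `f`, so
    -- the step leaves `f` fixed and adds no running cost.
    have hf0 : f.2 (((t + 1 : ℕ) : ℤ) - S.d) = 0 := hf3 _ (by push_cast; omega)
    have hadv : ∀ j, S.advance (t + 1) j f = f := by
      intro j
      rw [advance_apply, hf0, hf]
      ext <;> simp [hf]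
    have hstage : ∀ j, S.stage (t + 1) j e f = 0 := by
      intro j
      rw [stage_apply, hf0, hf]
      simp
    -- The window at $t+1$ drops the inputs up to $t+1-d$, which `value` no longer sees, and those
    -- from $t+1$ on, which are zero here.
    have hwin : ∀ j (g h : Aug n m), (∀ τ : ℤ, t < τ → g.2 τ = 0) → (∀ τ : ℤ, t < τ → h.2 τ = 0) →
        S.value (t + 1) j (S.window (t + 1) g) (S.window (t + 1) h) = S.value (t + 1) j g h := by
      intro j g h hg hh
      refine S.value_congr hd (by omega) j rfl rfl ?_ ?_
      · intro τ h1 h2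
        rw [window_apply]
        dsimp only
        split_ifs with h3
        · rfl
        · exact (hg τ (by omega)).symm
      · intro τ h1 h2
        rw [window_apply]
        dsimp only
        split_ifs with h3
        · rfl
        · exact (hh τ (by omega)).symm
    rw [S.value_step (by omega), Finset.sum_range_succ', pathSum]
    have hrest : ∀ q, pathSum S.lam t (q + 1 + 1) (fun l' =>
            S.feed (t + (q + 1) + 1) (l' (t + (q + 1) + 1)) f ⬝ᵥ
              (S.W (t + (q + 1) + 1) (l' (t + (q + 1) + 1)))⁻¹ *ᵥ
              S.feed (t + (q + 1) + 1) (l' (t + (q + 1) + 1))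
                (S.advancePath (q + 1 + 1) t l' e)) l
        = ∑ j, S.lam (l t) j * pathSum S.lam (t + 1) (q + 1) (fun l' =>
            S.feed (t + 1 + q + 1) (l' (t + 1 + q + 1)) f ⬝ᵥ
              (S.W (t + 1 + q + 1) (l' (t + 1 + q + 1)))⁻¹ *ᵥ
              S.feed (t + 1 + q + 1) (l' (t + 1 + q + 1))
                (S.advancePath (q + 1) (t + 1) l' (S.advance (t + 1) j e)))
            (Function.update l (t + 1) j) := by
      intro q
      rw [pathSum]
      refine Finset.sum_congr rfl fun j _ => ?_
      rw [smul_eq_mul, show t + (q + 1) + 1 = t + 1 + q + 1 by omega]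
      refine congrArg (S.lam (l t) j * ·) (pathSum_congr _ _ _ _ ?_)
      intro l' hl'
      rw [advancePath, hl' (t + 1) le_rfl, Function.update_self]
    have hfirst : pathSum S.lam t (0 + 1) (fun l' =>
            S.feed (t + 0 + 1) (l' (t + 0 + 1)) f ⬝ᵥ (S.W (t + 0 + 1) (l' (t + 0 + 1)))⁻¹ *ᵥ
              S.feed (t + 0 + 1) (l' (t + 0 + 1)) (S.advancePath (0 + 1) t l' e)) l
        = ∑ j, S.lam (l t) j * (S.feed (t + 1) j f ⬝ᵥ (S.W (t + 1) j)⁻¹ *ᵥ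
              S.feed (t + 1) j (S.advance (t + 1) j e)) := by
      simp only [pathSum, advancePath, Function.update_self, smul_eq_mul, add_zero]
    rw [hfirst, Finset.sum_congr rfl fun q _ => hrest q, Finset.sum_comm]
    simp only [smul_eq_mul]
    rw [← Finset.sum_add_distrib, ← Finset.sum_sub_distrib]
    refine Finset.sum_congr rfl fun j _ => ?_
    rw [hstage, zero_add, hadv, reduced_apply, hwin j _ _ _ fun τ h => hf2 τ h]
    swap
    · exact fun τ h => he τ h
    have := ih (t + 1) (Function.update l (t + 1) j) (S.advance (t + 1) j e) f (by omega)
      (fun τ h => he τ (by push_cast at h; omega)) hf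
      (fun τ h => hf2 τ (by push_cast at h; omega))
      (fun τ h => hf3 τ (by push_cast at h ⊢; omega))
    rw [Function.update_self] at this
    have e1 : pathSum S.lam (t + 1) r (fun l' => S.value (t + 1 + r) (l' (t + 1 + r))
          (S.advancePath r (t + 1) l' (S.advance (t + 1) j e)) f) (Function.update l (t + 1) j)
        = pathSum S.lam (t + 1) r (fun l' => S.value (t + (r + 1)) (l' (t + (r + 1)))
          (S.advancePath (r + 1) t l' e) f) (Function.update l (t + 1) j) := by
      rw [show t + 1 + r = t + (r + 1) by omega]
      apply pathSum_congr
      intro l' hl'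
      rw [advancePath, hl' (t + 1) le_rfl, Function.update_self]
    have key : ∀ a b c d : ℝ, a * (b - c - d) = a * b - (a * c + a * d) := by intros; ring
    rw [this, e1]
    refine (key _ _ _ _).trans ?_
    rw [Finset.mul_sum]

end DelayedMJLS

theorem dotProduct_transpose_mulVec {a b : Type*} [Fintype a] [Fintype b] (M : Matrix a b ℝ)
    (v : b → ℝ) (y : a → ℝ) : v ⬝ᵥ Mᵀ *ᵥ y = (M *ᵥ v) ⬝ᵥ y := by
  rw [Matrix.dotProduct_mulVec, Matrix.vecMul_transpose]

namespace DelayedMJLS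

variable {n m L : ℕ} (S : DelayedMJLS n m L)

theorem dotProduct_Lam_mulVec {a b : Type*} [Fintype a] [Fintype b] (s t : ℕ)
    (f : (ℕ → Fin L) → Matrix a b ℝ) (i : Fin L) (v : a → ℝ) (x : b → ℝ) :
    v ⬝ᵥ S.Lam s t f i *ᵥ x = S.Lam s t (fun l => v ⬝ᵥ f l *ᵥ x) i := by
  let φ : Matrix a b ℝ →ₗ[ℝ] ℝ :=
    { toFun := fun M => v ⬝ᵥ M *ᵥ x
      map_add' := fun M M' => by simp [Matrix.add_mulVec]
      map_smul' := fun c M => by simp [Matrix.smul_mulVec] }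
  exact map_pathSum S.lam φ _ _ _ _

theorem Lam_succ {V : Type*} [AddCommMonoid V] [Module ℝ V] (t : ℕ) (f : Fin L → V) (i : Fin L) :
    S.Lam t (t + 1) (fun l => f (l (t + 1))) i = ∑ j, S.lam i j • f j := by
  simp [Lam, pathSum]

theorem window_fst_zero (t : ℕ) (x : Fin n → ℝ) : S.window t ((x, 0) : Aug n m) = (x, 0) := by
  rw [window_apply]
  simp
  rfl

theorem feed_fst_zero (t : ℕ) (i : Fin L) (x : Fin n → ℝ) :
    S.feed t i ((x, 0) : Aug n m) = S.T0 t i *ᵥ x := by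
  simp [feed_apply]

theorem advance_fst_zero (t : ℕ) (i : Fin L) (x : Fin n → ℝ) :
    S.advance t i ((x, 0) : Aug n m) = (S.A t i *ᵥ x, 0) := by
  simp [advance_apply]

theorem reduced_fst_of_value {t : ℕ} {i : Fin L} {x y : Fin n → ℝ}
    (h : S.value t i (x, 0) (y, 0) = y ⬝ᵥ (S.riccati t).P i *ᵥ x) :
    S.reduced t i (x, 0) (y, 0) = y ⬝ᵥ S.PmP0 t i *ᵥ x := by
  rw [reduced_apply, window_fst_zero, window_fst_zero, h, feed_fst_zero, feed_fst_zero, PmP0,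
    RiccatiData.PmP0, RiccatiData.P0, Matrix.sub_mulVec, dotProduct_sub, ← Matrix.mulVec_mulVec,
    ← Matrix.mulVec_mulVec, dotProduct_transpose_mulVec]

theorem value_fst (hd : 0 < S.d) : ∀ (c t : ℕ), t + c = S.N → ∀ (i : Fin L) (x y : Fin n → ℝ),
    S.value t i (x, 0) (y, 0) = y ⬝ᵥ (S.riccati t).P i *ᵥ x := by
  intro c
  induction c with
  | zero =>
    intro t ht i x y
    obtain rfl : t = S.N := ht
    exact S.value_final i (x, 0) (y, 0)
  | succ c ih =>
    intro t ht i x y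
    rw [S.value_step (by omega), S.P_eq hd (by omega), rhsP, S.Lam_succ t (fun j =>
      S.Q (t + 1) j + (S.A (t + 1) j)ᵀ * (S.riccati (t + 1)).PmP0 j * S.A (t + 1) j),
      Matrix.sum_mulVec, dotProduct_sum]
    refine Finset.sum_congr rfl fun j _ => ?_
    rw [stage_apply, advance_fst_zero, advance_fst_zero,
      S.reduced_fst_of_value (ih (t + 1) (by omega) j _ _), Matrix.smul_mulVec, dotProduct_smul,
      Matrix.add_mulVec, dotProduct_add, ← Matrix.mulVec_mulVec, ← Matrix.mulVec_mulVec,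
      dotProduct_transpose_mulVec]
    simp

theorem reduced_fst (hd : 0 < S.d) {t : ℕ} (ht : t ≤ S.N) (i : Fin L) (x y : Fin n → ℝ) :
    S.reduced t i (x, 0) (y, 0) = y ⬝ᵥ S.PmP0 t i *ᵥ x :=
  S.reduced_fst_of_value (S.value_fst hd (S.N - t) t (by omega) i x y)

/-! ### Propagation of a single input. -/

/-- The perturbation of inputs that equals `v` at the time `τ` only. -/
def pulse (τ : ℤ) (v : Fin m → ℝ) : Aug n m := (0, Pi.single τ v)

@[simp] theorem pulse_fst (τ : ℤ) (v : Fin m → ℝ) : (pulse τ v : Aug n m).1 = 0 := rfl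

@[simp] theorem pulse_self (τ : ℤ) (v : Fin m → ℝ) : (pulse τ v : Aug n m).2 τ = v := by
  simp [pulse]

theorem pulse_of_ne {τ σ : ℤ} (h : σ ≠ τ) (v : Fin m → ℝ) : (pulse τ v : Aug n m).2 σ = 0 := by
  simp [pulse, h]

theorem feed_pulse (t : ℕ) (i : Fin L) {j : ℕ} (hj : 1 ≤ j) (hjd : j < S.d) {τ : ℤ}
    (hτ : τ = (t : ℤ) - S.d + j) (v : Fin m → ℝ) :
    S.feed t i (pulse τ v) = S.T j t i *ᵥ v := by
  subst hτ
  rw [feed_apply, Finset.sum_eq_single j]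
  · simp
  · intro k _ hk
    rw [pulse_of_ne (by omega), Matrix.mulVec_zero]
  · intro h
    exact absurd (Finset.mem_Icc.2 ⟨hj, by omega⟩) h

theorem feed_pulse_of_le (t : ℕ) (i : Fin L) {τ : ℤ} (x : Fin n → ℝ)
    (hτ : τ ≤ (t : ℤ) - S.d ∨ t ≤ τ) (v : Fin m → ℝ) :
    S.feed t i (x, Pi.single τ v) = S.T0 t i *ᵥ x := by
  rw [feed_apply, Finset.sum_eq_zero, add_zero]
  intro k hk
  rw [Finset.mem_Icc] at hk
  simp [show (t : ℤ) - S.d + k ≠ τ by omega]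

theorem advance_pulse_of_ne (t : ℕ) (i : Fin L) {τ : ℤ} (hτ : τ ≠ (t : ℤ) - S.d) (v : Fin m → ℝ) :
    S.advance t i (pulse τ v) = pulse τ v := by
  rw [advance_apply, pulse_of_ne hτ.symm]
  simp [pulse]

/-- `value_unroll` carries the pulse unchanged through $d-1$ steps. In step $d$ it is charged by $R$
and becomes the state perturbation $Bv$. By then no input of `e` is pending, since `e` has none
after $t$, so only the state block $P-P^0$ is left. -/
theorem value_pulse_unroll (hd : 0 < S.d) {t : ℕ} (ht : t + S.d ≤ S.N) (i : Fin L) (e : Aug n m)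
    (he : ∀ τ : ℤ, t < τ → e.2 τ = 0) (v : Fin m → ℝ) :
    S.value t i e (pulse t v) =
      S.Lam t (t + S.d) (fun l => v ⬝ᵥ S.R (t + S.d) (l (t + S.d)) *ᵥ e.2 t
          + (S.B (t + S.d) (l (t + S.d)) *ᵥ v) ⬝ᵥ S.PmP0 (t + S.d) (l (t + S.d)) *ᵥ
              (S.advancePath S.d t l e).1) i
        - ∑ s ∈ Finset.Icc 1 (S.d - 1), S.Lam t (t + S.d - s) (fun l =>
            (S.T s (t + S.d - s) (l (t + S.d - s)) *ᵥ v) ⬝ᵥ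
              (S.W (t + S.d - s) (l (t + S.d - s)))⁻¹ *ᵥ
              S.feed (t + S.d - s) (l (t + S.d - s)) (S.advancePath (S.d - s) t l e)) i := by
  obtain ⟨d, hd'⟩ : ∃ d, S.d = d + 1 := ⟨S.d - 1, by omega⟩
  rw [S.value_unroll hd d t (fun _ => i) e (pulse t v) (by omega) he rfl
    (fun τ h => pulse_of_ne h.ne' v) (fun τ h => pulse_of_ne (by omega) v)]
  congr 1
  · rw [Lam, show t + S.d - t = d + 1 by omega, pathSum_succ_last]
    apply pathSum_congr
    intro l _
    rw [S.value_step (by omega)]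
    refine Finset.sum_congr rfl fun j _ => ?_
    have h0 : (((t + d + 1 : ℕ) : ℤ) - S.d) = t := by omega
    have hx : (S.advancePath d t l e).2 = e.2 := S.advancePath_snd d t l e
    have h1 : t + S.d = t + d + 1 := by omega
    rw [stage_apply, h0, pulse_self, hx, if_pos (by omega), pulse_fst, h1, Function.update_self,
      smul_eq_mul, zero_dotProduct, zero_add]
    have h2 : S.reduced (t + d + 1) j (S.advance (t + d + 1) j (S.advancePath d t l e))
        (S.advance (t + d + 1) j (pulse t v)) = S.reduced (t + d + 1) j
          ((S.advance (t + d + 1) j (S.advancePath d t l e)).1, 0)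
          (S.B (t + d + 1) j *ᵥ v, 0) := by
      refine S.reduced_congr _ _ rfl ?_ ?_ ?_
      · rw [advance_apply, h0, pulse_self, pulse_fst]
        simp
      · intro τ h3 _
        rw [advance_apply, hx]
        exact he τ (by omega)
      · intro τ h3 _
        exact pulse_of_ne (n := n) (by omega) v
    rw [h2, S.reduced_fst hd (by omega)]
    -- The mode at the last time does not influence earlier steps. The local `d` is the delay minus
    -- one, and the alternative `d < q` takes the place of a bound on `q` in the induction.
    have h3 : ∀ q, S.advancePath q t (Function.update l (t + d + 1) j) e
        = S.advancePath q t l e ∨ d < q := by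
      intro q
      induction q with
      | zero => exact Or.inl rfl
      | succ q ih =>
        rcases ih with ih | ih
        · by_cases hq : d < q + 1
          · exact Or.inr hq
          · left
            rw [advancePath_succ, advancePath_succ, ih, Function.update_of_ne (by omega)]
        · exact Or.inr (by omega)
    rw [show S.d = d + 1 from hd', advancePath_succ, Function.update_self,
      (h3 d).resolve_right (lt_irrefl d)]
  · rw [show S.d - 1 = d by omega]
    -- The minimization at time $t+q+1$ is the one that the recursion labels by $s$, counted back
    -- from $t$ plus the delay.
    refine Finset.sum_bij' (fun q _ => d - q) (fun s _ => d - s) ?_ ?_ ?_ ?_ ?_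
    · intro q hq
      rw [Finset.mem_range] at hq
      rw [Finset.mem_Icc]
      omega
    · intro q hq
      rw [Finset.mem_Icc] at hq
      rw [Finset.mem_range]
      omega
    · intro q hq
      rw [Finset.mem_range] at hq
      omega
    · intro q hq
      rw [Finset.mem_Icc] at hq
      omega
    · intro q hq
      rw [Finset.mem_range] at hq
      rw [Lam, show t + S.d - (d - q) = t + q + 1 by omega, show S.d - (d - q) = q + 1 by omega,
        show t + q + 1 - t = q + 1 by omega]
      apply pathSum_congr
      intro l _
      rw [S.feed_pulse (t + q + 1) _ (j := d - q) (by omega) (by omega) (by omega)]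

theorem advancePath_fst_zero (l : ℕ → Fin L) (t : ℕ) (x : Fin n → ℝ) (q : ℕ) :
    S.advancePath q t l ((x, 0) : Aug n m) = (S.F l (t + q) (t + 1) *ᵥ x, 0) := by
  have h : ∀ q, S.F l (t + q) (t + 1) = S.transition l (t + 1) q := by
    intro q
    rw [F, show t + q + 1 - (t + 1) = q by omega]
  induction q with
  | zero => rw [h, transition, Matrix.one_mulVec]; rfl
  | succ q ih =>
    rw [advancePath_succ, ih, advance_fst_zero, Matrix.mulVec_mulVec, h, h, transition,
      show t + 1 + q = t + q + 1 by omega]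

theorem advancePath_pulse_of_lt (l : ℕ → Fin L) (t : ℕ) {j : ℕ} (v : Fin m → ℝ) {q : ℕ}
    (hq : q < j) :
    S.advancePath q t l (pulse ((t : ℤ) - S.d + j) v : Aug n m)
      = pulse ((t : ℤ) - S.d + j) v := by
  induction q with
  | zero => rfl
  | succ q ih =>
    rw [advancePath_succ, ih (by omega), advance_pulse_of_ne _ _ _ (by push_cast; omega)]

/-- The input $u(t-d+j)$ enters the state in step $j$ and is then transported by the $A$'s. The
dynamics never erase it from the record of inputs, hence the second component. -/
theorem advancePath_pulse_of_le (l : ℕ → Fin L) (t : ℕ) {j : ℕ} (hj : 1 ≤ j) (v : Fin m → ℝ)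
    {q : ℕ} (hq : j ≤ q) :
    S.advancePath q t l (pulse ((t : ℤ) - S.d + j) v : Aug n m)
      = (S.F l (t + q) (t + j + 1) *ᵥ S.B (t + j) (l (t + j)) *ᵥ v,
          Pi.single ((t : ℤ) - S.d + j) v) := by
  obtain ⟨r, rfl⟩ := Nat.exists_eq_add_of_le hq
  have h : ∀ r, S.F l (t + (j + r)) (t + j + 1) = S.transition l (t + j + 1) r := by
    intro q
    rw [F, show t + (j + q) + 1 - (t + j + 1) = q by omega]
  rw [h]
  clear hq
  induction r with
  | zero =>
    obtain ⟨j, rfl⟩ : ∃ k, j = k + 1 := ⟨j - 1, by omega⟩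
    rw [add_zero, advancePath_succ, advancePath_pulse_of_lt _ _ _ _ (Nat.lt_succ_self j),
      advance_apply, transition, Matrix.one_mulVec, pulse_fst, Matrix.mulVec_zero, zero_add,
      show (((t + j + 1 : ℕ) : ℤ) - S.d) = (t : ℤ) - S.d + ((j + 1 : ℕ) : ℤ) by push_cast; ring,
      pulse_self]
    rfl
  | succ r ih =>
    rw [← add_assoc, advancePath_succ, ih, advance_apply, transition,
      show t + j + 1 + r = t + (j + r) + 1 by omega]
    have : (Pi.single ((t : ℤ) - S.d + j) v : ℤ → Fin m → ℝ)
        (((t + (j + r) + 1 : ℕ) : ℤ) - S.d) = 0 := by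
      rw [Pi.single_eq_of_ne]
      push_cast
      omega
    simp only [this, Matrix.mulVec_zero, add_zero, Matrix.mulVec_mulVec, Matrix.mul_assoc]

end DelayedMJLS

/-! ### The Riccati matrices as blocks of the cost-to-go. -/

namespace DelayedMJLS

variable {n m L : ℕ} (S : DelayedMJLS n m L)

theorem value_fst_pulse (hd : 0 < S.d) {t : ℕ} (ht : t + S.d ≤ S.N) (i : Fin L) (x : Fin n → ℝ)
    (v : Fin m → ℝ) : S.value t i (x, 0) (pulse t v) = v ⬝ᵥ S.T0 t i *ᵥ x := by
  rw [S.value_pulse_unroll hd ht i _ (fun _ _ => rfl), S.T0_eq hd ht, rhsT0]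
  simp only [Matrix.sub_mulVec, dotProduct_sub, Matrix.sum_mulVec, dotProduct_sum,
    dotProduct_Lam_mulVec]
  congr 1
  · congr 1
    funext l
    rw [advancePath_fst_zero]
    simp only [Pi.zero_apply, Matrix.mulVec_zero, dotProduct_zero, zero_add,
      ← Matrix.mulVec_mulVec, dotProduct_transpose_mulVec]
  · refine Finset.sum_congr rfl fun s hs => ?_
    rw [Finset.mem_Icc] at hs
    congr 1
    funext l
    rw [advancePath_fst_zero, feed_fst_zero, show t + (S.d - s) = t + S.d - s by omega]
    simp only [← Matrix.mulVec_mulVec, dotProduct_transpose_mulVec]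

theorem value_pulse_pulse (hd : 0 < S.d) {t : ℕ} (ht : t + S.d ≤ S.N) (i : Fin L) {j : ℕ}
    (hj : 1 ≤ j) (hjd : j < S.d) (w v : Fin m → ℝ) :
    S.value t i (pulse ((t : ℤ) - S.d + j) w) (pulse t v) = v ⬝ᵥ S.T j t i *ᵥ w := by
  rw [S.value_pulse_unroll hd ht i _ (fun _ _ => pulse_of_ne (by omega) _),
    S.T_eq hd ht hj hjd, rhsT]
  simp only [Matrix.sub_mulVec, dotProduct_sub, Matrix.sum_mulVec, dotProduct_sum,
    dotProduct_Lam_mulVec]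
  rw [sub_sub]
  congr 1
  · congr 1
    funext l
    rw [S.advancePath_pulse_of_le l t hj w hjd.le, pulse_of_ne (by omega)]
    simp only [Matrix.mulVec_zero, dotProduct_zero, zero_add,
      ← Matrix.mulVec_mulVec, dotProduct_transpose_mulVec]
  · have hsplit : Finset.Icc 1 (S.d - 1)
        = Finset.Icc 1 (S.d - j) ∪ Finset.Icc (S.d - j + 1) (S.d - 1) := by
      ext s
      simp only [Finset.mem_union, Finset.mem_Icc]
      omega
    rw [hsplit, Finset.sum_union]
    · congr 1
      · refine Finset.sum_congr rfl fun s hs => ?_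
        rw [Finset.mem_Icc] at hs
        congr 1
        funext l
        rw [S.advancePath_pulse_of_le l t hj w (q := S.d - s) (by omega),
          S.feed_pulse_of_le _ _ _ (by omega), show t + (S.d - s) = t + S.d - s by omega]
        simp only [← Matrix.mulVec_mulVec, dotProduct_transpose_mulVec]
      · refine Finset.sum_congr rfl fun s hs => ?_
        rw [Finset.mem_Icc] at hs
        congr 1
        funext l
        rw [S.advancePath_pulse_of_lt l t w (q := S.d - s) (by omega),
          S.feed_pulse (t + S.d - s) _ (j := s - (S.d - j)) (by omega) (by omega) (by omega)]
        simp only [← Matrix.mulVec_mulVec, dotProduct_transpose_mulVec]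
    · rw [Finset.disjoint_left]
      intro s hs
      rw [Finset.mem_Icc] at hs ⊢
      omega

theorem value_pulse_self (hd : 0 < S.d) {t : ℕ} (ht : t + S.d ≤ S.N) (i : Fin L)
    (w v : Fin m → ℝ) :
    S.value t i (pulse t w) (pulse t v) = v ⬝ᵥ S.W t i *ᵥ w := by
  -- The current input is the case $j=d$ of the pulse lemmas.
  have ht' : (t : ℤ) = (t : ℤ) - S.d + S.d := by ring
  rw [S.value_pulse_unroll hd ht i _ (fun _ h => pulse_of_ne (by omega) _), S.W_eq hd ht, rhsW]
  simp only [Matrix.sub_mulVec, dotProduct_sub, Matrix.sum_mulVec, dotProduct_sum,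
    dotProduct_Lam_mulVec]
  congr 1
  · congr 1
    funext l
    have := S.advancePath_pulse_of_le l t (j := S.d) hd w le_rfl
    rw [← ht'] at this
    rw [this, pulse_self, F, Nat.sub_self, transition, Matrix.one_mulVec]
    simp only [Matrix.add_mulVec, dotProduct_add, ← Matrix.mulVec_mulVec,
      dotProduct_transpose_mulVec]
    ring
  · refine Finset.sum_congr rfl fun s hs => ?_
    rw [Finset.mem_Icc] at hs
    congr 1
    funext l
    have := S.advancePath_pulse_of_lt l t (j := S.d) w (q := S.d - s) (by omega)
    rw [← ht'] at this
    rw [this, S.feed_pulse (t + S.d - s) _ (j := s) (by omega) (by omega) (by omega)]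
    simp only [← Matrix.mulVec_mulVec, dotProduct_transpose_mulVec]

/-- Such an input would act only after the horizon, and all feedback maps passed on the way to $N$
are zero. -/
theorem value_pulse_late (hd : 0 < S.d) {t : ℕ} (ht : S.N < t + S.d) (htN : t ≤ S.N) (i : Fin L)
    (e : Aug n m) (he : ∀ τ : ℤ, t < τ → e.2 τ = 0) (v : Fin m → ℝ) :
    S.value t i e (pulse t v) = 0 := by
  rw [S.value_unroll hd (S.N - t) t (fun _ => i) e (pulse t v) (by omega) he rfl
    (fun τ h => pulse_of_ne h.ne' v) (fun τ h => pulse_of_ne (by omega) v)]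
  have hz : ∀ (a r : ℕ) (l : ℕ → Fin L), pathSum S.lam a r (fun _ => (0 : ℝ)) l = 0 := by
    intro a r l
    exact (map_pathSum S.lam (0 : ℝ →ₗ[ℝ] ℝ) r a (fun _ => 0) l).symm
  rw [Finset.sum_eq_zero, sub_zero]
  · rw [show t + (S.N - t) = S.N by omega]
    simp only [value_final, pulse_fst, zero_dotProduct, hz]
  · intro q hq
    rw [Finset.mem_range] at hq
    have : ∀ (j : Fin L) (e : Aug n m), S.feed (t + q + 1) j e = 0 :=
      fun j e => S.feed_late hd (by omega) (by omega) j e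
    simp only [this, zero_dotProduct, hz]

/-- Only the state and the inputs in the window matter, and they enter linearly. -/
theorem value_decomp (hd : 0 < S.d) {t : ℕ} (htN : t ≤ S.N) (i : Fin L) (e f : Aug n m) :
    S.value t i e f = S.value t i (e.1, 0) f
      + ∑ j ∈ Finset.Icc 1 S.d,
          S.value t i (pulse ((t : ℤ) - S.d + j) (e.2 ((t : ℤ) - S.d + j))) f := by
  have : S.value t i e f = S.value t i ((e.1, 0)
      + ∑ j ∈ Finset.Icc 1 S.d, pulse ((t : ℤ) - S.d + j) (e.2 ((t : ℤ) - S.d + j))) f := by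
    refine S.value_congr hd htN i ?_ rfl ?_ fun _ _ _ => rfl
    · simp [Prod.fst_sum]
    · intro τ h1 h2
      obtain ⟨j, hj⟩ : ∃ j : ℕ, τ = (t : ℤ) - S.d + j := ⟨(τ - (t - S.d)).toNat, by omega⟩
      rw [Prod.snd_add, Prod.snd_sum, Pi.add_apply, Finset.sum_apply,
        Finset.sum_eq_single j]
      · rw [hj, pulse_self]
        simp
      · intro k _ hk
        exact pulse_of_ne (by omega) _
      · intro h
        exact absurd (Finset.mem_Icc.2 ⟨by omega, by omega⟩) h
  rw [this, map_add, LinearMap.add_apply, map_sum, LinearMap.sum_apply]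

/-- The cross terms of the cost-to-go with the current input are given by `T⁰`, `T^j` and `W`. -/
theorem value_pulse (hd : 0 < S.d) {t : ℕ} (htN : t ≤ S.N) (i : Fin L)
    (e : Aug n m) (v : Fin m → ℝ) :
    S.value t i e (pulse t v) = v ⬝ᵥ (S.feed t i e + S.W t i *ᵥ e.2 t) := by
  by_cases ht : t + S.d ≤ S.N
  · rw [S.value_decomp hd htN, S.value_fst_pulse hd ht, feed_apply, dotProduct_add, dotProduct_add,
      dotProduct_sum, add_assoc]
    congr 1
    have hs : Finset.Icc 1 S.d = insert S.d (Finset.Icc 1 (S.d - 1)) := by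
      ext s
      simp only [Finset.mem_insert, Finset.mem_Icc]
      omega
    rw [hs, Finset.sum_insert (by simp; omega), add_comm,
      show (t : ℤ) - S.d + S.d = t by ring, S.value_pulse_self hd ht]
    congr 1
    refine Finset.sum_congr rfl fun j hj => ?_
    rw [Finset.mem_Icc] at hj
    exact S.value_pulse_pulse hd ht i hj.1 (by omega) _ _
  · have : S.value t i e (pulse t v)
        = S.value t i (e.1, fun τ => if τ ≤ t then e.2 τ else 0) (pulse t v) :=
      S.value_congr hd htN i rfl rfl (fun τ _ h => by simp [h]) fun _ _ _ => rfl
    rw [this, S.value_pulse_late hd (by omega) htN i _ (fun τ h => by simp [not_le.2 h]),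
      S.feed_late hd (by omega) htN, S.W_late hd (by omega) htN]
    simp

end DelayedMJLS

theorem Matrix.IsSymm.dotProduct_mulVec_comm {a : Type*} [Fintype a] {M : Matrix a a ℝ}
    (hM : M.IsSymm) (x y : a → ℝ) : x ⬝ᵥ M *ᵥ y = y ⬝ᵥ M *ᵥ x := by
  conv_lhs => rw [← hM.eq, dotProduct_transpose_mulVec]

theorem Matrix.isSymm_of_dotProduct_mulVec_comm {a : Type*} [Fintype a]
    {M : Matrix a a ℝ} (h : ∀ x y : a → ℝ, x ⬝ᵥ M *ᵥ y = y ⬝ᵥ M *ᵥ x) : M.IsSymm := by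
  classical
  ext i j
  have := h (Pi.single j 1) (Pi.single i 1)
  simpa using this

/-! ### Symmetry and completion of the square. -/

namespace DelayedMJLS

variable {n m L : ℕ} (S : DelayedMJLS n m L)

theorem window_pulse {t : ℕ} {τ : ℤ} (h1 : (t : ℤ) - S.d < τ) (h2 : τ < t) (v : Fin m → ℝ) :
    S.window t (pulse τ v : Aug n m) = pulse τ v := by
  rw [window_apply]
  refine Prod.ext rfl (funext fun σ => ?_)
  by_cases hσ : σ = τ
  · subst hσ
    simp [h1, h2]
  · simp [pulse_of_ne (n := n) hσ]

theorem reduced_pulse_of_out {t : ℕ} (i : Fin L) {τ : ℤ} (hτ : τ ≤ (t : ℤ) - S.d ∨ t ≤ τ)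
    (e : Aug n m) (v : Fin m → ℝ) : S.reduced t i e (pulse τ v) = 0 := by
  have : S.reduced t i e (pulse τ v) = S.reduced t i e 0 :=
    S.reduced_congr t i rfl rfl (fun _ _ _ => rfl) fun σ h1 h2 => pulse_of_ne (n := n) (by omega) v
  rw [this, map_zero]

/-- The cost of the deviation from the minimizer of the cost-to-go over the input at time `t`, as a
bilinear form. -/
noncomputable def gap (t : ℕ) (i : Fin L) (e f : Aug n m) : ℝ :=
  f.2 t ⬝ᵥ S.W t i *ᵥ e.2 t + f.2 t ⬝ᵥ S.feed t i e + e.2 t ⬝ᵥ S.feed t i f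
    + S.feed t i f ⬝ᵥ (S.W t i)⁻¹ *ᵥ S.feed t i e

/-- Symmetry of $W$ is read off from the form, of which $W$ is a diagonal block. In the backward
induction for `value_symm` it makes $W^{-1}$ symmetric, hence `reduced`, hence the form one step
earlier. -/
theorem W_isSymm_of_value_symm (hd : 0 < S.d) {t : ℕ} (htN : t ≤ S.N) (i : Fin L)
    (h : ∀ e f : Aug n m, S.value t i e f = S.value t i f e) : (S.W t i).IsSymm := by
  refine Matrix.isSymm_of_dotProduct_mulVec_comm fun x y => ?_
  have hf : ∀ v, S.feed t i (pulse t v) = 0 := fun v => by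
    have := S.feed_pulse_of_le t i 0 (τ := t) (Or.inr le_rfl) v
    rwa [Matrix.mulVec_zero] at this
  have := h (pulse t y) (pulse t x)
  rwa [S.value_pulse hd htN, S.value_pulse hd htN, hf, hf, zero_add, zero_add, pulse_self,
    pulse_self] at this

theorem reduced_symm_of_value_symm (hd : 0 < S.d) {t : ℕ} (htN : t ≤ S.N) (i : Fin L)
    (h : ∀ e f : Aug n m, S.value t i e f = S.value t i f e) (e f : Aug n m) :
    S.reduced t i e f = S.reduced t i f e := by
  rw [reduced_apply, reduced_apply, h,
    (S.W_isSymm_of_value_symm hd htN i h).inv.dotProduct_mulVec_comm]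

section Symmetry

variable (hd : 0 < S.d) (hQ : ∀ k, k ≤ S.N → ∀ i, (S.Q k i).IsSymm)
  (hR : ∀ k, S.d ≤ k → k ≤ S.N → ∀ i, (S.R k i).IsSymm) (hPT : ∀ i, (S.PT i).IsSymm)
include hd hQ hR hPT

theorem value_symm : ∀ {t : ℕ}, t ≤ S.N → ∀ (i : Fin L) (e f : Aug n m),
    S.value t i e f = S.value t i f e := by
  suffices H : ∀ c t : ℕ, t + c = S.N → ∀ (i : Fin L) (e f : Aug n m),
      S.value t i e f = S.value t i f e from
    fun {t} ht => H (S.N - t) t (by omega)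
  intro c
  induction c with
  | zero =>
    intro t ht i e f
    obtain rfl : t = S.N := ht
    have hP : ((S.riccati S.N).P i).IsSymm := by
      rw [riccati_final, riccatiFinal]
      simp only [S.Lam_succ S.N S.PT]
      rw [Matrix.IsSymm, Matrix.transpose_sum]
      refine Finset.sum_congr rfl fun j _ => ?_
      rw [Matrix.transpose_smul, (hPT j).eq]
    rw [value_final, value_final, hP.dotProduct_mulVec_comm]
  | succ c ih =>
    intro t ht i e f
    rw [S.value_step (by omega), S.value_step (by omega)]
    refine Finset.sum_congr rfl fun j _ => ?_
    rw [S.reduced_symm_of_value_symm hd (by omega) j (ih (t + 1) (by omega) j), stage_apply,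
      stage_apply, (hQ (t + 1) (by omega) j).dotProduct_mulVec_comm]
    split_ifs with h
    · rw [(hR (t + 1) h (by omega) j).dotProduct_mulVec_comm]
    · rfl

theorem W_isSymm {t : ℕ} (ht : t ≤ S.N) (i : Fin L) : (S.W t i).IsSymm :=
  S.W_isSymm_of_value_symm hd ht i (S.value_symm hd hQ hR hPT ht i)

theorem reduced_symm {t : ℕ} (ht : t ≤ S.N) (i : Fin L) (e f : Aug n m) :
    S.reduced t i e f = S.reduced t i f e :=
  S.reduced_symm_of_value_symm hd ht i (S.value_symm hd hQ hR hPT ht i) e f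

/-- Both arguments are split into their windowed part and the pulse of the current input; symmetry
and `value_pulse` evaluate the cross terms. The term with $W^{-1}$ cancels between `reduced` and
`gap`, so $W$ may be singular. -/
theorem value_eq_reduced_add_gap {t : ℕ} (ht : t ≤ S.N) (i : Fin L) (e f : Aug n m) :
    S.value t i e f = S.reduced t i e f + S.gap t i e f := by
  have hw : ∀ e : Aug n m, ∀ τ : ℤ, (t : ℤ) - S.d < τ → τ ≤ t →
      e.2 τ = (S.window t e + pulse t (e.2 t)).2 τ := by
    intro e τ h1 h2
    rw [Prod.snd_add, Pi.add_apply, window_apply]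
    dsimp only
    by_cases h : τ = t
    · subst h
      simp
    · rw [if_pos ⟨h1, by omega⟩, pulse_of_ne h, add_zero]
  have hf : ∀ e : Aug n m, S.feed t i (S.window t e) = S.feed t i e := by
    intro e
    refine S.feed_congr t i rfl fun τ h1 h2 => ?_
    rw [window_apply]
    exact if_pos ⟨h1, h2⟩
  have hp : ∀ v, S.feed t i (pulse t v) = 0 := fun v => by
    have := S.feed_pulse_of_le t i 0 (τ := t) (Or.inr le_rfl) v
    rwa [Matrix.mulVec_zero] at this
  have hz : ∀ e : Aug n m, (S.window t e).2 t = 0 := by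
    intro e
    rw [window_apply]
    simp
  rw [S.value_congr hd ht i (e' := S.window t e + pulse t (e.2 t))
    (f' := S.window t f + pulse t (f.2 t)) (by simp [window_apply]) (by simp [window_apply])
    (hw e) (hw f)]
  simp only [map_add, LinearMap.add_apply]
  rw [S.value_symm hd hQ hR hPT ht i (pulse t (e.2 t)) (S.window t f), S.value_pulse hd ht,
    S.value_pulse hd ht, S.value_pulse hd ht, hf, hf, hp, hz, hz, pulse_self, reduced_apply, gap]
  simp only [Matrix.mulVec_zero, add_zero, zero_add]
  ring

end Symmetry

/-- First-order condition: at the minimizer the gap vanishes against every direction `f`, which is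
what the costate needs, and not only on the diagonal. -/
theorem gap_eq_zero {t : ℕ} {i : Fin L} (e f : Aug n m)
    (hu : S.W t i *ᵥ (S.W t i)⁻¹ *ᵥ S.feed t i e = S.feed t i e)
    (he : e.2 t = -((S.W t i)⁻¹ *ᵥ S.feed t i e)) : S.gap t i e f = 0 := by
  rw [gap, he, Matrix.mulVec_neg, hu, dotProduct_neg, neg_dotProduct,
    dotProduct_comm ((S.W t i)⁻¹ *ᵥ S.feed t i e)]
  ring

/-! ### The gradient of the minimized cost-to-go and the matrices $\delta$, $\alpha$. -/

theorem delta_one {t : ℕ} (ht : t < S.N) (i : Fin L) : S.delta 1 t i =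
    (S.Lam t (t + 1) (fun l => (S.A (t + 1) (l (t + 1)))ᵀ * S.PmP0 (t + 1) (l (t + 1))
          * S.B (t + 1) (l (t + 1))) i
        - (S.T0 t i)ᵀ * (S.W t i)⁻¹ * S.T 1 t i)ᵀ := by
  rw [delta, if_pos ht]

theorem delta_succ_succ {t : ℕ} (ht : t < S.N) (j : ℕ) (i : Fin L) : S.delta (j + 2) t i =
    (S.Lam t (t + 1) (fun l => (S.A (t + 1) (l (t + 1)))ᵀ
          * (S.delta (j + 1) (t + 1) (l (t + 1)))ᵀ) i
        - (S.T0 t i)ᵀ * (S.W t i)⁻¹ * S.T (j + 2) t i)ᵀ := by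
  rw [delta, if_pos ht]

theorem delta_final (j : ℕ) (i : Fin L) : S.delta j S.N i = 0 := by
  rcases j with _ | _ | j <;> simp [delta]

/-- One step later the input with index $j$ has index $j-1$, which gives the recursion of
$\delta^j$. For $j=1$ it acts in that step and meets the state block $P-P^0$. -/
theorem reduced_pulse_fst (hd : 0 < S.d) (j : ℕ) : ∀ {t : ℕ}, t ≤ S.N → 1 ≤ j → j < S.d →
    ∀ (i : Fin L) {τ : ℤ}, τ = (t : ℤ) - S.d + j → ∀ (v : Fin m → ℝ) (x : Fin n → ℝ),
    S.reduced t i (pulse τ v) (x, 0) = x ⬝ᵥ (S.delta j t i)ᵀ *ᵥ v := by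
  induction j with
  | zero => intro t _ h; omega
  | succ j ih =>
    intro t ht hj hjd i τ hτ v x
    rw [reduced_apply, S.window_pulse (by omega) (by omega), window_fst_zero, feed_fst_zero,
      S.feed_pulse t i hj hjd hτ]
    rcases ht.lt_or_eq with h | rfl
    · rw [S.value_step h]
      have hst : ∀ i, S.stage (t + 1) i (pulse τ v) (x, 0) = 0 := by
        intro i
        simp [stage_apply]
      simp only [hst, zero_add, advance_fst_zero]
      rcases j with _ | j
      · have hred : ∀ i, S.reduced (t + 1) i (S.advance (t + 1) i (pulse τ v))
            (S.A (t + 1) i *ᵥ x, 0)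
            = S.reduced (t + 1) i (S.B (t + 1) i *ᵥ v, 0) (S.A (t + 1) i *ᵥ x, 0) := by
          intro i
          refine S.reduced_congr _ _ ?_ rfl ?_ fun _ _ _ => rfl
          · rw [advance_apply, show (((t + 1 : ℕ) : ℤ) - S.d) = τ by rw [hτ]; push_cast; ring,
              pulse_self]
            simp
          · intro σ h1 h2
            exact pulse_of_ne (n := n) (by push_cast at hτ h1; omega) v
        simp only [hred, S.reduced_fst hd h]
        rw [zero_add, S.delta_one h, Matrix.transpose_transpose, Matrix.sub_mulVec, dotProduct_sub,
          S.Lam_succ t (fun i => (S.A (t + 1) i)ᵀ * S.PmP0 (t + 1) i * S.B (t + 1) i),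
          Matrix.sum_mulVec, dotProduct_sum]
        simp only [Matrix.smul_mulVec, dotProduct_smul, smul_eq_mul, ← Matrix.mulVec_mulVec,
          dotProduct_transpose_mulVec]
      · have hred : ∀ i, S.reduced (t + 1) i (S.advance (t + 1) i (pulse τ v))
            (S.A (t + 1) i *ᵥ x, 0)
            = (S.A (t + 1) i *ᵥ x) ⬝ᵥ (S.delta (j + 1) (t + 1) i)ᵀ *ᵥ v := by
          intro i
          rw [S.advance_pulse_of_ne _ _ (by push_cast at hτ ⊢; omega)]
          exact ih h (by omega) (by omega) i (by rw [hτ]; push_cast; ring) v _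
        simp only [hred]
        rw [S.delta_succ_succ h, Matrix.transpose_transpose, Matrix.sub_mulVec, dotProduct_sub,
          S.Lam_succ t (fun i => (S.A (t + 1) i)ᵀ * (S.delta (j + 1) (t + 1) i)ᵀ),
          Matrix.sum_mulVec, dotProduct_sum]
        simp only [Matrix.smul_mulVec, dotProduct_smul, smul_eq_mul, ← Matrix.mulVec_mulVec,
          dotProduct_transpose_mulVec]
    · rw [value_final, S.T0_late hd (by omega) le_rfl, delta_final]
      simp

theorem reduced_decomp (t : ℕ) (i : Fin L) (e f : Aug n m) :
    S.reduced t i e f = S.reduced t i (e.1, 0) f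
      + ∑ j ∈ Finset.Icc 1 (S.d - 1),
          S.reduced t i (pulse ((t : ℤ) - S.d + j) (e.2 ((t : ℤ) - S.d + j))) f := by
  have : S.reduced t i e f = S.reduced t i ((e.1, 0)
      + ∑ j ∈ Finset.Icc 1 (S.d - 1),
          pulse ((t : ℤ) - S.d + j) (e.2 ((t : ℤ) - S.d + j))) f := by
    refine S.reduced_congr t i ?_ rfl ?_ fun _ _ _ => rfl
    · simp [Prod.fst_sum]
    · intro τ h1 h2
      obtain ⟨j, hj⟩ : ∃ j : ℕ, τ = (t : ℤ) - S.d + j := ⟨(τ - (t - S.d)).toNat, by omega⟩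
      rw [Prod.snd_add, Prod.snd_sum, Pi.add_apply, Finset.sum_apply,
        Finset.sum_eq_single j]
      · rw [hj, pulse_self]
        simp
      · intro k _ hk
        exact pulse_of_ne (by omega) _
      · intro h
        exact absurd (Finset.mem_Icc.2 ⟨by omega, by omega⟩) h
  rw [this, map_add, LinearMap.add_apply, map_sum, LinearMap.sum_apply]

/-- The gradient of the minimized cost-to-go in the direction of the state. -/
theorem reduced_fst_right (hd : 0 < S.d) {t : ℕ} (ht : t ≤ S.N) (i : Fin L) (e : Aug n m)
    (x : Fin n → ℝ) : S.reduced t i e (x, 0) = x ⬝ᵥ (S.PmP0 t i *ᵥ e.1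
      + ∑ j ∈ Finset.Icc 1 (S.d - 1), (S.delta j t i)ᵀ *ᵥ e.2 ((t : ℤ) - S.d + j)) := by
  rw [reduced_decomp, S.reduced_fst hd ht, dotProduct_add, dotProduct_sum]
  congr 1
  refine Finset.sum_congr rfl fun j hj => ?_
  rw [Finset.mem_Icc] at hj
  exact S.reduced_pulse_fst hd j ht hj.1 (by omega) i rfl _ _

theorem alpha_transpose (j t : ℕ) (l : ℕ → Fin L) : (S.alpha j t l)ᵀ =
    (S.delta (S.d - j) t (l t))ᵀ - ∑ s ∈ Finset.Icc 1 (j - 1),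
      (S.alpha s t l)ᵀ * (S.W (t - s) (l (t - s)))⁻¹ * S.T (S.d - j + s) (t - s) (l (t - s)) := by
  rw [alpha, Matrix.transpose_transpose]
  congr 1
  rw [Fin.sum_univ_eq_sum_range (fun s => (S.alpha (s + 1) t l)ᵀ *
    (S.W (t - (s + 1)) (l (t - (s + 1))))⁻¹
      * S.T (S.d - j + (s + 1)) (t - (s + 1)) (l (t - (s + 1)))) (j - 1),
    Finset.range_eq_Ico, Finset.sum_Ico_add' (fun s => (S.alpha s t l)ᵀ *
    (S.W (t - s) (l (t - s)))⁻¹ * S.T (S.d - j + s) (t - s) (l (t - s)))]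
  refine Finset.sum_congr ?_ fun _ _ => rfl
  ext s
  simp only [Finset.mem_Ico, Finset.mem_Icc]
  omega

end DelayedMJLS

/-! ### Functions of the mode history, the Markov property and conditional expectations. -/

/-- `f` is a function of the modes `θ(0), …, θ(t)`. -/
def IsPast {Ω X : Type*} {L : ℕ} (θ : ℕ → Ω → Fin L) (t : ℕ) (f : Ω → X) : Prop :=
  ∀ ω ω', (∀ s ≤ t, θ s ω = θ s ω') → f ω = f ω'

section Past

variable {Ω : Type*} {L : ℕ} {θ : ℕ → Ω → Fin L} {t : ℕ}

theorem isPast_const {X : Type*} (c : X) : IsPast θ t (fun _ => c) := fun _ _ _ => rfl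

theorem isPast_mode {s : ℕ} (h : s ≤ t) : IsPast θ t (θ s) := fun _ _ hω => hω s h

theorem IsPast.mono {X : Type*} {f : Ω → X} {s : ℕ} (hf : IsPast θ s f) (h : s ≤ t) :
    IsPast θ t f := fun ω ω' hω => hf ω ω' fun r hr => hω r (hr.trans h)

theorem IsPast.comp {X Y : Type*} {f : Ω → X} (F : X → Y) (hf : IsPast θ t f) :
    IsPast θ t fun ω => F (f ω) := fun ω ω' hω => congrArg F (hf ω ω' hω)

theorem IsPast.comp₂ {X Y Z : Type*} {f : Ω → X} {g : Ω → Y} (F : X → Y → Z) (hf : IsPast θ t f)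
    (hg : IsPast θ t g) : IsPast θ t fun ω => F (f ω) (g ω) :=
  fun ω ω' hω => congrArg₂ F (hf ω ω' hω) (hg ω ω' hω)

theorem IsPast.comp₃ {W X Y Z : Type*} {f : Ω → X} {g : Ω → Y} {h : Ω → W} (F : X → Y → W → Z)
    (hf : IsPast θ t f) (hg : IsPast θ t g) (hh : IsPast θ t h) :
    IsPast θ t fun ω => F (f ω) (g ω) (h ω) := by
  intro ω ω' hω
  simp only [hf ω ω' hω, hg ω ω' hω, hh ω ω' hω]

theorem IsPast.sum {ι V : Type*} [AddCommMonoid V] {s : Finset ι} {f : ι → Ω → V}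
    (hf : ∀ i ∈ s, IsPast θ t (f i)) : IsPast θ t fun ω => ∑ i ∈ s, f i ω :=
  fun ω ω' hω => Finset.sum_congr rfl fun i hi => hf i hi ω ω' hω

/-- The modes up to the time `t`, as a tuple. -/
def pastModes (θ : ℕ → Ω → Fin L) (t : ℕ) (ω : Ω) : Fin (t + 1) → Fin L := fun s => θ s ω

theorem pastModes_eq_iff {ω ω' : Ω} :
    pastModes θ t ω = pastModes θ t ω' ↔ ∀ s ≤ t, θ s ω = θ s ω' := by
  rw [funext_iff, Fin.forall_iff]
  exact ⟨fun h s hs => h s (by omega), fun h s hs => h s (by omega)⟩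

theorem IsPast.exists_eq_comp {X : Type*} [Nonempty X] {f : Ω → X} (hf : IsPast θ t f) :
    ∃ g : (Fin (t + 1) → Fin L) → X, f = g ∘ pastModes θ t := by
  have h : Function.FactorsThrough f (pastModes θ t) :=
    fun ω ω' hω => hf ω ω' (pastModes_eq_iff.1 hω)
  exact ⟨Function.extend (pastModes θ t) f fun _ => Classical.arbitrary X, (h.extend_comp _).symm⟩

theorem measurable_pastModes : Measurable[modeSigma θ t] (pastModes θ t) := by
  refine (@measurable_pi_iff _ _ _ (modeSigma θ t) _ _).2 fun s => ?_
  have : MeasurableSpace.comap (θ s) ⊤ ≤ modeSigma θ t :=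
    le_iSup (fun s : Fin (t + 1) => MeasurableSpace.comap (θ s) ⊤) s
  exact fun A _ => this _ ⟨A, trivial, rfl⟩

theorem modeSigma_le_comap : modeSigma θ t ≤ MeasurableSpace.comap (pastModes θ t) ⊤ := by
  refine iSup_le fun s => ?_
  rintro _ ⟨A, _, rfl⟩
  exact ⟨{p | p s ∈ A}, trivial, rfl⟩

theorem IsPast.of_measurable {X : Type*} [MeasurableSpace X] [MeasurableSingletonClass X]
    {f : Ω → X} (hf : Measurable[modeSigma θ t] f) : IsPast θ t f := by
  intro ω ω' h
  obtain ⟨A, _, hA⟩ := modeSigma_le_comap _ (hf (measurableSet_singleton (f ω)))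
  have h1 : ω ∈ pastModes θ t ⁻¹' A := by rw [hA]; rfl
  rw [Set.mem_preimage, pastModes_eq_iff.2 h] at h1
  have h2 : ω' ∈ f ⁻¹' {f ω} := by rw [← hA]; exact h1
  exact h2.symm

theorem IsPast.stronglyMeasurable {V : Type*} [TopologicalSpace V] [Nonempty V] {f : Ω → V}
    (hf : IsPast θ t f) : StronglyMeasurable[modeSigma θ t] f := by
  obtain ⟨g, rfl⟩ := hf.exists_eq_comp
  exact StronglyMeasurable.of_discrete.comp_measurable measurable_pastModes

variable [MeasurableSpace Ω] {μ : Measure Ω}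

theorem modeSigma_le (hθ : ∀ k, Measurable (θ k)) : modeSigma θ t ≤ ‹MeasurableSpace Ω› := by
  refine iSup_le fun s => ?_
  rintro _ ⟨A, _, rfl⟩
  exact hθ s (MeasurableSet.of_discrete)

/-- There are finitely many histories up to a given time, so the function takes finitely many
values. -/
theorem IsPast.integrable [IsFiniteMeasure μ] (hθ : ∀ k, Measurable (θ k)) {V : Type*}
    [NormedAddCommGroup V] {f : Ω → V} (hf : IsPast θ t f) : Integrable f μ := by
  obtain ⟨g, rfl⟩ := hf.exists_eq_comp
  have : Measurable (pastModes θ t) := measurable_pastModes.mono (modeSigma_le hθ) le_rfl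
  exact (Integrable.of_finite (μ := μ.map (pastModes θ t)) (f := g)).comp_measurable this

/-- Integrated Markov property: on each atom given by a history and a next mode the integrand is
constant, and the chain's defining identity gives the measure of the atom. -/
theorem IsMarkovChain.integral_next [IsFiniteMeasure μ] {lam : Matrix (Fin L) (Fin L) ℝ}
    (hθ : IsMarkovChain μ θ lam) {φ : Fin L → Ω → ℝ} (hφ : ∀ j, IsPast θ t (φ j)) :
    ∫ ω, φ (θ (t + 1) ω) ω ∂μ = ∫ ω, ∑ j, lam (θ t ω) j * φ j ω ∂μ := by
  choose g hg using fun j => (hφ j).exists_eq_comp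
  have hpm : Measurable (pastModes θ t) :=
    measurable_pastModes.mono (modeSigma_le hθ.measurable) le_rfl
  let last : Fin (t + 1) := ⟨t, by omega⟩
  have hset : ∀ p j, MeasurableSet (pastModes θ t ⁻¹' {p} ∩ θ (t + 1) ⁻¹' {j}) := fun p j =>
    (hpm (measurableSet_singleton p)).inter (hθ.measurable _ (measurableSet_singleton j))
  have hl : ∀ ω, φ (θ (t + 1) ω) ω = ∑ j, ∑ p,
      (pastModes θ t ⁻¹' {p} ∩ θ (t + 1) ⁻¹' {j}).indicator (fun _ => g j p) ω := by
    intro ω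
    rw [Finset.sum_eq_single (θ (t + 1) ω), Finset.sum_eq_single (pastModes θ t ω)]
    · rw [Set.indicator_of_mem (s := pastModes θ t ⁻¹' {pastModes θ t ω} ∩
        θ (t + 1) ⁻¹' {θ (t + 1) ω}) ⟨rfl, rfl⟩, hg]
      rfl
    · intro p _ hp
      exact Set.indicator_of_notMem (fun h => hp h.1.symm) _
    · simp
    · intro j _ hj
      exact Finset.sum_eq_zero fun p _ => Set.indicator_of_notMem (fun h => hj h.2.symm) _
    · simp
  have hr : ∀ ω, ∑ j, lam (θ t ω) j * φ j ω = ∑ j, ∑ p,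
      (pastModes θ t ⁻¹' {p}).indicator (fun _ => lam (p last) j * g j p) ω := by
    intro ω
    refine Finset.sum_congr rfl fun j _ => ?_
    rw [Finset.sum_eq_single (pastModes θ t ω)]
    · rw [Set.indicator_of_mem (s := pastModes θ t ⁻¹' {pastModes θ t ω}) rfl, hg]
      rfl
    · intro p _ hp
      exact Set.indicator_of_notMem (fun h => hp h.symm) _
    · simp
  simp only [hl, hr]
  rw [integral_finsetSum _ fun j _ => integrable_finsetSum _ fun p _ =>
      (integrable_const _).indicator (hset p j),
    integral_finsetSum _ fun j _ => integrable_finsetSum _ fun p _ =>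
      (integrable_const _).indicator (hpm (measurableSet_singleton p))]
  refine Finset.sum_congr rfl fun j _ => ?_
  rw [integral_finsetSum _ fun p _ => (integrable_const _).indicator (hset p j),
    integral_finsetSum _ fun p _ =>
      (integrable_const _).indicator (hpm (measurableSet_singleton p))]
  refine Finset.sum_congr rfl fun p _ => ?_
  rw [integral_indicator_const _ (hset p j),
    integral_indicator_const _ (hpm (measurableSet_singleton p))]
  -- The path continues the history `p` by `j`. Its values after $t+1$ play no role.
  let l : ℕ → Fin L := fun s => if h : s < t + 1 then p ⟨s, h⟩ else j
  have h1 : pastModes θ t ⁻¹' {p} = {ω | ∀ s ≤ t, θ s ω = l s} := by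
    ext ω
    simp only [Set.mem_preimage, Set.mem_singleton_iff, Set.mem_ofPred_eq, funext_iff,
      Fin.forall_iff]
    refine ⟨fun h s hs => ?_, fun h s hs => ?_⟩
    · have hs' : s < t + 1 := by omega
      rw [show l s = p ⟨s, hs'⟩ from dif_pos hs']
      exact h s hs'
    · have := h s (by omega)
      rw [show l s = p ⟨s, hs⟩ from dif_pos hs] at this
      exact this
  have h2 : pastModes θ t ⁻¹' {p} ∩ θ (t + 1) ⁻¹' {j} = {ω | ∀ s ≤ t + 1, θ s ω = l s} := by
    have hj : l (t + 1) = j := dif_neg (by omega)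
    ext ω
    rw [h1]
    simp only [Set.mem_inter_iff, Set.mem_preimage, Set.mem_singleton_iff, Set.mem_ofPred_eq]
    refine ⟨fun h s hs => ?_, fun h => ⟨fun s hs => h s (by omega), by rw [h _ le_rfl, hj]⟩⟩
    rcases hs.lt_or_eq with hs | rfl
    · exact h.1 s (by omega)
    · rw [h.2, hj]
  rw [h2, hθ.markov, ← h1, show l t = p last from dif_pos (by omega),
    show l (t + 1) = j from dif_neg (by omega)]
  simp only [smul_eq_mul]
  ring

/-- The conditional expectation given the modes up to time `t` is determined by integrals against
functions of these modes. -/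
theorem ae_eq_condExp_of_integral_dotProduct_eq [IsFiniteMeasure μ] (hθ : ∀ k, Measurable (θ k))
    {a : Type*} [Fintype a] [DecidableEq a] {f g : Ω → a → ℝ} (hf : Integrable f μ)
    (hg : IsPast θ t g)
    (h : ∀ ξ : Ω → a → ℝ, IsPast θ t ξ → ∫ ω, ξ ω ⬝ᵥ g ω ∂μ = ∫ ω, ξ ω ⬝ᵥ f ω ∂μ) :
    g =ᵐ[μ] μ[f | modeSigma θ t] := by
  have hle := modeSigma_le (t := t) hθ
  refine ae_eq_condExp_of_forall_setIntegral_eq hle hf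
    (fun s _ _ => (hg.integrable hθ).integrableOn) ?_ hg.stronglyMeasurable.aestronglyMeasurable
  intro s hs _
  obtain ⟨A, _, hA⟩ := modeSigma_le_comap _ hs
  have hind : ∀ v : Ω → a → ℝ, Integrable v μ → ∀ i, (∫ ω in s, v ω ∂μ) i
      = ∫ ω, (s.indicator (fun _ => Pi.single i 1) ω : a → ℝ) ⬝ᵥ v ω ∂μ := by
    intro v hv i
    rw [eval_integral fun i => (hv.eval i).integrableOn, ← integral_indicator (hle _ hs)]
    refine integral_congr_ae (Filter.Eventually.of_forall fun ω => ?_)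
    by_cases hω : ω ∈ s <;> simp [hω]
  funext i
  rw [hind _ (hg.integrable hθ), hind _ hf]
  apply h
  intro ω ω' hω
  have : ω ∈ s ↔ ω' ∈ s := by
    rw [← hA, Set.mem_preimage, Set.mem_preimage, pastModes_eq_iff.2 hω]
  by_cases h1 : ω ∈ s
  · rw [Set.indicator_of_mem h1, Set.indicator_of_mem (this.1 h1)]
  · rw [Set.indicator_of_notMem h1, Set.indicator_of_notMem (mt this.2 h1)]

end Past

/-! ### The cost along an admissible trajectory. -/

namespace DelayedMJLS

variable {n m L : ℕ} (S : DelayedMJLS n m L) {Ω : Type*}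

/-- The Bellman recursion in expectation. Both arguments must be known at time $t$, so that
averaging over the next mode amounts to conditioning. -/
theorem integral_value_step [MeasurableSpace Ω] {μ : Measure Ω} [IsFiniteMeasure μ]
    {θ : ℕ → Ω → Fin L} (hθ : IsMarkovChain μ θ S.lam) {t : ℕ} (ht : t < S.N)
    {e f : Ω → Aug n m} (he : IsPast θ t e) (hf : IsPast θ t f) :
    ∫ ω, S.value t (θ t ω) (e ω) (f ω) ∂μ =
      ∫ ω, (S.stage (t + 1) (θ (t + 1) ω) (e ω) (f ω)
        + S.reduced (t + 1) (θ (t + 1) ω) (S.advance (t + 1) (θ (t + 1) ω) (e ω))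
            (S.advance (t + 1) (θ (t + 1) ω) (f ω))) ∂μ := by
  simp only [S.value_step ht]
  exact (hθ.integral_next (φ := fun j ω => S.stage (t + 1) j (e ω) (f ω)
    + S.reduced (t + 1) j (S.advance (t + 1) j (e ω)) (S.advance (t + 1) j (f ω)))
    fun j => he.comp₂ (fun e f => S.stage (t + 1) j e f
      + S.reduced (t + 1) j (S.advance (t + 1) j e) (S.advance (t + 1) j f)) hf).symm

/-- The state `x(t + 1)` together with the inputs up to the time `c`. -/
def traj (θ : ℕ → Ω → Fin L) (u : ℤ → Ω → Fin m → ℝ) (c : ℤ) (t : ℕ) (ω : Ω) : Aug n m :=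
  (S.state θ u (t + 1) ω,
    -- The mask removes inputs before $-d$ and after $N-d$: admissibility says nothing about them.
    fun τ => if -(S.d : ℤ) ≤ τ ∧ τ ≤ c ∧ τ + S.d ≤ S.N then u τ ω else 0)

variable {S} {θ : ℕ → Ω → Fin L} {u v : ℤ → Ω → Fin m → ℝ}

theorem traj_snd_of_le {c τ : ℤ} (h1 : -(S.d : ℤ) ≤ τ) (h2 : τ ≤ c) (h3 : τ + S.d ≤ S.N) (t : ℕ)
    (ω : Ω) : (S.traj θ u c t ω).2 τ = u τ ω := if_pos ⟨h1, h2, h3⟩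

theorem traj_snd_of_lt {c τ : ℤ} (h : c < τ) (t : ℕ) (ω : Ω) : (S.traj θ u c t ω).2 τ = 0 :=
  if_neg (by omega)

theorem advance_traj {c : ℤ} {t : ℕ} (ht : t < S.N) (hc : (t : ℤ) + 1 - S.d ≤ c) (ω : Ω) :
    S.advance (t + 1) (θ (t + 1) ω) (S.traj θ u c t ω) = S.traj θ u c (t + 1) ω := by
  rw [advance_apply, traj_snd_of_le (by omega) (by push_cast; omega) (by omega)]
  rfl

theorem state_congr {k : ℕ} {ω : Ω}
    (h : ∀ τ : ℤ, -(S.d : ℤ) ≤ τ → τ + S.d < k → u τ ω = v τ ω) :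
    S.state θ u k ω = S.state θ v k ω := by
  induction k with
  | zero => rfl
  | succ k ih =>
    rw [state, state, ih fun τ h1 h2 => h τ h1 (by push_cast; omega),
      h _ (by omega) (by push_cast; omega)]

theorem IsAdmissible.isPast (hu : S.IsAdmissible θ u) {τ : ℤ} (h1 : -(S.d : ℤ) ≤ τ)
    (h2 : τ + S.d ≤ S.N) {t : ℕ} (ht : τ ≤ t) : IsPast θ t (u τ) := by
  by_cases h : τ < 0
  · rw [show u τ = fun _ => S.u0 τ from funext (hu.initial τ h1 h)]
    exact isPast_const _
  · obtain ⟨r, rfl⟩ := Int.eq_ofNat_of_zero_le (not_lt.1 h)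
    exact (IsPast.of_measurable (hu.measurable r (by omega))).mono (by omega)

theorem IsAdmissible.isPast_state (hd : 0 < S.d) (hu : S.IsAdmissible θ u) (k : ℕ) :
    ∀ {t : ℕ}, k ≤ S.N + 1 → k ≤ t + 1 → IsPast θ t (S.state θ u k) := by
  induction k with
  | zero => intro t _ _; exact isPast_const _
  | succ k ih =>
    intro t hk hkt
    exact IsPast.comp₃ (fun i x w => S.A k i *ᵥ x + S.B k i *ᵥ w) (isPast_mode (by omega))
      (ih (by omega) (by omega)) (hu.isPast (by omega) (by omega) (by omega))

theorem IsAdmissible.isPast_traj (hd : 0 < S.d) (hu : S.IsAdmissible θ u) {c : ℤ} {t r : ℕ}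
    (ht : t ≤ S.N) (hc : c ≤ r) (hr : t ≤ r) : IsPast θ r (S.traj θ u c t) := by
  intro ω ω' hω
  refine Prod.ext (hu.isPast_state hd (t + 1) (by omega) (by omega) ω ω' hω) (funext fun τ => ?_)
  unfold traj
  dsimp only
  split_ifs with h
  · exact hu.isPast h.1 h.2.2 (by omega) ω ω' hω
  · rfl

/-- The current input has been minimized out, so any cut-off from $t-1$ on gives the same value. -/
theorem reduced_traj_congr {c c' : ℤ} {t : ℕ} (hc : (t : ℤ) ≤ c + 1) (hc' : (t : ℤ) ≤ c' + 1)
    (i : Fin L) (ω : Ω) (f : Aug n m) :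
    S.reduced t i (S.traj θ u c t ω) f = S.reduced t i (S.traj θ u c' t ω) f := by
  refine S.reduced_congr t i rfl rfl (fun τ h1 h2 => ?_) fun _ _ _ => rfl
  unfold traj
  dsimp only
  congr 1
  simp only [eq_iff_iff]
  constructor <;> rintro ⟨h3, h4, h5⟩ <;> exact ⟨h3, by omega, h5⟩

/-- The cost incurred after the time `τ`. -/
noncomputable def tailCost (S : DelayedMJLS n m L) (θ : ℕ → Ω → Fin L) (u : ℤ → Ω → Fin m → ℝ)
    (τ : ℕ) (ω : Ω) : ℝ :=
  ∑ k ∈ Finset.Ioc τ S.N, (S.state θ u k ω ⬝ᵥ S.Q k (θ k ω) *ᵥ S.state θ u k ω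
    + if S.d ≤ k then u ((k : ℤ) - S.d) ω ⬝ᵥ S.R k (θ k ω) *ᵥ u ((k : ℤ) - S.d) ω else 0)
  + S.state θ u (S.N + 1) ω ⬝ᵥ S.PT (θ (S.N + 1) ω) *ᵥ S.state θ u (S.N + 1) ω

theorem IsAdmissible.isPast_running (hd : 0 < S.d) (hu : S.IsAdmissible θ u) {k t : ℕ}
    (hk : k ≤ t) (hkN : k ≤ S.N) :
    IsPast θ t fun ω => S.state θ u k ω ⬝ᵥ S.Q k (θ k ω) *ᵥ S.state θ u k ω
    + if S.d ≤ k then u ((k : ℤ) - S.d) ω ⬝ᵥ S.R k (θ k ω) *ᵥ u ((k : ℤ) - S.d) ω else 0 :=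
  IsPast.comp₃ (fun i x w => x ⬝ᵥ S.Q k i *ᵥ x + if S.d ≤ k then w ⬝ᵥ S.R k i *ᵥ w else 0)
    (isPast_mode hk) (hu.isPast_state hd k (by omega) (by omega))
    (hu.isPast (by omega) (by omega) (by omega))

theorem IsAdmissible.isPast_tailCost (hd : 0 < S.d) (hu : S.IsAdmissible θ u) (τ : ℕ) :
    IsPast θ (S.N + 1) (S.tailCost θ u τ) := by
  refine IsPast.comp₂ (· + ·) (IsPast.sum fun k hk => ?_)
    (IsPast.comp₂ (fun i x => x ⬝ᵥ S.PT i *ᵥ x) (isPast_mode le_rfl)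
      (hu.isPast_state hd _ le_rfl (by omega)))
  rw [Finset.mem_Ioc] at hk
  exact hu.isPast_running hd (by omega) hk.2

variable [MeasurableSpace Ω] {μ : Measure Ω} [IsProbabilityMeasure μ]

/-- The expected cost of the deviation of the input at time `t` from the feedback law. -/
noncomputable def gapCost (S : DelayedMJLS n m L) (μ : Measure Ω) (θ : ℕ → Ω → Fin L)
    (u : ℤ → Ω → Fin m → ℝ) (t : ℕ) : ℝ :=
  ∫ ω, S.gap t (θ t ω) (S.traj θ u t t ω) (S.traj θ u t t ω) ∂μ

/-- The standing assumptions on the weights: symmetry. -/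
structure IsSymmetric (S : DelayedMJLS n m L) : Prop where
  d_pos : 0 < S.d
  Q : ∀ k, k ≤ S.N → ∀ i, (S.Q k i).IsSymm
  R : ∀ k, S.d ≤ k → k ≤ S.N → ∀ i, (S.R k i).IsSymm
  PT : ∀ i, (S.PT i).IsSymm

theorem integral_terminal (hS : S.IsSymmetric) (hθ : IsMarkovChain μ θ S.lam)
    (hu : S.IsAdmissible θ u) :
    ∫ ω, S.state θ u (S.N + 1) ω ⬝ᵥ S.PT (θ (S.N + 1) ω) *ᵥ S.state θ u (S.N + 1) ω ∂μ
      = ∫ ω, S.value S.N (θ S.N ω) (S.traj θ u S.N S.N ω) (S.traj θ u S.N S.N ω) ∂μ := by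
  rw [hθ.integral_next (φ := fun j ω =>
    S.state θ u (S.N + 1) ω ⬝ᵥ S.PT j *ᵥ S.state θ u (S.N + 1) ω) fun j =>
      (hu.isPast_state hS.d_pos _ le_rfl le_rfl).comp fun x => x ⬝ᵥ S.PT j *ᵥ x]
  congr 1
  funext ω
  rw [value_final, riccati_final, riccatiFinal]
  simp only [S.Lam_succ S.N S.PT, Matrix.sum_mulVec, dotProduct_sum, Matrix.smul_mulVec,
    dotProduct_smul, smul_eq_mul]
  rfl

/-- Backward in time: each step turns the later `value` into `reduced` plus `gap`, and the recursion
absorbs `reduced` and the running cost. -/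
theorem integral_tailCost (hS : S.IsSymmetric) (hθ : IsMarkovChain μ θ S.lam)
    (hu : S.IsAdmissible θ u) : ∀ c τ : ℕ, τ + c = S.N → ∫ ω, S.tailCost θ u τ ω ∂μ
      = ∫ ω, S.value τ (θ τ ω) (S.traj θ u τ τ ω) (S.traj θ u τ τ ω) ∂μ
        + ∑ t ∈ Finset.Ioc τ S.N, S.gapCost μ θ u t := by
  have hd := hS.d_pos
  intro c
  induction c with
  | zero =>
    intro τ hτ
    obtain rfl : τ = S.N := hτ
    simp only [tailCost, Finset.Ioc_self, Finset.sum_empty, zero_add, add_zero]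
    exact integral_terminal hS hθ hu
  | succ c ih =>
    intro τ hτ
    have hIoc : Finset.Ioc τ S.N = insert (τ + 1) (Finset.Ioc (τ + 1) S.N) := by
      ext s
      simp only [Finset.mem_insert, Finset.mem_Ioc]
      omega
    have hsplit : ∀ ω, S.tailCost θ u τ ω
        = (S.state θ u (τ + 1) ω ⬝ᵥ S.Q (τ + 1) (θ (τ + 1) ω) *ᵥ S.state θ u (τ + 1) ω
          + if S.d ≤ τ + 1 then u (((τ + 1 : ℕ) : ℤ) - S.d) ω ⬝ᵥ S.R (τ + 1) (θ (τ + 1) ω) *ᵥ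
              u (((τ + 1 : ℕ) : ℤ) - S.d) ω else 0) + S.tailCost θ u (τ + 1) ω := by
      intro ω
      rw [tailCost, tailCost, hIoc, Finset.sum_insert (by simp), add_assoc]
    have hstage : ∀ ω, (S.state θ u (τ + 1) ω ⬝ᵥ S.Q (τ + 1) (θ (τ + 1) ω) *ᵥ
          S.state θ u (τ + 1) ω
          + if S.d ≤ τ + 1 then u (((τ + 1 : ℕ) : ℤ) - S.d) ω ⬝ᵥ S.R (τ + 1) (θ (τ + 1) ω) *ᵥ
              u (((τ + 1 : ℕ) : ℤ) - S.d) ω else 0)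
        = S.stage (τ + 1) (θ (τ + 1) ω) (S.traj θ u τ τ ω) (S.traj θ u τ τ ω) := by
      intro ω
      rw [stage_apply, traj_snd_of_le (by omega) (by push_cast; omega) (by omega)]
      rfl
    have hred : ∀ ω, S.value (τ + 1) (θ (τ + 1) ω) (S.traj θ u ((τ + 1 : ℕ) : ℤ) (τ + 1) ω)
          (S.traj θ u ((τ + 1 : ℕ) : ℤ) (τ + 1) ω)
        = S.reduced (τ + 1) (θ (τ + 1) ω)
            (S.advance (τ + 1) (θ (τ + 1) ω) (S.traj θ u τ τ ω))
            (S.advance (τ + 1) (θ (τ + 1) ω) (S.traj θ u τ τ ω))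
          + S.gap (τ + 1) (θ (τ + 1) ω) (S.traj θ u ((τ + 1 : ℕ) : ℤ) (τ + 1) ω)
            (S.traj θ u ((τ + 1 : ℕ) : ℤ) (τ + 1) ω) := by
      intro ω
      rw [S.value_eq_reduced_add_gap hd hS.Q hS.R hS.PT (by omega),
        advance_traj (by omega) (by omega)]
      congr 1
      rw [reduced_traj_congr (c := ((τ + 1 : ℕ) : ℤ)) (c' := τ) (by omega) (by omega),
        S.reduced_symm hd hS.Q hS.R hS.PT (by omega),
        reduced_traj_congr (c := ((τ + 1 : ℕ) : ℤ)) (c' := τ) (by omega) (by omega)]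
    have he : IsPast θ τ (S.traj θ u τ τ) := hu.isPast_traj hd (by omega) le_rfl le_rfl
    have he' : IsPast θ (τ + 1) (S.traj θ u τ τ) := he.mono (by omega)
    have he'' : IsPast θ (τ + 1) (S.traj θ u ((τ + 1 : ℕ) : ℤ) (τ + 1)) :=
      hu.isPast_traj hd (by omega) le_rfl le_rfl
    have hm : IsPast θ (τ + 1) (θ (τ + 1)) := isPast_mode le_rfl
    simp only [hsplit]
    rw [integral_add ((hu.isPast_running hd le_rfl (by omega)).integrable hθ.measurable)
      ((hu.isPast_tailCost hd _).integrable hθ.measurable), ih (τ + 1) (by omega), hIoc,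
      Finset.sum_insert (by simp), S.integral_value_step hθ (by omega) he he]
    simp only [hred, hstage]
    rw [integral_add, integral_add]
    · rw [gapCost]
      ring
    · exact (IsPast.comp₂ (fun i e => S.stage (τ + 1) i e e) hm he').integrable hθ.measurable
    · exact (IsPast.comp₂ (fun i e => S.reduced (τ + 1) i (S.advance (τ + 1) i e)
        (S.advance (τ + 1) i e)) hm he').integrable hθ.measurable
    · exact (IsPast.comp₂ (fun i e => S.reduced (τ + 1) i (S.advance (τ + 1) i e)
        (S.advance (τ + 1) i e)) hm he').integrable hθ.measurable
    · exact (IsPast.comp₂ (fun i e => S.gap (τ + 1) i e e) hm he'').integrable hθ.measurable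

/-- Completion of squares: the cost is the minimized cost-to-go after an initial time `τ < d`, plus
the costs of the deviations from the feedback law. -/
theorem cost_eq (hS : S.IsSymmetric) (hθ : IsMarkovChain μ θ S.lam)
    (hu : S.IsAdmissible θ u) {τ : ℕ} (hτ : τ < S.d) (hτN : τ ≤ S.N) : S.cost μ θ u
      = ∫ ω, (∑ k ∈ Finset.range (τ + 1), S.state θ u k ω ⬝ᵥ S.Q k (θ k ω) *ᵥ S.state θ u k ω) ∂μ
        + ∫ ω, S.reduced τ (θ τ ω) (S.traj θ u τ τ ω) (S.traj θ u τ τ ω) ∂μ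
        + ∑ t ∈ Finset.Icc τ S.N, S.gapCost μ θ u t := by
  have hd := hS.d_pos
  have hIcc : Finset.Icc τ S.N = insert τ (Finset.Ioc τ S.N) := by
    ext s
    simp only [Finset.mem_insert, Finset.mem_Ioc, Finset.mem_Icc]
    omega
  have he : IsPast θ τ (S.traj θ u τ τ) := hu.isPast_traj hd (by omega) le_rfl le_rfl
  have hm : IsPast θ τ (θ τ) := isPast_mode le_rfl
  have hsum : ∀ ω, (∑ k ∈ Finset.range (S.N + 1),
          S.state θ u k ω ⬝ᵥ S.Q k (θ k ω) *ᵥ S.state θ u k ω)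
      + (∑ k ∈ Finset.Icc S.d S.N,
          u ((k : ℤ) - S.d) ω ⬝ᵥ S.R k (θ k ω) *ᵥ u ((k : ℤ) - S.d) ω)
      + S.state θ u (S.N + 1) ω ⬝ᵥ S.PT (θ (S.N + 1) ω) *ᵥ S.state θ u (S.N + 1) ω
      = (∑ k ∈ Finset.range (τ + 1), S.state θ u k ω ⬝ᵥ S.Q k (θ k ω) *ᵥ S.state θ u k ω)
        + S.tailCost θ u τ ω := by
    intro ω
    have h1 : Finset.range (S.N + 1) = Finset.range (τ + 1) ∪ Finset.Ioc τ S.N := by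
      ext s
      simp only [Finset.mem_union, Finset.mem_Ioc, Finset.mem_range]
      omega
    -- Inputs are charged from time $d>\tau$ on, so all of their cost lies in the tail.
    have h2 : Finset.Icc S.d S.N = (Finset.Ioc τ S.N).filter (S.d ≤ ·) := by
      ext s
      simp only [Finset.mem_filter, Finset.mem_Ioc, Finset.mem_Icc]
      omega
    rw [tailCost, Finset.sum_add_distrib, h1, h2, Finset.sum_filter, Finset.sum_union]
    · ring
    · rw [Finset.disjoint_left]
      intro s hs
      simp only [Finset.mem_Ioc, Finset.mem_range] at hs ⊢
      omega
  rw [cost]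
  simp only [hsum]
  rw [integral_add, integral_tailCost hS hθ hu (S.N - τ) τ (by omega), hIcc,
    Finset.sum_insert (by simp)]
  · simp only [S.value_eq_reduced_add_gap hd hS.Q hS.R hS.PT hτN]
    rw [integral_add, gapCost]
    · ring
    · exact (IsPast.comp₂ (fun i e => S.reduced τ i e e) hm he).integrable hθ.measurable
    · exact (IsPast.comp₂ (fun i e => S.gap τ i e e) hm he).integrable hθ.measurable
  · refine (IsPast.sum (t := S.N) fun k hk => ?_).integrable hθ.measurable
    rw [Finset.mem_range] at hk
    exact IsPast.comp₂ (fun i x => x ⬝ᵥ S.Q k i *ᵥ x) (isPast_mode (by omega))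
      (hu.isPast_state hd k (by omega) (by omega))
  · exact (hu.isPast_tailCost hd _).integrable hθ.measurable

end DelayedMJLS

/-! ### Unique solvability and positive definiteness of $W$. -/

namespace DelayedMJLS

variable {n m L : ℕ} {S : DelayedMJLS n m L} {Ω : Type*}
  {θ : ℕ → Ω → Fin L} {u v : ℤ → Ω → Fin m → ℝ}

theorem gap_self_eq {t : ℕ} {i : Fin L} (hW : (S.W t i).PosDef) (e : Aug n m) :
    S.gap t i e e = (e.2 t + (S.W t i)⁻¹ *ᵥ S.feed t i e) ⬝ᵥ
      S.W t i *ᵥ (e.2 t + (S.W t i)⁻¹ *ᵥ S.feed t i e) := by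
  have h1 : S.W t i *ᵥ (S.W t i)⁻¹ *ᵥ S.feed t i e = S.feed t i e := by
    rw [Matrix.mulVec_mulVec, Matrix.mul_nonsing_inv _ ((Matrix.isUnit_iff_isUnit_det _).1
      hW.isUnit), Matrix.one_mulVec]
  have hs : (S.W t i).IsSymm := hW.isHermitian
  have h2 := hs.dotProduct_mulVec_comm ((S.W t i)⁻¹ *ᵥ S.feed t i e) (e.2 t)
  rw [Matrix.mulVec_add, h1, add_dotProduct, dotProduct_add, dotProduct_add, h2, h1, gap,
    dotProduct_comm ((S.W t i)⁻¹ *ᵥ S.feed t i e)]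
  ring

theorem feed_traj_congr {t : ℕ} {ω : Ω} (i : Fin L)
    (h : ∀ τ : ℤ, -(S.d : ℤ) ≤ τ → τ < t → u τ ω = v τ ω) (hd : 0 < S.d) :
    S.feed t i (S.traj θ u t t ω) = S.feed t i (S.traj θ v t t ω) := by
  refine S.feed_congr t i (state_congr fun τ h1 h2 => h τ h1 (by push_cast at h2; omega)) ?_
  intro τ h1 h2
  unfold traj
  dsimp only
  split_ifs with h3
  · exact h τ h3.1 h2
  · rfl

theorem feed_traj {t : ℕ} (ht : t + S.d ≤ S.N) (i : Fin L) (ω : Ω) :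
    S.feed t i (S.traj θ u t t ω) = S.T0 t i *ᵥ S.state θ u (t + 1) ω
      + ∑ j ∈ Finset.Icc 1 (S.d - 1), S.T j t i *ᵥ u ((t : ℤ) - S.d + j) ω := by
  rw [feed_apply]
  congr 1
  refine Finset.sum_congr rfl fun j hj => ?_
  rw [Finset.mem_Icc] at hj
  rw [traj_snd_of_le (by omega) (by omega) (by omega)]

/-- The input at time `t` at `ω` is the one of the feedback law. -/
def FollowsLaw (S : DelayedMJLS n m L) (θ : ℕ → Ω → Fin L) (u : ℤ → Ω → Fin m → ℝ) (t : ℕ)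
    (ω : Ω) : Prop :=
  u t ω = -((S.W t (θ t ω))⁻¹ *ᵥ S.feed t (θ t ω) (S.traj θ u t t ω))

theorem IsAdmissible.isPast_feed (hd : 0 < S.d) (hu : S.IsAdmissible θ u) {t : ℕ} (ht : t ≤ S.N) :
    IsPast θ t fun ω => S.feed t (θ t ω) (S.traj θ u t t ω) :=
  IsPast.comp₂ (fun i e => S.feed t i e) (isPast_mode le_rfl)
    (hu.isPast_traj hd ht le_rfl le_rfl)

theorem IsAdmissible.update (hu : S.IsAdmissible θ u) (t : ℕ) {w : Ω → Fin m → ℝ}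
    (hw : IsPast θ t w) : S.IsAdmissible θ (Function.update u t w) where
  initial i h1 h2 ω := by
    rw [Function.update_of_ne (by omega)]
    exact hu.initial i h1 h2 ω
  measurable s hs := by
    by_cases h : s = t
    · subst h
      rw [Function.update_self]
      exact hw.stronglyMeasurable.measurable
    · rw [Function.update_of_ne (by omega)]
      exact hu.measurable s hs

theorem exists_isAdmissible (S : DelayedMJLS n m L) (θ : ℕ → Ω → Fin L) :
    ∃ u, S.IsAdmissible θ u :=
  ⟨fun τ _ => S.u0 τ, fun _ _ _ _ => rfl, fun _ _ => measurable_const⟩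

/-- From any time on, an admissible control may be replaced by the feedback law. -/
theorem IsAdmissible.exists_followsLaw (hd : 0 < S.d) (hu : S.IsAdmissible θ u) (t₀ : ℕ) :
    ∃ v, S.IsAdmissible θ v ∧ (∀ τ : ℤ, τ < t₀ → v τ = u τ) ∧
      ∀ t, t₀ ≤ t → t + S.d ≤ S.N → ∀ ω, S.FollowsLaw θ v t ω := by
  -- The law at time $t$ involves only inputs before $t$, so the controls can be replaced one by
  -- one, forward in time.
  suffices H : ∀ c : ℕ, ∃ v, S.IsAdmissible θ v ∧ (∀ τ : ℤ, τ < t₀ → v τ = u τ) ∧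
      ∀ t, t₀ ≤ t → t < t₀ + c → t + S.d ≤ S.N → ∀ ω, S.FollowsLaw θ v t ω by
    obtain ⟨v, h1, h2, h3⟩ := H (S.N + 1)
    exact ⟨v, h1, h2, fun t ht htN => h3 t ht (by omega) htN⟩
  intro c
  induction c with
  | zero => exact ⟨u, hu, fun _ _ => rfl, fun t h1 h2 => by omega⟩
  | succ c ih =>
    obtain ⟨v, hv, h1, h2⟩ := ih
    by_cases hc : t₀ + c + S.d ≤ S.N
    · refine ⟨Function.update v ((t₀ + c : ℕ) : ℤ) fun ω => -((S.W (t₀ + c) (θ (t₀ + c) ω))⁻¹ *ᵥ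
        S.feed (t₀ + c) (θ (t₀ + c) ω) (S.traj θ v ((t₀ + c : ℕ) : ℤ) (t₀ + c) ω)), ?_, ?_, ?_⟩
      · exact hv.update _ (IsPast.comp₂ (fun i w => -((S.W (t₀ + c) i)⁻¹ *ᵥ w))
          (isPast_mode le_rfl) (hv.isPast_feed hd (by omega)))
      · intro τ hτ
        rw [Function.update_of_ne (by push_cast; omega), h1 τ hτ]
      · intro t ht htc htN ω
        have hcongr : S.feed t (θ t ω) (S.traj θ (Function.update v ((t₀ + c : ℕ) : ℤ)
            fun ω => -((S.W (t₀ + c) (θ (t₀ + c) ω))⁻¹ *ᵥ S.feed (t₀ + c) (θ (t₀ + c) ω)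
              (S.traj θ v ((t₀ + c : ℕ) : ℤ) (t₀ + c) ω))) t t ω)
            = S.feed t (θ t ω) (S.traj θ v t t ω) :=
          feed_traj_congr _ (fun τ _ h => by rw [Function.update_of_ne (by omega)]) hd
        rw [FollowsLaw, hcongr]
        by_cases h : t = t₀ + c
        · subst h
          rw [Function.update_self]
        · rw [Function.update_of_ne (by omega)]
          exact h2 t ht (by omega) htN ω
    · exact ⟨v, hv, h1, fun t ht htc htN => h2 t ht (by omega) htN⟩

theorem gap_traj_eq {t : ℕ} (ht : t + S.d ≤ S.N) {ω : Ω} (hW : (S.W t (θ t ω)).PosDef) :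
    S.gap t (θ t ω) (S.traj θ u t t ω) (S.traj θ u t t ω)
      = (u t ω + (S.W t (θ t ω))⁻¹ *ᵥ S.feed t (θ t ω) (S.traj θ u t t ω)) ⬝ᵥ
        S.W t (θ t ω) *ᵥ
          (u t ω + (S.W t (θ t ω))⁻¹ *ᵥ S.feed t (θ t ω) (S.traj θ u t t ω)) := by
  rw [gap_self_eq hW, traj_snd_of_le (by omega) le_rfl (by omega)]

theorem gap_traj_nonneg {t : ℕ} (ht : t + S.d ≤ S.N) {ω : Ω} (hW : (S.W t (θ t ω)).PosDef) :
    0 ≤ S.gap t (θ t ω) (S.traj θ u t t ω) (S.traj θ u t t ω) := by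
  rw [gap_traj_eq ht hW]
  exact hW.posSemidef.dotProduct_mulVec_nonneg _

theorem gap_traj_eq_zero_iff {t : ℕ} (ht : t + S.d ≤ S.N) {ω : Ω}
    (hW : (S.W t (θ t ω)).PosDef) :
    S.gap t (θ t ω) (S.traj θ u t t ω) (S.traj θ u t t ω) = 0 ↔ S.FollowsLaw θ u t ω := by
  rw [gap_traj_eq ht hW, FollowsLaw, ← add_eq_zero_iff_eq_neg]
  refine ⟨fun h => ?_, fun h => by rw [h, zero_dotProduct]⟩
  by_contra hne
  exact (hW.dotProduct_mulVec_pos hne).ne' h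

variable [MeasurableSpace Ω] {μ : Measure Ω}

theorem gapCost_late (hd : 0 < S.d) {t : ℕ} (ht : S.N < t + S.d) (htN : t ≤ S.N) :
    S.gapCost μ θ u t = 0 := by
  have : ∀ (i : Fin L) (e : Aug n m), S.gap t i e e = 0 := by
    intro i e
    rw [gap, S.feed_late hd ht htN, S.W_late hd ht htN]
    simp
  simp only [gapCost, this, integral_zero]

theorem gapCost_nonneg {t : ℕ} (ht : t + S.d ≤ S.N) (hW : ∀ i, (S.W t i).PosDef) :
    0 ≤ S.gapCost μ θ u t :=
  integral_nonneg fun _ => gap_traj_nonneg ht (hW _)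

theorem gapCost_eq_zero {t : ℕ} (ht : t + S.d ≤ S.N) (hW : ∀ i, (S.W t i).PosDef)
    (h : ∀ ω, S.FollowsLaw θ u t ω) : S.gapCost μ θ u t = 0 := by
  rw [gapCost]
  simp only [fun ω => (gap_traj_eq_zero_iff ht (hW (θ t ω))).2 (h ω), integral_zero]

theorem gapCost_congr (hd : 0 < S.d) {t : ℕ}
    (h : ∀ τ : ℤ, -(S.d : ℤ) ≤ τ → τ ≤ t → u τ = v τ) :
    S.gapCost μ θ u t = S.gapCost μ θ v t := by
  have : S.traj θ u t t = S.traj θ v t t := by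
    funext ω
    refine Prod.ext (state_congr fun τ h1 h2 => by rw [h τ h1 (by push_cast at h2; omega)])
      (funext fun τ => ?_)
    unfold traj
    dsimp only
    split_ifs with h3
    · rw [h τ h3.1 h3.2.1]
    · rfl
  rw [gapCost, gapCost, this]

variable [IsProbabilityMeasure μ]

theorem IsAdmissible.integrable_gap (hd : 0 < S.d) (hθ : IsMarkovChain μ θ S.lam)
    (hu : S.IsAdmissible θ u) {t : ℕ} (ht : t ≤ S.N) :
    Integrable (fun ω => S.gap t (θ t ω) (S.traj θ u t t ω) (S.traj θ u t t ω)) μ :=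
  (IsPast.comp₂ (t := t) (fun i e => S.gap t i e e) (isPast_mode le_rfl)
    (hu.isPast_traj hd ht le_rfl le_rfl)).integrable hθ.measurable

theorem ae_followsLaw_of_gapCost_eq_zero (hd : 0 < S.d) (hθ : IsMarkovChain μ θ S.lam)
    (hu : S.IsAdmissible θ u) {t : ℕ} (ht : t + S.d ≤ S.N) (hW : ∀ i, (S.W t i).PosDef)
    (h : S.gapCost μ θ u t = 0) : ∀ᵐ ω ∂μ, S.FollowsLaw θ u t ω := by
  rw [gapCost, integral_eq_zero_iff_of_nonneg (fun ω => gap_traj_nonneg ht (hW _))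
    (hu.integrable_gap hd hθ (by omega))] at h
  filter_upwards [h] with ω hω
  exact (gap_traj_eq_zero_iff ht (hW _)).1 hω

/-- In `cost_eq` at $\tau=0$ the other terms involve only $x_0$, $\theta(0)$ and the given past
inputs. -/
theorem cost_sub_sum_gapCost (hS : S.IsSymmetric) (hθ : IsMarkovChain μ θ S.lam)
    (hu : S.IsAdmissible θ u) (hv : S.IsAdmissible θ v) :
    S.cost μ θ u - ∑ t ∈ Finset.Icc 0 S.N, S.gapCost μ θ u t
      = S.cost μ θ v - ∑ t ∈ Finset.Icc 0 S.N, S.gapCost μ θ v t := by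
  have hd := hS.d_pos
  rw [cost_eq hS hθ hu hd (Nat.zero_le _), cost_eq hS hθ hv hd (Nat.zero_le _),
    add_sub_cancel_right, add_sub_cancel_right]
  simp only [zero_add, Finset.sum_range_one]
  congr 1
  congr 1
  funext ω
  have h : ∀ τ : ℤ, -(S.d : ℤ) ≤ τ → τ < 0 → u τ ω = v τ ω := fun τ h1 h2 => by
    rw [hu.initial τ h1 h2, hv.initial τ h1 h2]
  have h1 : (S.traj θ u (0 : ℕ) 0 ω).1 = (S.traj θ v (0 : ℕ) 0 ω).1 :=
    state_congr fun τ h1 h2 => h τ h1 (by push_cast at h2; omega)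
  have h2 : ∀ τ : ℤ, ((0 : ℕ) : ℤ) - S.d < τ → τ < ((0 : ℕ) : ℤ) →
      (S.traj θ u (0 : ℕ) 0 ω).2 τ = (S.traj θ v (0 : ℕ) 0 ω).2 τ := by
    intro τ _ h4
    unfold traj
    dsimp only
    split_ifs with h3
    · exact h τ h3.1 (by simpa using h4)
    · rfl
  exact S.reduced_congr 0 _ h1 h1 h2 h2

/-- The feedback law from time 0 has zero gaps. An optimal control costs no more, and its gaps are
nonnegative. -/
theorem IsOptimal.gapCost_eq_zero (hS : S.IsSymmetric)
    (hθ : IsMarkovChain μ θ S.lam) (hu : S.IsOptimal μ θ u)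
    (hW : ∀ t, t + S.d ≤ S.N → ∀ i, (S.W t i).PosDef) {t : ℕ} (ht : t ≤ S.N) :
    S.gapCost μ θ u t = 0 := by
  have hd := hS.d_pos
  have hnn : ∀ t ∈ Finset.Icc 0 S.N, 0 ≤ S.gapCost μ θ u t := by
    intro t ht
    rw [Finset.mem_Icc] at ht
    by_cases h : t + S.d ≤ S.N
    · exact gapCost_nonneg h (hW t h)
    · rw [gapCost_late hd (by omega) ht.2]
  obtain ⟨v, hv, -, hlaw⟩ := hu.1.exists_followsLaw hd 0
  have hz : ∑ t ∈ Finset.Icc 0 S.N, S.gapCost μ θ v t = 0 := by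
    refine Finset.sum_eq_zero fun t ht => ?_
    rw [Finset.mem_Icc] at ht
    by_cases h : t + S.d ≤ S.N
    · exact DelayedMJLS.gapCost_eq_zero h (hW t h) (hlaw t (Nat.zero_le _) h)
    · exact gapCost_late hd (by omega) ht.2
  have h1 := cost_sub_sum_gapCost hS hθ hu.1 hv
  have h2 := hu.2 v hv
  have h3 : ∑ t ∈ Finset.Icc 0 S.N, S.gapCost μ θ u t = 0 :=
    le_antisymm (by rw [hz] at h1; linarith) (Finset.sum_nonneg hnn)
  exact (Finset.sum_eq_zero_iff_of_nonneg hnn).1 h3 t (Finset.mem_Icc.2 ⟨Nat.zero_le _, ht⟩)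

theorem IsOptimal.ae_followsLaw (hS : S.IsSymmetric)
    (hθ : IsMarkovChain μ θ S.lam) (hu : S.IsOptimal μ θ u)
    (hW : ∀ t, t + S.d ≤ S.N → ∀ i, (S.W t i).PosDef) {t : ℕ} (ht : t + S.d ≤ S.N) :
    ∀ᵐ ω ∂μ, S.FollowsLaw θ u t ω :=
  ae_followsLaw_of_gapCost_eq_zero hS.d_pos hθ hu.1 ht (hW t ht)
    (hu.gapCost_eq_zero hS hθ hW (by omega))

theorem hasUniqueOptimal_of_posDef (hS : S.IsSymmetric) (hθ : IsMarkovChain μ θ S.lam)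
    (hW : ∀ t, t + S.d ≤ S.N → ∀ i, (S.W t i).PosDef) : S.HasUniqueOptimal μ θ := by
  have hd := hS.d_pos
  obtain ⟨u₀, hu₀⟩ := S.exists_isAdmissible θ
  obtain ⟨u, hu, -, hlaw⟩ := hu₀.exists_followsLaw hd 0
  have hopt : S.IsOptimal μ θ u := by
    refine ⟨hu, fun v hv => ?_⟩
    have h1 := cost_sub_sum_gapCost hS hθ hu hv
    have h2 : ∑ t ∈ Finset.Icc 0 S.N, S.gapCost μ θ u t
        ≤ ∑ t ∈ Finset.Icc 0 S.N, S.gapCost μ θ v t := by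
      refine Finset.sum_le_sum fun t ht => ?_
      rw [Finset.mem_Icc] at ht
      by_cases h : t + S.d ≤ S.N
      · rw [gapCost_eq_zero h (hW t h) (hlaw t (Nat.zero_le _) h)]
        exact gapCost_nonneg h (hW t h)
      · rw [gapCost_late hd (by omega) ht.2, gapCost_late hd (by omega) ht.2]
    linarith
  refine ⟨u, hopt, fun v hv t => ?_⟩
  -- Both controls obey the law almost surely, so agreement at earlier times passes on to time $t$.
  induction t using Nat.strong_induction_on with
  | _ t ih =>
    intro ht
    have hprev : ∀ s : ℕ, ∀ᵐ ω ∂μ, s < t → v s ω = u s ω := by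
      intro s
      by_cases hs : s < t
      · filter_upwards [ih s hs (by omega)] with ω hω _
        exact hω
      · exact Filter.Eventually.of_forall fun ω h => absurd h hs
    filter_upwards [hv.ae_followsLaw hS hθ hW ht, ae_all_iff.2 hprev] with ω h1 h2
    rw [show v t ω = _ from h1, show u t ω = _ from hlaw t (Nat.zero_le _) ht ω]
    rw [feed_traj_congr (v := u) _ (fun τ h3 h4 => ?_) hd]
    by_cases h5 : τ < 0
    · rw [hv.1.initial τ h3 h5, hu.initial τ h3 h5]
    · obtain ⟨s, rfl⟩ := Int.eq_ofNat_of_zero_le (not_lt.1 h5)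
      exact h2 s (by omega)

/-- Adding $w$ to $u(t)$ on $\{\theta(t)=i\}$ changes the gap there by $w'Ww+2w'(Wu+\mathrm{feed})$.
The two hypotheses control the quadratic term and the mean of the linear term. -/
theorem gapCost_update_le (hS : S.IsSymmetric) (hθ : IsMarkovChain μ θ S.lam)
    (hu : S.IsAdmissible θ u) {t : ℕ} (ht : t + S.d ≤ S.N) {i : Fin L} {w : Fin m → ℝ}
    (hw : w ⬝ᵥ S.W t i *ᵥ w ≤ 0)
    (hg : ∫ ω, (if θ t ω = i then w ⬝ᵥ (S.W t i *ᵥ u t ω + S.feed t i (S.traj θ u t t ω)) else 0) ∂μ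
      ≤ 0) :
    S.gapCost μ θ (Function.update u t fun ω => u t ω + if θ t ω = i then w else 0) t
      ≤ S.gapCost μ θ u t := by
  have hd := hS.d_pos
  set u' : ℤ → Ω → Fin m → ℝ :=
    Function.update u t fun ω => u t ω + if θ t ω = i then w else 0 with hu'
  have hm : IsPast θ t (θ t) := isPast_mode le_rfl
  have hadm : S.IsAdmissible θ u' :=
    hu.update t ((hu.isPast (by omega) (by omega) le_rfl).comp₂
      (fun x j => x + if j = i then w else 0) hm)
  have hint : Integrable (fun ω => if θ t ω = i then
      w ⬝ᵥ (S.W t i *ᵥ u t ω + S.feed t i (S.traj θ u t t ω)) else 0) μ :=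
    (IsPast.comp₃ (t := t) (fun j x e => if j = i then
      w ⬝ᵥ (S.W t i *ᵥ x + S.feed t i e) else 0) hm (hu.isPast (by omega) (by omega) le_rfl)
      (hu.isPast_traj hd (by omega) le_rfl le_rfl)).integrable hθ.measurable
  have hpt : ∀ ω, S.gap t (θ t ω) (S.traj θ u' t t ω) (S.traj θ u' t t ω)
      ≤ S.gap t (θ t ω) (S.traj θ u t t ω) (S.traj θ u t t ω) + 2 * (if θ t ω = i then
        w ⬝ᵥ (S.W t i *ᵥ u t ω + S.feed t i (S.traj θ u t t ω)) else 0) := by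
    intro ω
    have hfeed : S.feed t (θ t ω) (S.traj θ u' t t ω) = S.feed t (θ t ω) (S.traj θ u t t ω) :=
      feed_traj_congr _ (fun τ _ h => by rw [hu', Function.update_of_ne (by omega)]) hd
    rw [gap, gap, hfeed, traj_snd_of_le (by omega) le_rfl (by omega),
      traj_snd_of_le (by omega) le_rfl (by omega), hu', Function.update_self]
    split_ifs with h
    · rw [h]
      have hs := (S.W_isSymm hd hS.Q hS.R hS.PT (by omega : t ≤ S.N) i).dotProduct_mulVec_comm
        (u t ω) w
      simp only [Matrix.mulVec_add, add_dotProduct, dotProduct_add, hs]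
      linarith
    · simp
  calc S.gapCost μ θ u' t ≤ ∫ ω, (S.gap t (θ t ω) (S.traj θ u t t ω) (S.traj θ u t t ω)
        + 2 * (if θ t ω = i then
        w ⬝ᵥ (S.W t i *ᵥ u t ω + S.feed t i (S.traj θ u t t ω)) else 0)) ∂μ :=
        integral_mono (hadm.integrable_gap hd hθ (by omega))
          ((hu.integrable_gap hd hθ (by omega)).add (hint.const_mul 2)) hpt
    _ ≤ S.gapCost μ θ u t := by
        rw [integral_add (hu.integrable_gap hd hθ (by omega)) (hint.const_mul 2),
          integral_const_mul, gapCost]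
        linarith

theorem HasUniqueOptimal.posDef (hS : S.IsSymmetric) (hθ : IsMarkovChain μ θ S.lam)
    (hpos : ∀ t, t + S.d ≤ S.N → ∀ i, 0 < μ {ω | θ t ω = i}) (h : S.HasUniqueOptimal μ θ) :
    ∀ t, t + S.d ≤ S.N → ∀ i, (S.W t i).PosDef := by
  have hd := hS.d_pos
  obtain ⟨u, hu, huniq⟩ := h
  suffices H : ∀ c t, t + S.d + c = S.N → ∀ i, (S.W t i).PosDef from
    fun t ht => H (S.N - (t + S.d)) t (by omega)
  intro c
  induction c using Nat.strong_induction_on with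
  | _ c ih =>
    intro t ht i
    by_contra hW
    have hsym := S.W_isSymm hd hS.Q hS.R hS.PT (by omega : t ≤ S.N) i
    obtain ⟨w₀, hw₀, hneg₀⟩ : ∃ w : Fin m → ℝ, w ≠ 0 ∧ w ⬝ᵥ S.W t i *ᵥ w ≤ 0 := by
      by_contra! hcon
      exact hW (Matrix.PosDef.of_dotProduct_mulVec_pos hsym fun x hx => hcon x hx)
    obtain ⟨w, hw, hneg, hg⟩ : ∃ w : Fin m → ℝ, w ≠ 0 ∧ w ⬝ᵥ S.W t i *ᵥ w ≤ 0 ∧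
        ∫ ω, (if θ t ω = i then
          w ⬝ᵥ (S.W t i *ᵥ u t ω + S.feed t i (S.traj θ u t t ω)) else 0) ∂μ ≤ 0 := by
      -- Replacing $w_0$ by $-w_0$ keeps the curvature and flips the linear term, so one of the two
      -- signs does not increase the cost.
      rcases le_total (∫ ω, (if θ t ω = i then
          w₀ ⬝ᵥ (S.W t i *ᵥ u t ω + S.feed t i (S.traj θ u t t ω)) else 0) ∂μ) 0 with hle | hle
      · exact ⟨w₀, hw₀, hneg₀, hle⟩
      · refine ⟨-w₀, neg_ne_zero.2 hw₀, by simpa [Matrix.mulVec_neg] using hneg₀, ?_⟩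
        have : ∀ ω, (if θ t ω = i then
            -w₀ ⬝ᵥ (S.W t i *ᵥ u t ω + S.feed t i (S.traj θ u t t ω)) else 0)
            = -(if θ t ω = i then
              w₀ ⬝ᵥ (S.W t i *ᵥ u t ω + S.feed t i (S.traj θ u t t ω)) else 0) := by
          intro ω
          split_ifs
          · rw [neg_dotProduct]
          · simp
        simp only [this, integral_neg]
        linarith
    have hadm := hu.1.update t ((hu.1.isPast (by omega) (by omega) le_rfl).comp₂
      (fun x j => x + if j = i then w else 0) (isPast_mode le_rfl))
    have hle := gapCost_update_le hS hθ hu.1 (by omega) hneg hg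
    obtain ⟨v, hv, hvu, hlaw⟩ := hadm.exists_followsLaw hd (t + 1)
    have hvt : v t = fun ω => u t ω + if θ t ω = i then w else 0 := by
      rw [hvu t (by push_cast; omega), Function.update_self]
    have hopt : S.IsOptimal μ θ v := by
      refine ⟨hv, fun v' hv' => le_trans ?_ (hu.2 v' hv')⟩
      have h1 := cost_sub_sum_gapCost hS hθ hu.1 hv
      have h2 : ∑ s ∈ Finset.Icc 0 S.N, S.gapCost μ θ v s
          ≤ ∑ s ∈ Finset.Icc 0 S.N, S.gapCost μ θ u s := by
        -- Gaps before $t$ are unchanged, the gap at $t$ does not grow, and later ones vanish by the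
        -- feedback law, where the induction makes $W$ positive definite.
        refine Finset.sum_le_sum fun s hs => ?_
        rw [Finset.mem_Icc] at hs
        rcases lt_trichotomy s t with hst | rfl | hst
        · refine (gapCost_congr hd fun τ _ h4 => ?_).le
          rw [hvu τ (by push_cast; omega), Function.update_of_ne (by omega)]
        · rw [gapCost_congr hd fun τ _ h4 => hvu τ (by push_cast; omega)]
          exact hle
        · by_cases hsN : s + S.d ≤ S.N
          · have hWs := ih (S.N - (s + S.d)) (by omega) s (by omega)
            rw [gapCost_eq_zero hsN hWs (hlaw s (by omega) hsN)]
            exact gapCost_nonneg hsN hWs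
          · rw [gapCost_late hd (by omega) hs.2, gapCost_late hd (by omega) hs.2]
      linarith
    have hae := huniq v hopt t (by omega)
    -- The two optimal controls differ by $w\ne0$ on all of $\{\theta(t)=i\}$, which uniqueness
    -- would make a null set.
    refine (hpos t (by omega) i).ne' (measure_mono_null ?_ (ae_iff.1 hae))
    intro ω hω
    simp only [Set.mem_ofPred_eq] at hω ⊢
    rw [hvt]
    simpa [hω] using hw

end DelayedMJLS

/-! ### The costate, stationarity and prediction along the optimal trajectory. -/

/-- Elimination of recursively given vectors `U s` from a linear combination of them. -/
theorem sum_mulVec_eq_neg_sum_of_recursion {a b : Type*} [Fintype b] {p : ℕ}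
    {α δ : ℕ → Matrix a b ℝ} {V : ℕ → Matrix b b ℝ} {T : ℕ → ℕ → Matrix b b ℝ}
    {U g : ℕ → b → ℝ}
    (hα : ∀ s ∈ Finset.Icc 1 p, α s = δ s - ∑ r ∈ Finset.Icc 1 (s - 1), α r * V r * T s r)
    (hU : ∀ s ∈ Finset.Icc 1 p, U s = -(V s *ᵥ (g s + ∑ r ∈ Finset.Ioc s p, T r s *ᵥ U r))) :
    ∑ s ∈ Finset.Icc 1 p, δ s *ᵥ U s = -∑ s ∈ Finset.Icc 1 p, α s *ᵥ V s *ᵥ g s := by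
  have h1 : ∑ s ∈ Finset.Icc 1 p, δ s *ᵥ U s = ∑ s ∈ Finset.Icc 1 p, α s *ᵥ U s
      + ∑ s ∈ Finset.Icc 1 p, ∑ r ∈ Finset.Icc 1 (s - 1), α r *ᵥ V r *ᵥ T s r *ᵥ U s := by
    rw [← Finset.sum_add_distrib]
    refine Finset.sum_congr rfl fun s hs => ?_
    rw [hα s hs, Matrix.sub_mulVec, Matrix.sum_mulVec]
    simp only [Matrix.mulVec_mulVec, Matrix.mul_assoc]
    abel
  have h2 : ∑ s ∈ Finset.Icc 1 p, ∑ r ∈ Finset.Icc 1 (s - 1), α r *ᵥ V r *ᵥ T s r *ᵥ U s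
      -- With the triangular sum exchanged, the coefficient of $\alpha_r$ is $U_r$ plus its later
      -- feedback terms, which the recursion for $U_r$ reduces to $-V_r g_r$.
      = ∑ r ∈ Finset.Icc 1 p, ∑ s ∈ Finset.Ioc r p, α r *ᵥ V r *ᵥ T s r *ᵥ U s := by
    refine Finset.sum_comm' fun s r => ?_
    simp only [Finset.mem_Icc, Finset.mem_Ioc]
    omega
  rw [h1, h2, ← Finset.sum_add_distrib, ← Finset.sum_neg_distrib]
  refine Finset.sum_congr rfl fun s hs => ?_
  conv_lhs => rw [hU s hs]
  rw [Matrix.mulVec_neg, Matrix.mulVec_add, Matrix.mulVec_add, Matrix.mulVec_sum, Matrix.mulVec_sum]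
  abel

namespace DelayedMJLS

variable {n m L : ℕ} {S : DelayedMJLS n m L} {Ω : Type*}
  {θ : ℕ → Ω → Fin L} {u : ℤ → Ω → Fin m → ℝ}

theorem alpha_congr {t : ℕ} {l l' : ℕ → Fin L} (h : ∀ s ≤ t, l s = l' s) (j : ℕ) :
    S.alpha j t l = S.alpha j t l' := by
  induction j using Nat.strong_induction_on with
  | _ j ih =>
    rw [← Matrix.transpose_inj, alpha_transpose, alpha_transpose, h t le_rfl]
    congr 1
    refine Finset.sum_congr rfl fun s hs => ?_
    rw [Finset.mem_Icc] at hs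
    rw [ih s (by omega), h (t - s) (by omega)]

theorem isPast_alpha (j t : ℕ) : IsPast θ t fun ω => S.alpha j t fun s => θ s ω :=
  fun _ _ h => alpha_congr h j

/-- The gradient of the minimized cost-to-go along the trajectory. -/
noncomputable def gradient (S : DelayedMJLS n m L) (θ : ℕ → Ω → Fin L) (u : ℤ → Ω → Fin m → ℝ)
    (t : ℕ) (ω : Ω) : Fin n → ℝ :=
  S.PmP0 t (θ t ω) *ᵥ S.state θ u (t + 1) ω + ∑ j ∈ Finset.Icc 1 (S.d - 1),
    (S.delta j t (θ t ω))ᵀ *ᵥ (S.traj θ u t t ω).2 ((t : ℤ) - S.d + j)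

theorem reduced_traj_fst (hd : 0 < S.d) {t : ℕ} (ht : t ≤ S.N) (ω : Ω) (x : Fin n → ℝ) :
    S.reduced t (θ t ω) (S.traj θ u t t ω) (x, 0) = x ⬝ᵥ S.gradient θ u t ω :=
  S.reduced_fst_right hd ht _ _ x

theorem IsAdmissible.isPast_gradient (hd : 0 < S.d) (hu : S.IsAdmissible θ u) {t : ℕ}
    (ht : t ≤ S.N) : IsPast θ t (S.gradient θ u t) :=
  IsPast.comp₂ (fun i (e : Aug n m) => S.PmP0 t i *ᵥ e.1 + ∑ j ∈ Finset.Icc 1 (S.d - 1),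
    (S.delta j t i)ᵀ *ᵥ e.2 ((t : ℤ) - S.d + j)) (isPast_mode le_rfl)
    (hu.isPast_traj hd ht le_rfl le_rfl)

variable [MeasurableSpace Ω] {μ : Measure Ω}

theorem ae_gap_eq_zero (hd : 0 < S.d)
    (hW : ∀ t, t + S.d ≤ S.N → ∀ i, (S.W t i).PosDef)
    (hlaw : ∀ t, t + S.d ≤ S.N → ∀ᵐ ω ∂μ, S.FollowsLaw θ u t ω) {t : ℕ} (ht : t ≤ S.N) :
    ∀ᵐ ω ∂μ, ∀ f, S.gap t (θ t ω) (S.traj θ u t t ω) f = 0 := by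
  by_cases h : t + S.d ≤ S.N
  · filter_upwards [hlaw t h] with ω hω f
    refine S.gap_eq_zero _ _ ?_ ?_
    · rw [Matrix.mulVec_mulVec, Matrix.mul_nonsing_inv _ ((Matrix.isUnit_iff_isUnit_det _).1
        (hW t h _).isUnit), Matrix.one_mulVec]
    · rw [traj_snd_of_le (by omega) le_rfl (by omega)]
      exact hω
  · refine Filter.Eventually.of_forall fun ω f => ?_
    rw [gap, S.feed_late hd (by omega) ht, S.feed_late hd (by omega) ht, S.W_late hd (by omega) ht]
    simp

theorem integral_value_traj (hS : S.IsSymmetric)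
    (hW : ∀ t, t + S.d ≤ S.N → ∀ i, (S.W t i).PosDef)
    (hlaw : ∀ t, t + S.d ≤ S.N → ∀ᵐ ω ∂μ, S.FollowsLaw θ u t ω) {t : ℕ} (ht : t ≤ S.N)
    (f : Ω → Aug n m) : ∫ ω, S.value t (θ t ω) (S.traj θ u t t ω) (f ω) ∂μ
      = ∫ ω, S.reduced t (θ t ω) (S.traj θ u t t ω) (f ω) ∂μ := by
  refine integral_congr_ae ?_
  filter_upwards [ae_gap_eq_zero hS.d_pos hW hlaw ht] with ω hω
  rw [S.value_eq_reduced_add_gap hS.d_pos hS.Q hS.R hS.PT ht, hω, add_zero]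

variable [IsProbabilityMeasure μ]

/-- Under the law `value` and `reduced` agree against every direction. The Bellman recursion in the
direction $(\xi,0)$, for all $\xi$ known at time $t$, is then the costate recursion in weak form. -/
theorem costate_ae_eq_gradient (hS : S.IsSymmetric) (hθ : IsMarkovChain μ θ S.lam)
    (hu : S.IsAdmissible θ u) (hW : ∀ t, t + S.d ≤ S.N → ∀ i, (S.W t i).PosDef)
    (hlaw : ∀ t, t + S.d ≤ S.N → ∀ᵐ ω ∂μ, S.FollowsLaw θ u t ω) :
    ∀ c t : ℕ, t + c = S.N → S.costate μ θ u t =ᵐ[μ] S.gradient θ u t := by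
  have hd := hS.d_pos
  intro c
  induction c with
  | zero =>
    intro t ht
    obtain rfl : t = S.N := ht
    rw [costate_final]
    have hx := hu.isPast_state hd (S.N + 1) le_rfl (le_refl (S.N + 1))
    refine (ae_eq_condExp_of_integral_dotProduct_eq hθ.measurable
      ((IsPast.comp₂ (fun i x => S.PT i *ᵥ x) (isPast_mode le_rfl)
        (hx.mono (Nat.le_succ _))).integrable hθ.measurable)
      (hu.isPast_gradient hd le_rfl) fun ξ hξ => ?_).symm
    simp only [← reduced_traj_fst hd (le_refl S.N)]
    rw [← integral_value_traj hS hW hlaw le_rfl, hθ.integral_next (φ := fun j ω =>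
      ξ ω ⬝ᵥ S.PT j *ᵥ S.state θ u (S.N + 1) ω) fun j =>
        hξ.comp₂ (fun ξ x => ξ ⬝ᵥ S.PT j *ᵥ x) hx]
    congr 1
    funext ω
    rw [value_final, riccati_final, riccatiFinal]
    simp only [S.Lam_succ S.N S.PT, Matrix.sum_mulVec, dotProduct_sum, Matrix.smul_mulVec,
      dotProduct_smul, smul_eq_mul]
    rfl
  | succ c ih =>
    intro t ht
    have hpred := S.costate_pred μ θ u (k := t + 1) (by omega) (by omega)
    rw [Nat.add_sub_cancel] at hpred
    rw [hpred]
    have hm : IsPast θ (t + 1) (θ (t + 1)) := isPast_mode le_rfl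
    have hx : IsPast θ (t + 1) (S.state θ u (t + 1)) :=
      hu.isPast_state hd (t + 1) (by omega) (by omega)
    have hgr : IsPast θ (t + 1) (S.gradient θ u (t + 1)) := hu.isPast_gradient hd (by omega)
    refine (condExp_congr_ae (g := fun ω => (S.A (t + 1) (θ (t + 1) ω))ᵀ *ᵥ
      S.gradient θ u (t + 1) ω + S.Q (t + 1) (θ (t + 1) ω) *ᵥ S.state θ u (t + 1) ω) ?_).trans ?_
    · filter_upwards [ih (t + 1) (by omega)] with ω hω
      rw [hω]
    refine (ae_eq_condExp_of_integral_dotProduct_eq hθ.measurable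
      ((IsPast.comp₃ (fun i g x => (S.A (t + 1) i)ᵀ *ᵥ g + S.Q (t + 1) i *ᵥ x)
        hm hgr hx).integrable hθ.measurable)
      (hu.isPast_gradient hd (by omega)) fun ξ hξ => ?_).symm
    simp only [← reduced_traj_fst hd (show t ≤ S.N by omega)]
    rw [← integral_value_traj hS hW hlaw (by omega), S.integral_value_step hθ (by omega)
      (hu.isPast_traj hd (by omega) le_rfl le_rfl)
      (hξ.comp fun x => ((x, 0) : Aug n m))]
    congr 1
    funext ω
    rw [advance_traj (by omega) (by omega), advance_fst_zero,
      reduced_traj_congr (c := t) (c' := ((t + 1 : ℕ) : ℤ)) (by omega) (by omega),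
      reduced_traj_fst hd (by omega), stage_apply, dotProduct_add, dotProduct_transpose_mulVec]
    simp only [Pi.zero_apply, zero_dotProduct, ite_self, add_zero]
    exact add_comm _ _

/-- The optimal trajectory is stationary with respect to perturbations of the inputs. -/
theorem integral_reduced_traj_pulse (hS : S.IsSymmetric) (hθ : IsMarkovChain μ θ S.lam)
    (hu : S.IsAdmissible θ u) (hW : ∀ t, t + S.d ≤ S.N → ∀ i, (S.W t i).PosDef)
    (hlaw : ∀ t, t + S.d ≤ S.N → ∀ᵐ ω ∂μ, S.FollowsLaw θ u t ω) {τ : ℕ} {ξ : Ω → Fin m → ℝ}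
    (hξ : IsPast θ τ ξ) : ∀ r : ℕ, r < S.d → τ + r ≤ S.N →
    ∫ ω, S.reduced (τ + r) (θ (τ + r) ω) (S.traj θ u ((τ + r : ℕ) : ℤ) (τ + r) ω)
      (pulse τ (ξ ω)) ∂μ = 0 := by
  have hd := hS.d_pos
  intro r
  induction r with
  | zero =>
    intro _ _
    -- At time $\tau$ the minimization has just removed $u(\tau)$. Stationarity is then carried
    -- forward while the input is pending.
    simp only [S.reduced_pulse_of_out (t := τ + 0) (τ := τ) _ (Or.inr (by simp)), integral_zero]
  | succ r ih =>
    intro hr hN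
    rw [← ih (by omega) (by omega),
      ← integral_value_traj hS hW hlaw (t := τ + r) (by omega),
      S.integral_value_step hθ (by omega) (hu.isPast_traj hd (by omega) le_rfl le_rfl)
      ((hξ.mono (by omega)).comp fun x => (pulse τ x : Aug n m))]
    congr 1
    funext ω
    rw [advance_traj (by omega) (by omega), S.advance_pulse_of_ne _ _ (by push_cast; omega),
      reduced_traj_congr (c := ((τ + r : ℕ) : ℤ)) (c' := ((τ + (r + 1) : ℕ) : ℤ))
        (by push_cast; omega) (by push_cast; omega), stage_apply,
      pulse_of_ne (by push_cast; omega)]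
    simp [add_assoc]

/-- The part of the feedback law at time `K - s` that does not involve the inputs after `K - d` is
the prediction of `α x(K + 1)`. -/
theorem integral_alpha_state (hS : S.IsSymmetric) (hθ : IsMarkovChain μ θ S.lam)
    (hu : S.IsAdmissible θ u) {K : ℕ} (hK : S.d ≤ K + 1) (hKN : K ≤ S.N) (s : ℕ) :
    1 ≤ s → s < S.d → ∀ ξ : Ω → Fin m → ℝ, IsPast θ (K - s) ξ →
    ∫ ω, ξ ω ⬝ᵥ S.feed (K - s) (θ (K - s) ω) (S.traj θ u ((K : ℤ) - S.d) (K - s) ω) ∂μ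
      = ∫ ω, ξ ω ⬝ᵥ (S.alpha s K (fun t => θ t ω) *ᵥ S.state θ u (K + 1) ω) ∂μ := by
  have hd := hS.d_pos
  induction s using Nat.strong_induction_on with
  | _ s ih =>
    intro hs hsd ξ hξ
    set c : ℤ := (K : ℤ) - S.d with hc
    have hτ : (((K - s : ℕ)) : ℤ) = (K : ℤ) - s := by omega
    have htraj : ∀ r ≤ s, ∀ r' ≤ r, IsPast θ (K - r') (S.traj θ u c (K - r)) := fun r hr r' hr' =>
      hu.isPast_traj hd (by omega) (by omega) (by omega)
    have hp : ∀ r ≤ s, IsPast θ (K - r) fun ω => (pulse ((K - s : ℕ) : ℤ) (ξ ω) : Aug n m) :=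
      fun r hr => (hξ.mono (by omega)).comp fun x => (pulse ((K - s : ℕ) : ℤ) x : Aug n m)
    have hlast : ∀ r, r ≤ s → IsPast θ (K - r) (θ (K - r)) := fun r _ => isPast_mode le_rfl
    have hstep : ∀ r, r + 1 ≤ s →
        ∫ ω, S.value (K - (r + 1)) (θ (K - (r + 1)) ω) (S.traj θ u c (K - (r + 1)) ω)
          (pulse ((K - s : ℕ) : ℤ) (ξ ω)) ∂μ
        = ∫ ω, S.reduced (K - r) (θ (K - r) ω) (S.traj θ u c (K - r) ω)
          (pulse ((K - s : ℕ) : ℤ) (ξ ω)) ∂μ := by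
      intro r hr
      rw [S.integral_value_step hθ (by omega) (htraj (r + 1) hr (r + 1) le_rfl) (hp (r + 1) hr)]
      rw [show K - (r + 1) + 1 = K - r by omega]
      congr 1
      funext ω
      have hadv := advance_traj (S := S) (θ := θ) (u := u) (c := c) (t := K - (r + 1))
        (by omega) (by omega) ω
      rw [show K - (r + 1) + 1 = K - r by omega] at hadv
      rw [hadv, S.advance_pulse_of_ne _ _ (by omega), stage_apply, pulse_of_ne (by omega)]
      simp
    -- The truncated trajectory has no input at time $K-r-1$, and neither has the pulse, whose time
    -- is $K-s$. Of the gap only the product of the two feedbacks survives.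
    have hunroll : ∀ r, r + 1 ≤ s →
        ∫ ω, S.reduced (K - r) (θ (K - r) ω) (S.traj θ u c (K - r) ω)
          (pulse ((K - s : ℕ) : ℤ) (ξ ω)) ∂μ
        = ∫ ω, S.reduced K (θ K ω) (S.traj θ u c K ω) (pulse ((K - s : ℕ) : ℤ) (ξ ω)) ∂μ
          - ∑ q ∈ Finset.Icc 1 r, ∫ ω, S.feed (K - q) (θ (K - q) ω)
              (pulse ((K - s : ℕ) : ℤ) (ξ ω)) ⬝ᵥ (S.W (K - q) (θ (K - q) ω))⁻¹ *ᵥ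
                S.feed (K - q) (θ (K - q) ω) (S.traj θ u c (K - q) ω) ∂μ := by
      intro r
      induction r with
      | zero => intro _; simp
      | succ r ihr =>
        intro hr
        rw [Finset.sum_Icc_succ_top (by omega), ← sub_sub, ← ihr (by omega),
          ← hstep r (by omega), ← integral_sub]
        · congr 1
          funext ω
          rw [S.value_eq_reduced_add_gap hd hS.Q hS.R hS.PT (by omega), gap,
            traj_snd_of_lt (by omega), pulse_of_ne (by omega)]
          simp
        · exact (IsPast.comp₃ (fun i e f => S.value (K - (r + 1)) i e f) (hlast (r + 1) (by omega))
            (htraj (r + 1) (by omega) _ le_rfl) (hp (r + 1) (by omega))).integrable hθ.measurable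
        · exact (IsPast.comp₃ (fun i e f => S.feed (K - (r + 1)) i f ⬝ᵥ
            (S.W (K - (r + 1)) i)⁻¹ *ᵥ S.feed (K - (r + 1)) i e) (hlast (r + 1) (by omega))
            (htraj (r + 1) (by omega) _ le_rfl) (hp (r + 1) (by omega))).integrable hθ.measurable
    have hval : ∀ ω, ξ ω ⬝ᵥ S.feed (K - s) (θ (K - s) ω) (S.traj θ u c (K - s) ω)
        = S.value (K - s) (θ (K - s) ω) (S.traj θ u c (K - s) ω)
          (pulse ((K - s : ℕ) : ℤ) (ξ ω)) := by
      intro ω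
      rw [S.value_pulse hd (by omega), traj_snd_of_lt (by omega), Matrix.mulVec_zero, add_zero]
    obtain ⟨r, rfl⟩ : ∃ r, s = r + 1 := ⟨s - 1, by omega⟩
    simp only [hval]
    rw [hstep r le_rfl, hunroll r le_rfl]
    -- At time $K$ the window starts after $K-d$, where the trajectory was truncated: only the state
    -- remains, and it meets the pulse through $\delta$.
    have hK0 : ∀ ω, S.reduced K (θ K ω) (S.traj θ u c K ω) (pulse ((K - (r + 1) : ℕ) : ℤ) (ξ ω))
        = S.state θ u (K + 1) ω ⬝ᵥ (S.delta (S.d - (r + 1)) K (θ K ω))ᵀ *ᵥ ξ ω := by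
      intro ω
      rw [S.reduced_symm hd hS.Q hS.R hS.PT hKN, ← S.reduced_pulse_fst hd (S.d - (r + 1)) hKN
        (by omega) (by omega) (θ K ω) (τ := ((K - (r + 1) : ℕ) : ℤ)) (by omega)]
      refine S.reduced_congr _ _ rfl rfl (fun _ _ _ => rfl) fun τ h1 _ => ?_
      exact traj_snd_of_lt (by omega) _ _
    -- The induction hypothesis, tested against $W^{-1}T\xi$, replaces the feedback at time $K-q$ by
    -- $\alpha x(K+1)$. The resulting sum is the one in the recursion of $\alpha$.
    have hterm : ∀ q ∈ Finset.Icc 1 r, ∫ ω, S.feed (K - q) (θ (K - q) ω)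
              (pulse ((K - (r + 1) : ℕ) : ℤ) (ξ ω)) ⬝ᵥ (S.W (K - q) (θ (K - q) ω))⁻¹ *ᵥ
                S.feed (K - q) (θ (K - q) ω) (S.traj θ u c (K - q) ω) ∂μ
        = ∫ ω, S.state θ u (K + 1) ω ⬝ᵥ ((S.alpha q K (fun t => θ t ω))ᵀ
            * (S.W (K - q) (θ (K - q) ω))⁻¹
            * S.T (S.d - (r + 1) + q) (K - q) (θ (K - q) ω)) *ᵥ ξ ω ∂μ := by
      intro q hq
      rw [Finset.mem_Icc] at hq
      have hinv : ∀ i, ((S.W (K - q) i)⁻¹).IsSymm := fun i =>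
        (S.W_isSymm hd hS.Q hS.R hS.PT (by omega) i).inv
      have := ih q (by omega) hq.1 (by omega) (fun ω => (S.W (K - q) (θ (K - q) ω))⁻¹ *ᵥ
        S.T (S.d - (r + 1) + q) (K - q) (θ (K - q) ω) *ᵥ ξ ω)
        (IsPast.comp₂ (fun i x => (S.W (K - q) i)⁻¹ *ᵥ
          S.T (S.d - (r + 1) + q) (K - q) i *ᵥ x) (isPast_mode le_rfl) (hξ.mono (by omega)))
      refine Eq.trans ?_ (this.trans ?_)
      · congr 1
        funext ω
        rw [S.feed_pulse (K - q) _ (j := S.d - (r + 1) + q) (by omega) (by omega) (by omega),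
          (hinv _).dotProduct_mulVec_comm, dotProduct_comm]
      · congr 1
        funext ω
        rw [← Matrix.mulVec_mulVec, ← Matrix.mulVec_mulVec, dotProduct_transpose_mulVec,
          dotProduct_comm]
    rw [Finset.sum_congr rfl hterm, ← integral_finsetSum, ← integral_sub]
    · congr 1
      funext ω
      rw [hK0, dotProduct_comm (ξ ω), ← dotProduct_transpose_mulVec, alpha_transpose,
        Matrix.sub_mulVec, dotProduct_sub, Matrix.sum_mulVec, dotProduct_sum,
        Nat.add_sub_cancel]
    · have h0 : IsPast θ K (S.traj θ u c K) := hu.isPast_traj hd hKN (by omega) le_rfl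
      exact (IsPast.comp₃ (fun i e f => S.reduced K i e f) (isPast_mode le_rfl)
        h0 (hp 0 (by omega))).integrable hθ.measurable
    · refine (IsPast.sum fun q hq => ?_).integrable hθ.measurable (t := K)
      have h0 : IsPast θ K (S.state θ u (K + 1)) :=
        hu.isPast_state hd (K + 1) (by omega) le_rfl
      have h1 : IsPast θ K fun ω => (S.alpha q K (fun t => θ t ω))ᵀ
            * (S.W (K - q) (θ (K - q) ω))⁻¹
            * S.T (S.d - (r + 1) + q) (K - q) (θ (K - q) ω) :=
        IsPast.comp₂ (fun M i => Mᵀ * (S.W (K - q) i)⁻¹ * S.T (S.d - (r + 1) + q) (K - q) i)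
          (isPast_alpha q K) (isPast_mode (by omega))
      exact IsPast.comp₃ (fun x M y => x ⬝ᵥ M *ᵥ y) h0 h1 (hξ.mono (by omega))
    · intro q hq
      have h0 : IsPast θ K (S.state θ u (K + 1)) :=
        hu.isPast_state hd (K + 1) (by omega) le_rfl
      have h1 : IsPast θ K fun ω => (S.alpha q K (fun t => θ t ω))ᵀ
            * (S.W (K - q) (θ (K - q) ω))⁻¹
            * S.T (S.d - (r + 1) + q) (K - q) (θ (K - q) ω) :=
        IsPast.comp₂ (fun M i => Mᵀ * (S.W (K - q) i)⁻¹ * S.T (S.d - (r + 1) + q) (K - q) i)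
          (isPast_alpha q K) (isPast_mode (by omega))
      exact (IsPast.comp₃ (fun x M y => x ⬝ᵥ M *ᵥ y) h0 h1
        (hξ.mono (by omega))).integrable hθ.measurable

end DelayedMJLS

/-! ### The formulas for the costate and the optimal cost. -/

namespace DelayedMJLS

variable {n m L : ℕ} {S : DelayedMJLS n m L} {Ω : Type*}
  {θ : ℕ → Ω → Fin L} {u : ℤ → Ω → Fin m → ℝ}

/-- Split of the feedback law at time `K - s` into the part with inputs up to the time `K - d` and
the part with later inputs. -/
theorem feed_traj_split {K s : ℕ} (hs : 1 ≤ s) (hsd : s < S.d) (hK : S.d ≤ K + 1)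
    (i : Fin L) (ω : Ω) :
    S.feed (K - s) i (S.traj θ u ((K - s : ℕ) : ℤ) (K - s) ω)
      = S.feed (K - s) i (S.traj θ u ((K : ℤ) - S.d) (K - s) ω)
        + ∑ r ∈ Finset.Ioc s (S.d - 1), S.T (S.d - r + s) (K - s) i *ᵥ
            (S.traj θ u K K ω).2 ((K : ℤ) - r) := by
  rw [feed_apply, feed_apply, add_assoc]
  congr 1
  have hIcc : Finset.Icc 1 (S.d - 1) = Finset.Icc 1 s ∪ Finset.Ioc s (S.d - 1) := by
    ext r
    simp only [Finset.mem_union, Finset.mem_Icc, Finset.mem_Ioc]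
    omega
  have hdisj : Disjoint (Finset.Icc 1 s) (Finset.Ioc s (S.d - 1)) := by
    rw [Finset.disjoint_left]
    intro r
    simp only [Finset.mem_Icc, Finset.mem_Ioc]
    omega
  have hmask : ∀ {c c' τ : ℤ} (t t' : ℕ), τ ≤ c → τ ≤ c' →
      (S.traj θ u c t ω).2 τ = (S.traj θ u c' t' ω).2 τ := by
    intro c c' τ t t' h h'
    unfold traj
    simp only [h, h', true_and]
  rw [hIcc, Finset.sum_union hdisj, Finset.sum_union hdisj, add_assoc]
  congr 1
  · refine Finset.sum_congr rfl fun j hj => ?_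
    rw [Finset.mem_Icc] at hj
    rw [hmask (c' := (K : ℤ) - S.d) _ (K - s) (by omega) (by omega)]
  · have hz : ∑ j ∈ Finset.Ioc s (S.d - 1), S.T j (K - s) i *ᵥ
        (S.traj θ u ((K : ℤ) - S.d) (K - s) ω).2 (((K - s : ℕ) : ℤ) - S.d + j) = 0 := by
      refine Finset.sum_eq_zero fun j hj => ?_
      rw [Finset.mem_Ioc] at hj
      rw [traj_snd_of_lt (by omega), Matrix.mulVec_zero]
    rw [hz, zero_add]
    refine Finset.sum_bij' (fun j _ => S.d + s - j) (fun r _ => S.d + s - r) ?_ ?_ ?_ ?_ ?_ <;>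
      intro j hj <;> rw [Finset.mem_Ioc] at hj
    · rw [Finset.mem_Ioc]; omega
    · rw [Finset.mem_Ioc]; omega
    · omega
    · omega
    · rw [show S.d - (S.d + s - j) + s = j by omega, hmask (c' := (K : ℤ)) _ K (by omega) (by omega)]
      rw [show ((K - s : ℕ) : ℤ) - S.d + j = (K : ℤ) - ((S.d + s - j : ℕ) : ℤ) by omega]

variable [MeasurableSpace Ω] {μ : Measure Ω} [IsProbabilityMeasure μ]

theorem condExp_alpha_state (hS : S.IsSymmetric) (hθ : IsMarkovChain μ θ S.lam)
    (hu : S.IsAdmissible θ u) {K : ℕ} (hK : S.d ≤ K + 1) (hKN : K ≤ S.N) {s : ℕ}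
    (hs : 1 ≤ s) (hsd : s < S.d) :
    (fun ω => S.feed (K - s) (θ (K - s) ω) (S.traj θ u ((K : ℤ) - S.d) (K - s) ω)) =ᵐ[μ]
      μ[fun ω => S.alpha s K (fun t => θ t ω) *ᵥ S.state θ u (K + 1) ω | modeSigma θ (K - s)] := by
  have hd := hS.d_pos
  exact ae_eq_condExp_of_integral_dotProduct_eq hθ.measurable
    ((IsPast.comp₂ (fun M x => M *ᵥ x) (isPast_alpha s K)
      (hu.isPast_state hd (K + 1) (by omega) le_rfl)).integrable hθ.measurable)
    (IsPast.comp₂ (fun i e => S.feed (K - s) i e) (isPast_mode le_rfl)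
      (hu.isPast_traj hd (by omega) (by omega) le_rfl))
    fun ξ hξ => integral_alpha_state hS hθ hu hK hKN s hs hsd ξ hξ

/-- Splitting the law at time $K-s$ into earlier inputs and inputs after $K-d$ gives a triangular
system for the pending inputs. Its inhomogeneous terms are the predictions of $\alpha x(K+1)$, and
solving it turns $\delta$ into $\alpha$. -/
theorem gradient_ae_eq (hS : S.IsSymmetric) (hθ : IsMarkovChain μ θ S.lam)
    (hu : S.IsAdmissible θ u) (hlaw : ∀ t, t + S.d ≤ S.N → ∀ᵐ ω ∂μ, S.FollowsLaw θ u t ω)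
    {K : ℕ} (hK : S.d ≤ K + 1) (hKN : K ≤ S.N) :
    S.gradient θ u K =ᵐ[μ] fun ω => S.PmP0 K (θ K ω) *ᵥ S.state θ u (K + 1) ω
      - S.memoryTerm μ θ u (K + 1) ω := by
  have hd := hS.d_pos
  have hcond : ∀ s : ℕ, ∀ᵐ ω ∂μ, 1 ≤ s → s < S.d →
      S.feed (K - s) (θ (K - s) ω) (S.traj θ u ((K : ℤ) - S.d) (K - s) ω) =
      (μ[fun ω => S.alpha s K (fun t => θ t ω) *ᵥ S.state θ u (K + 1) ω
        | modeSigma θ (K - s)]) ω := by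
    intro s
    by_cases h : 1 ≤ s ∧ s < S.d
    · filter_upwards [condExp_alpha_state hS hθ hu hK hKN h.1 h.2] with ω hω _ _
      exact hω
    · exact Filter.Eventually.of_forall fun ω h1 h2 => absurd ⟨h1, h2⟩ h
  have hfb : ∀ t : ℕ, ∀ᵐ ω ∂μ, t + S.d ≤ S.N → S.FollowsLaw θ u t ω := by
    intro t
    by_cases h : t + S.d ≤ S.N
    · filter_upwards [hlaw t h] with ω hω _
      exact hω
    · exact Filter.Eventually.of_forall fun ω h1 => absurd h1 h
  filter_upwards [ae_all_iff.2 hcond, ae_all_iff.2 hfb] with ω h1 h2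
  have helim := sum_mulVec_eq_neg_sum_of_recursion (p := S.d - 1)
    (α := fun s => (S.alpha s K (fun t => θ t ω))ᵀ)
    (δ := fun s => (S.delta (S.d - s) K (θ K ω))ᵀ)
    (V := fun s => (S.W (K - s) (θ (K - s) ω))⁻¹)
    (T := fun s r => S.T (S.d - s + r) (K - r) (θ (K - r) ω))
    (U := fun s => (S.traj θ u K K ω).2 ((K : ℤ) - s))
    (g := fun s => S.feed (K - s) (θ (K - s) ω) (S.traj θ u ((K : ℤ) - S.d) (K - s) ω))
    (fun s _ => S.alpha_transpose s K _) ?_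
  · have hre : ∑ j ∈ Finset.Icc 1 (S.d - 1), (S.delta j K (θ K ω))ᵀ *ᵥ
          (S.traj θ u K K ω).2 ((K : ℤ) - S.d + j)
        = ∑ s ∈ Finset.Icc 1 (S.d - 1), (S.delta (S.d - s) K (θ K ω))ᵀ *ᵥ
          (S.traj θ u K K ω).2 ((K : ℤ) - s) := by
      refine Finset.sum_bij' (fun j _ => S.d - j) (fun r _ => S.d - r) ?_ ?_ ?_ ?_ ?_ <;>
        intro j hj <;> rw [Finset.mem_Icc] at hj
      · rw [Finset.mem_Icc]; omega
      · rw [Finset.mem_Icc]; omega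
      · omega
      · omega
      · rw [show S.d - (S.d - j) = j by omega]
        rw [show (K : ℤ) - S.d + j = (K : ℤ) - ((S.d - j : ℕ) : ℤ) by omega]
    rw [gradient, hre, helim, memoryTerm, ← sub_eq_add_neg]
    congr 1
    refine Finset.sum_congr rfl fun s hs => ?_
    rw [Finset.mem_Icc] at hs
    rw [show K + 1 - s - 1 = K - s by omega, Nat.add_sub_cancel, h1 s hs.1 (by omega)]
  · intro s hs
    rw [Finset.mem_Icc] at hs
    rw [← feed_traj_split hs.1 (by omega) hK]
    by_cases h : K - s + S.d ≤ S.N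
    · have := h2 (K - s) h
      rw [FollowsLaw] at this
      rw [traj_snd_of_le (by omega) (by omega) (by omega), ← this]
      congr 1
      omega
    -- Beyond $N-d$ the masked input is zero, as is $W^{-1}$ by convention, so the recursion holds
    -- there too.
    · rw [S.W_late hd (by omega) (by omega), Matrix.inv_zero, Matrix.zero_mulVec, neg_zero]
      exact if_neg (by omega)

/-- Time $\tau=d-1$ is the right place to stop: the inputs still pending in `reduced` are
$u(0),\dots,u(d-2)$, all of them controls and none of them given data. Stationarity therefore
removes every input direction, and only the pairing of $x(d)$ with the gradient is left. -/
theorem cost_optimal (hS : S.IsSymmetric) (hθ : IsMarkovChain μ θ S.lam) (hdN : S.d < S.N)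
    (hu : S.IsOptimal μ θ u) (hW : ∀ t, t + S.d ≤ S.N → ∀ i, (S.W t i).PosDef) :
    S.cost μ θ u = ∫ ω, ((∑ k ∈ Finset.range S.d,
        S.state θ u k ω ⬝ᵥ S.Q k (θ k ω) *ᵥ S.state θ u k ω)
      + S.state θ u S.d ω ⬝ᵥ S.gradient θ u (S.d - 1) ω) ∂μ := by
  have hd := hS.d_pos
  have hadm := hu.1
  obtain ⟨K, hK⟩ : ∃ K, S.d = K + 1 := ⟨S.d - 1, by omega⟩
  have hlaw : ∀ t, t + S.d ≤ S.N → ∀ᵐ ω ∂μ, S.FollowsLaw θ u t ω :=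
    fun t ht => hu.ae_followsLaw hS hθ hW ht
  have he : IsPast θ K (S.traj θ u K K) := hadm.isPast_traj hd (by omega) le_rfl le_rfl
  have hm : IsPast θ K (θ K) := isPast_mode le_rfl
  rw [cost_eq hS hθ hadm (τ := K) (by omega) (by omega), Finset.sum_eq_zero, add_zero]
  swap
  · intro t ht
    rw [Finset.mem_Icc] at ht
    exact hu.gapCost_eq_zero hS hθ hW ht.2
  have hred : ∫ ω, S.reduced K (θ K ω) (S.traj θ u K K ω) (S.traj θ u K K ω) ∂μ
      = ∫ ω, S.state θ u (K + 1) ω ⬝ᵥ S.gradient θ u K ω ∂μ := by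
    have hdec : ∀ ω, S.reduced K (θ K ω) (S.traj θ u K K ω) (S.traj θ u K K ω)
        = S.state θ u (K + 1) ω ⬝ᵥ S.gradient θ u K ω + ∑ j ∈ Finset.Icc 1 (S.d - 1),
          S.reduced K (θ K ω) (S.traj θ u K K ω)
            (pulse ((j - 1 : ℕ) : ℤ) ((S.traj θ u K K ω).2 ((j - 1 : ℕ) : ℤ))) := by
      intro ω
      rw [reduced_decomp, S.reduced_symm hd hS.Q hS.R hS.PT (by omega),
        ← reduced_traj_fst hd (by omega)]
      congr 1
      refine Finset.sum_congr rfl fun j hj => ?_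
      rw [Finset.mem_Icc] at hj
      rw [S.reduced_symm hd hS.Q hS.R hS.PT (by omega),
        show (K : ℤ) - S.d + j = ((j - 1 : ℕ) : ℤ) by omega]
    have hpast : ∀ j ∈ Finset.Icc 1 (S.d - 1), IsPast θ K fun ω =>
          S.reduced K (θ K ω) (S.traj θ u K K ω)
            (pulse ((j - 1 : ℕ) : ℤ) ((S.traj θ u K K ω).2 ((j - 1 : ℕ) : ℤ))) := by
      intro j _
      exact IsPast.comp₂ (fun i (e : Aug n m) => S.reduced K i e
        (pulse ((j - 1 : ℕ) : ℤ) (e.2 ((j - 1 : ℕ) : ℤ)))) hm he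
    simp only [hdec]
    rw [integral_add, integral_finsetSum _ fun j hj => (hpast j hj).integrable hθ.measurable,
      Finset.sum_eq_zero, add_zero]
    · intro j hj
      rw [Finset.mem_Icc] at hj
      obtain ⟨r, hr⟩ : ∃ r, K = j - 1 + r := ⟨K - (j - 1), by omega⟩
      have hξ : IsPast θ (j - 1) fun ω => (S.traj θ u K K ω).2 ((j - 1 : ℕ) : ℤ) := by
        by_cases h : j - 1 + S.d ≤ S.N
        · intro ω ω' hω
          dsimp only
          rw [traj_snd_of_le (by omega) (by omega) (by omega),
            traj_snd_of_le (by omega) (by omega) (by omega)]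
          exact hadm.isPast (τ := ((j - 1 : ℕ) : ℤ)) (by omega) (by omega) le_rfl ω ω' hω
        · have : ∀ ω, (S.traj θ u K K ω).2 ((j - 1 : ℕ) : ℤ) = 0 := fun ω => if_neg (by omega)
          simp only [this]
          exact isPast_const _
      have := integral_reduced_traj_pulse hS hθ hadm hW hlaw hξ r (by omega) (by omega)
      rwa [← hr] at this
    · exact (IsPast.comp₂ (fun x y => x ⬝ᵥ y)
        (hadm.isPast_state hd (K + 1) (by omega) le_rfl)
        (hadm.isPast_gradient hd (by omega))).integrable hθ.measurable
    · exact (IsPast.sum hpast).integrable hθ.measurable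
  rw [hred, ← integral_add, hK, Nat.add_sub_cancel]
  · refine (IsPast.sum (t := S.N) fun k hk => ?_).integrable hθ.measurable
    rw [Finset.mem_range] at hk
    exact IsPast.comp₂ (fun i x => x ⬝ᵥ S.Q k i *ᵥ x) (isPast_mode (by omega))
      (hadm.isPast_state hd k (by omega) (by omega))
  · exact (IsPast.comp₂ (fun x y => x ⬝ᵥ y)
        (hadm.isPast_state hd (K + 1) (by omega) le_rfl)
        (hadm.isPast_gradient hd (by omega))).integrable hθ.measurable

end DelayedMJLS

theorem theorem1 {n m L : ℕ} (S : DelayedMJLS n m L) (hd : 0 < S.d) (hN : S.d < S.N)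
    (hQ : ∀ k, k ≤ S.N → ∀ i, (S.Q k i).PosSemidef)
    (hR : ∀ k, S.d ≤ k → k ≤ S.N → ∀ i, (S.R k i).PosSemidef)
    (hPT : ∀ i, (S.PT i).IsSymm)
    {Ω : Type*} [MeasurableSpace Ω] (μ : Measure Ω) [IsProbabilityMeasure μ]
    (θ : ℕ → Ω → Fin L) (hθ : IsMarkovChain μ θ S.lam)
    (hpos : ∀ t, t + S.d ≤ S.N → ∀ i, 0 < μ {ω | θ t ω = i}) :
    (S.HasUniqueOptimal μ θ ↔
      ∀ k, S.d ≤ k → k ≤ S.N → ∀ i, (S.W (k - S.d) i).PosDef) ∧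
    ((∀ k, S.d ≤ k → k ≤ S.N → ∀ i, (S.W (k - S.d) i).PosDef) →
      ∀ u, S.IsOptimal μ θ u →
        (∀ t : ℕ, t + S.d ≤ S.N → u t =ᵐ[μ] fun ω =>
          -((S.W t (θ t ω))⁻¹ *ᵥ S.T0 t (θ t ω) *ᵥ S.state θ u (t + 1) ω)
            - ∑ j ∈ Finset.Icc 1 (S.d - 1),
                (S.W t (θ t ω))⁻¹ *ᵥ S.T j t (θ t ω) *ᵥ u ((t : ℤ) - S.d + j) ω) ∧
        (∀ k, S.d ≤ k → k ≤ S.N + 1 → S.costate μ θ u (k - 1) =ᵐ[μ] fun ω =>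
          S.PmP0 (k - 1) (θ (k - 1) ω) *ᵥ S.state θ u k ω - S.memoryTerm μ θ u k ω) ∧
        S.cost μ θ u = ∫ ω, ((∑ k ∈ Finset.range S.d,
              S.state θ u k ω ⬝ᵥ S.Q k (θ k ω) *ᵥ S.state θ u k ω)
            + S.state θ u S.d ω ⬝ᵥ S.PmP0 (S.d - 1) (θ (S.d - 1) ω) *ᵥ S.state θ u S.d ω
            - S.state θ u S.d ω ⬝ᵥ S.memoryTerm μ θ u S.d ω) ∂μ) := by
  have hS : S.IsSymmetric :=
    ⟨hd, fun k hk i => (hQ k hk i).isHermitian, fun k h1 h2 i => (hR k h1 h2 i).isHermitian, hPT⟩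
  have hshift : (∀ k, S.d ≤ k → k ≤ S.N → ∀ i, (S.W (k - S.d) i).PosDef) ↔
      ∀ t, t + S.d ≤ S.N → ∀ i, (S.W t i).PosDef := by
    refine ⟨fun h t ht i => ?_, fun h k h1 h2 i => h _ (by omega) i⟩
    have := h (t + S.d) (by omega) ht i
    rwa [Nat.add_sub_cancel] at this
  rw [hshift]
  refine ⟨⟨fun h => h.posDef hS hθ hpos, DelayedMJLS.hasUniqueOptimal_of_posDef hS hθ⟩,
    fun hW u hu => ?_⟩
  have hlaw : ∀ t, t + S.d ≤ S.N → ∀ᵐ ω ∂μ, S.FollowsLaw θ u t ω :=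
    fun t ht => hu.ae_followsLaw hS hθ hW ht
  refine ⟨fun t ht => ?_, fun k h1 h2 => ?_, ?_⟩
  · filter_upwards [hlaw t ht] with ω hω
    rw [DelayedMJLS.FollowsLaw] at hω
    rw [hω, DelayedMJLS.feed_traj ht, Matrix.mulVec_add, Matrix.mulVec_sum, neg_add]
    exact (sub_eq_add_neg _ _).symm
  · obtain ⟨K, rfl⟩ : ∃ K, k = K + 1 := ⟨k - 1, by omega⟩
    exact (DelayedMJLS.costate_ae_eq_gradient hS hθ hu.1 hW hlaw (S.N - K) K (by omega)).trans
      (DelayedMJLS.gradient_ae_eq hS hθ hu.1 hlaw h1 (by omega))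
  · rw [DelayedMJLS.cost_optimal hS hθ hN hu hW]
    have hgrad := DelayedMJLS.gradient_ae_eq hS hθ hu.1 hlaw (K := S.d - 1) (by omega) (by omega)
    rw [Nat.sub_add_cancel hd] at hgrad
    refine integral_congr_ae ?_
    filter_upwards [hgrad] with ω hω
    rw [hω, dotProduct_sub, add_sub_assoc]
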